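/- **Proposition (Discrete Exterior Derivative).** Let $\mathcal T$ be a finite simplicial complex (flat simplices in a real normed space, e.g. $\mathbb R^3$) triangulating an oriented surface $\Gamma_h$ without boundary: $\mathcal T$ is purely two-dimensional, every edge lies in exactly two facets, and the facets around each vertex form a single cycle. Let $\mathcal T^r$ be the set of $r$-cells, with arbitrary inner orientations (nodes positively oriented), $\boldsymbol\lambda^r_t$, $t\in\mathcal T^r$, the Whitney $r$-forms, and $D^r_{st}$ the incidence numbers of $s\in\mathcal T^r$ in $\partial t$, $t\in\mathcal T^{r+1}$. Let $\widetilde{\mathcal T}$ be the barycentric refinement, with arbitrarily oriented cells $w\in\widetilde{\mathcal T}^q$ and Whitney forms $\tilde{\boldsymbol\lambda}^q_w$. For $q+r=2$ and $t\in\mathcal T^r$ let $\star t$ be the barycentric dual $q$-cell, oriented such that $(\star t,t)$ is in the orientation of $\Gamma_h$; as a chain, $\star t=\sum_w c^q_{\star t\,w}\,w$ with $c^q_{\star t\,w}\in\{-1,0,1\}$, and $n_{\star t}=\sum_w|c^q_{\star t\,w}|$. Define $U^2_{\star t}=\overline{\star t}$ for nodes $t$ and, for $q=1,0$, $U^q_{\star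 t}=\bigcup_s U^{q+1}_{\star s}$, the union over the codimension-one faces $s$ of $t$ (equivalently, over the dual $(q+1)$-cells $\star s$ with $\star t\subset\partial\star s$). Then: 1. For $r=0,1,2$ the forms $\boldsymbol\lambda^r_s$, $s\in\mathcal T^r$, are linearly independent, and for $r=0,1$ $$\mathrm d\boldsymbol\lambda^r_s=\sum_{t\in\mathcal T^{r+1}}D^r_{st}\,\boldsymbol\lambda^{r+1}_t ,\qquad s\in\mathcal T^r .$$ 2. There is exactly one family of real coefficients $R^q_{vw}$ ($q=0,1,2$, $v=\star t$ with $t\in\mathcal T^{2-q}$, $w\in\widetilde{\mathcal T}^q$) such that the forms $\boldsymbol\mu^q_v=\sum_{w\in\widetilde{\mathcal T}^q}R^q_{vw}\tilde{\boldsymbol\lambda}^q_w$ satisfy * (local support) $\operatorname{supp}\boldsymbol\mu^q_v=U^q_v$, and $\boldsymbol\mu^q_v$ has zero trace on the boundary $\partial U^q_v$ of $U^q_v$ in $\Gamma_h$, implemented by $R^q_{vw}=0$ for $w\not\subset U^q_v$ and for $w\subset\partial U^q_v$; * (equal weight) $R^q_{vw}=c^q_{vw}/n_v$ whenever $c^q_{vw}\neq0$;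 * (stability) for $q=1$ and $v=\star t$, $R^1_{vw}=0$ for all $w$ contained in the primal edge $t$; * (discrete exterior derivative) for $r=0,1$ and $q=2-r$, $$\mathrm d\boldsymbol\mu^{q-1}_{\star t}=(-1)^r\sum_{s\in\mathcal T^r}D^r_{st}\,\boldsymbol\mu^q_{\star s},\qquad t\in\mathcal T^{r+1}.$$ 3. For these coefficients and each $q$ the forms $\boldsymbol\mu^q_v$ are linearly independent, so they are a basis of their span $\mathcal B^q$; the matrix of $\mathrm d$ in the bases $\boldsymbol\mu^{q-1},\boldsymbol\mu^q$ is $(-1)^r$ times the transpose of the matrix $D^r$ of $\mathrm d$ in the bases $\boldsymbol\lambda^r,\boldsymbol\lambda^{r+1}$. -/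

import Mathlib

noncomputable section

namespace BuffaChristiansen

variable {E : Type*} [NormedAddCommGroup E] [NormedSpace ℝ E]

/-! ### Cells, the barycentric refinement, closed triangulated surfaces -/

/-- The `k`-dimensional cells of a family `F` of simplices, a simplex being given by its vertices. -/
abbrev Cell (F : Set (Finset E)) (k : ℕ) : Type _ := {s : Finset E // s ∈ F ∧ s.card = k + 1}

/-- The barycenter of a simplex. -/
def barycenter (s : Finset E) : E := (s.card : ℝ)⁻¹ • ∑ x ∈ s, x

/-- The simplices of the barycentric refinement: their vertices are the barycenters of the members
of a non-empty flag of simplices of `F`. -/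
def sdFaces (F : Set (Finset E)) : Set (Finset E) :=
  {w | ∃ C : Finset (Finset E), C.Nonempty ∧ (∀ s ∈ C, s ∈ F) ∧
    IsChain (· ⊆ ·) (C : Set (Finset E)) ∧ (w : Set E) = barycenter '' (C : Set (Finset E))}

/-- A finite simplicial complex in `E` that triangulates a surface without boundary: it is purely
two-dimensional, every edge lies in exactly two facets, and the facets at a vertex form one cycle
(any two of them are joined by a sequence of facets at this vertex in which consecutive ones share
an edge at this vertex). -/
structure ClosedTriangulatedSurface (E : Type*) [NormedAddCommGroup E] [NormedSpace ℝ E]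
    extends Geometry.SimplicialComplex ℝ E where
  finite_faces : faces.Finite
  pure_two : ∀ s ∈ faces, ∃ t ∈ faces, s ⊆ t ∧ t.card = 3
  two_facets : ∀ e ∈ faces, e.card = 2 →
    {t : Finset E | t ∈ faces ∧ t.card = 3 ∧ e ⊆ t}.ncard = 2
  link_connected : ∀ (a : E) (t t' : Finset E), t ∈ faces → t.card = 3 → a ∈ t →
    t' ∈ faces → t'.card = 3 → a ∈ t' →
    Relation.ReflTransGen
      (fun u v : Finset E => (u ∈ faces ∧ u.card = 3) ∧ (v ∈ faces ∧ v.card = 3) ∧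
        ∃ e ∈ faces, e.card = 2 ∧ a ∈ e ∧ e ⊆ u ∧ e ⊆ v) t t'

theorem sdFaces_finite {F : Set (Finset E)} (hF : F.Finite) : (sdFaces F).Finite := by
  classical
  refine ((hF.toFinset.powerset.finite_toSet).image
    (fun C : Finset (Finset E) => C.image barycenter)).subset ?_
  rintro w ⟨C, -, hC, -, hw⟩
  refine ⟨C, ?_, ?_⟩
  · simp only [Finset.coe_powerset, Set.mem_preimage, Set.mem_powerset_iff]
    intro s hs
    simpa using hC s hs
  · apply Finset.coe_injective
    simp [hw]

instance (T : ClosedTriangulatedSurface E) (k : ℕ) : Fintype (Cell T.faces k) :=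
  @Fintype.ofFinite _ ((T.finite_faces.subset fun _ h => h.1).to_subtype)

instance (T : ClosedTriangulatedSurface E) (k : ℕ) : Fintype (Cell (sdFaces T.faces) k) :=
  @Fintype.ofFinite _ (((sdFaces_finite T.finite_faces).subset fun _ h => h.1).to_subtype)

/-! ### Oriented cells and incidence numbers -/

/-- An (arbitrary) inner orientation of every cell, given by an enumeration of its vertices. -/
abbrev Numbering (F : Set (Finset E)) : Type _ :=
  ∀ (k : ℕ) (s : Cell F k), Fin (k + 1) ≃ {x : E // x ∈ s.1}

/-- The vertices of the cell `s` in the order given by `o`. -/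
def Numbering.vert {F : Set (Finset E)} (o : Numbering F) {k : ℕ} (s : Cell F k) :
    Fin (k + 1) → E := fun i => (o k s i : E)

open Classical in
/-- The incidence number of `s` in the boundary of `t`: the boundary of `[p₀, …, p_{r+1}]` is
`∑ i, (-1) ^ i [p₀, …, p̂ᵢ, …, p_{r+1}]`, and a permutation of the vertices multiplies an oriented
simplex by its sign. -/
def incidence {F : Set (Finset E)} (o : Numbering F) {r : ℕ} (s : Cell F r)
    (t : Cell F (r + 1)) : ℤ :=
  ∑ i : Fin (r + 2), ∑ π : Equiv.Perm (Fin (r + 1)),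
    if ∀ j, o.vert s (π j) = o.vert t (i.succAbove j) then
      (-1) ^ (i : ℕ) * (Equiv.Perm.sign π : ℤ) else 0

/-- An orientation of the surface: a sign for every facet, telling whether the orientation of the
facet agrees with that of the surface, such that the sum of the facets with these signs is
a cycle. -/
structure SurfaceOrientation (T : ClosedTriangulatedSurface E) (o : Numbering T.faces) where
  sign : Cell T.faces 2 → ℤˣ
  closed : ∀ e : Cell T.faces 1, ∑ t : Cell T.faces 2, (sign t : ℤ) * incidence o e t = 0

/-! ### Piecewise differential forms and Whitney forms -/

/-- The space of vectors tangent to a simplex. -/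
abbrev Tangent (s : Finset E) : Submodule ℝ E := vectorSpan ℝ (s : Set E)

theorem sub_mem_tangent {s : Finset E} {a b : E} (ha : a ∈ s) (hb : b ∈ s) :
    a - b ∈ Tangent s := by
  simpa using vsub_mem_vectorSpan ℝ (s := (s : Set E)) (by simpa using ha) (by simpa using hb)

open Classical in
/-- `ℓ` is the differential of the hat function on the simplex `s` that is affine, equal to `1` at
the vertex `p` and to `0` at all other vertices (of the zero function if `p` is no vertex). -/
def IsHatDifferential (s : Finset E) (p : E) (ℓ : Tangent s →L[ℝ] ℝ) : Prop :=
  ∀ (a b : E) (ha : a ∈ s) (hb : b ∈ s), ℓ ⟨a - b, sub_mem_tangent ha hb⟩ =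
    (if a = p then 1 else 0) - (if b = p then 1 else 0)

theorem exists_isHatDifferential {s : Finset E}
    (hs : AffineIndependent ℝ ((↑) : s → E)) (p : E) :
    ∃ ℓ : Tangent s →L[ℝ] ℝ, IsHatDifferential s p ℓ := by
  classical
  by_cases hp : p ∈ s
  · obtain ⟨B, hsB, hB, htop⟩ := exists_subset_affineIndependent_affineSpan_eq_top
      (s := (s : Set E)) hs
    let b : AffineBasis B ℝ E := ⟨((↑) : B → E), hB, by simpa using htop⟩
    have hcoord : ∀ (a : E) (ha : a ∈ s),
        b.coord ⟨p, hsB (by simpa using hp)⟩ a = if a = p then 1 else 0 := by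
      intro a ha
      have := b.coord_apply ⟨p, hsB (by simpa using hp)⟩ ⟨a, hsB (by simpa using ha)⟩
      have hb : b ⟨a, hsB (by simpa using ha)⟩ = a := rfl
      rw [hb] at this
      rw [this]
      simp [eq_comm]
    have : FiniteDimensional ℝ (Tangent s) :=
      finiteDimensional_vectorSpan_of_finite ℝ s.finite_toSet
    refine ⟨LinearMap.toContinuousLinearMap
      ((b.coord ⟨p, hsB (by simpa using hp)⟩).linear ∘ₗ (Tangent s).subtype), ?_⟩
    intro x y hx hy
    have := (b.coord ⟨p, hsB (by simpa using hp)⟩).linearMap_vsub x y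
    simp only [vsub_eq_sub] at this
    rw [hcoord x hx, hcoord y hy] at this
    exact this
  · refine ⟨0, fun a b ha hb => ?_⟩
    rw [if_neg (by rintro rfl; exact hp ha), if_neg (by rintro rfl; exact hp hb)]
    simp

theorem IsHatDifferential.unique {s : Finset E} {p : E} {ℓ ℓ' : Tangent s →L[ℝ] ℝ}
    (h : IsHatDifferential s p ℓ) (h' : IsHatDifferential s p ℓ') : ℓ = ℓ' := by
  ext ⟨v, hv⟩
  induction hv using Submodule.span_induction with
  | mem x hx =>
    obtain ⟨a, ha, b, hb, rfl⟩ := hx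
    exact (h a b (by simpa using ha) (by simpa using hb)).trans
      (h' a b (by simpa using ha) (by simpa using hb)).symm
  | zero => exact (map_zero ℓ).trans (map_zero ℓ').symm
  | add x y hx hy ihx ihy =>
    exact (map_add ℓ ⟨x, hx⟩ ⟨y, hy⟩).trans
      ((congrArg₂ (· + ·) ihx ihy).trans (map_add ℓ' ⟨x, hx⟩ ⟨y, hy⟩).symm)
  | smul c x hx ih =>
    exact (map_smul ℓ c ⟨x, hx⟩).trans
      ((congrArg (c • ·) ih).trans (map_smul ℓ' c ⟨x, hx⟩).symm)

open Classical in
/-- The differential of the hat function of `p` on the simplex `s`; it exists and is unique for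
affinely independent vertices by the two facts above. -/
def hatDifferential (s : Finset E) (p : E) : Tangent s →L[ℝ] ℝ :=
  if h : ∃ ℓ : Tangent s →L[ℝ] ℝ, IsHatDifferential s p ℓ then h.choose else 0

open Classical in
/-- The hat function of `p` on the simplex `s`, at the point `barycenter s + y`. -/
def hat (s : Finset E) (p : E) (y : Tangent s) : ℝ :=
  (if p ∈ s then (s.card : ℝ)⁻¹ else 0) + hatDifferential s p y

/-- Piecewise differential `q`-forms on a triangulated surface. The form on the facet `τ` is written
in the coordinate `y` that stands for the point `barycenter τ + y` of the plane of `τ`. (All forms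
below are polynomial on every facet, hence given on its whole plane.) -/
abbrev PForm (F : Set (Finset E)) (q : ℕ) : Type _ :=
  ∀ τ : Cell F 2, Tangent τ.1 → (Tangent τ.1) [⋀^Fin q]→L[ℝ] ℝ

/-- The exterior derivative, facet by facet. -/
def PForm.d {F : Set (Finset E)} {q : ℕ} (ω : PForm F q) : PForm F (q + 1) :=
  fun τ => extDeriv (ω τ)

/-- The support of a piecewise form: the closure of the set of points where it does not vanish. -/
def PForm.supp {F : Set (Finset E)} {q : ℕ} (ω : PForm F q) : Set E :=
  closure {x | ∃ (τ : Cell F 2) (y : Tangent τ.1), x = barycenter τ.1 + (y : E) ∧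
    x ∈ convexHull ℝ (τ.1 : Set E) ∧ ω τ y ≠ 0}

/-- The determinant as a continuous alternating form on `ℝ^q`. -/
def detForm (q : ℕ) : (Fin q → ℝ) [⋀^Fin q]→L[ℝ] ℝ :=
  { (Matrix.detRowAlternating : (Fin q → ℝ) [⋀^Fin q]→ₗ[ℝ] ℝ) with
    cont := by
      have : Continuous fun M : Matrix (Fin q) (Fin q) ℝ => M.det :=
        Continuous.matrix_det continuous_id
      exact this }

/-- The wedge product of `q` covectors. -/
def wedge {V : Type*} [NormedAddCommGroup V] [NormedSpace ℝ V] {q : ℕ}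
    (ℓ : Fin q → V →L[ℝ] ℝ) : V [⋀^Fin q]→L[ℝ] ℝ :=
  (detForm q).compContinuousLinearMap (ContinuousLinearMap.pi ℓ)

/-- The Whitney form of the oriented simplex `[p₀, …, p_q]`, that is,
`q! ∑ i, (-1) ^ i λᵢ dλ₀ ∧ … d̂λᵢ … ∧ dλ_q` with the hat functions `λᵢ` of the vertices. -/
def whitney (F : Set (Finset E)) {q : ℕ} (p : Fin (q + 1) → E) : PForm F q := fun τ y =>
  (q.factorial : ℝ) • ∑ i : Fin (q + 1), ((-1) ^ (i : ℕ) * hat τ.1 (p i) y) •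
    wedge fun j : Fin q => hatDifferential τ.1 (p (i.succAbove j))

/-- The standard basis form `λ_s` of the Whitney space, for an oriented cell `s`. -/
def whitneyBasis {F : Set (Finset E)} (o : Numbering F) {q : ℕ} (s : Cell F q) : PForm F q :=
  whitney F (o.vert s)

/-! ### The barycentric dual mesh

The dual cell `⋆t` is referred to by the primal cell `t`. -/

/-- The simplices of the barycentric refinement that make up the closed dual cell `⋆t`: those whose
vertices are barycenters of simplices containing `t`. -/
def InDual (T : ClosedTriangulatedSurface E) (t w : Finset E) : Prop :=
  w ∈ sdFaces T.faces ∧ ∀ x ∈ w, ∃ s ∈ T.faces, t ⊆ s ∧ x = barycenter s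

/-- The closed dual cell as a set of points. -/
def dualCell (T : ClosedTriangulatedSurface E) (t : Finset E) : Set E :=
  ⋃ (w : Finset E) (_ : InDual T t w), convexHull ℝ (w : Set E)

/-- The edge vectors of an oriented simplex that start at its first vertex. -/
def frame {k : ℕ} (p : Fin (k + 1) → E) : Fin k → E := fun j => p j.succ - p 0

/-- `(v₀, v₁)` is a frame of the plane of the facet `g`, in the orientation of the surface. -/
def IsPositiveFrame {T : ClosedTriangulatedSurface E} {o : Numbering T.faces}
    (σ : SurfaceOrientation T o) (g : Cell T.faces 2) (v : Fin 2 → E) : Prop :=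
  ∃ A : Matrix (Fin 2) (Fin 2) ℝ, (∀ i, v i = ∑ j, A i j • frame (o.vert g) j) ∧
    0 < ((σ.sign g : ℤ) : ℝ) * A.det

open Classical in
/-- The coefficient `c_{vw}` of the oriented cell `w` of the refinement in the chain of the dual
cell `v = ⋆t`. The dual cell is oriented so that the pair `(⋆t, t)` is in the orientation of the
surface, so `c_{vw} = 1` if the same holds for `(w, t)`, and `c_{vw} = -1` otherwise. -/
def chainCoeff {T : ClosedTriangulatedSurface E} {o : Numbering T.faces}
    (o' : Numbering (sdFaces T.faces)) (σ : SurfaceOrientation T o) {q r : ℕ} (h : q + r = 2)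
    (t : Cell T.faces r) (w : Cell (sdFaces T.faces) q) : ℤ :=
  if InDual T t.1 w.1 then
    if ∃ g : Cell T.faces 2, convexHull ℝ (w.1 : Set E) ⊆ convexHull ℝ (g.1 : Set E) ∧
        IsPositiveFrame σ g
          (Fin.append (frame (o'.vert w)) (frame (o.vert t)) ∘ Fin.cast h.symm)
    then 1 else -1
  else 0

/-- The number `n_v` of cells of the refinement in the dual cell `v = ⋆t`. -/
def dualSize {T : ClosedTriangulatedSurface E} {o : Numbering T.faces}
    (o' : Numbering (sdFaces T.faces)) (σ : SurfaceOrientation T o) {q r : ℕ} (h : q + r = 2)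
    (t : Cell T.faces r) : ℤ :=
  ∑ w : Cell (sdFaces T.faces) q, |chainCoeff o' σ h t w|

/-- The region `U_v`, `v = ⋆t`, for a primal `r`-cell `t`. It is the closed dual cell for `r = 0`,
and for larger `r` the union of the regions of those `⋆s` whose boundary contains `⋆t`, that is, of
the `(r - 1)`-dimensional faces `s` of `t`. -/
def supportRegion (T : ClosedTriangulatedSurface E) : ℕ → Finset E → Set E
  | 0, t => dualCell T t
  | r + 1, t => ⋃ (s : Finset E) (_ : s ∈ T.faces ∧ s.card = r + 1 ∧ s ⊆ t), supportRegion T r s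

/-- The boundary of a subset `U` relative to the closed set `X`. -/
def boundaryIn (X U : Set E) : Set E := closure U ∩ closure (X \ U)

/-! ### Buffa-Christiansen basis forms -/

/-- Families `R^q_{vw}` of coefficients, indexed by `v = ⋆t` with `t` a primal `r`-cell, `q + r = 2`,
and by the `q`-cells `w` of the barycentric refinement. -/
abbrev Coeffs (T : ClosedTriangulatedSurface E) : Type _ :=
  ∀ q r : ℕ, q + r = 2 → Cell T.faces r → Cell (sdFaces T.faces) q → ℝ

/-- The form `μ^q_v = ∑ w, R^q_{vw} λ̃_w`, `v = ⋆t`. -/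
def bcForm {T : ClosedTriangulatedSurface E} (o' : Numbering (sdFaces T.faces)) (R : Coeffs T)
    {q r : ℕ} (h : q + r = 2) (t : Cell T.faces r) : PForm (sdFaces T.faces) q :=
  ∑ w : Cell (sdFaces T.faces) q, R q r h t w • whitneyBasis o' w

/-- Local support: the support of `μ^q_v` is `U_v`, and its trace on the boundary of `U_v` is zero.
This is implemented by `R^q_{vw} = 0` for `w ⊄ U_v` and for `w ⊂ ∂U_v`. -/
structure LocalSupport {T : ClosedTriangulatedSurface E} (o' : Numbering (sdFaces T.faces))
    (R : Coeffs T) : Prop where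
  supp_eq : ∀ (q r : ℕ) (h : q + r = 2) (t : Cell T.faces r),
    (bcForm o' R h t).supp = supportRegion T r t.1
  trace_eq_zero : ∀ (q r : ℕ) (h : q + r = 2) (t : Cell T.faces r)
    (τ : Cell (sdFaces T.faces) 2) (w : Finset E), w ∈ sdFaces T.faces → w ⊆ τ.1 →
    convexHull ℝ (w : Set E) ⊆ boundaryIn T.space (supportRegion T r t.1) →
    ∀ y : Tangent τ.1, barycenter τ.1 + (y : E) ∈ convexHull ℝ (w : Set E) →
    ∀ v : Fin q → Tangent τ.1, (∀ i, (v i : E) ∈ Tangent w) → bcForm o' R h t τ y v = 0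
  coeff_outside : ∀ (q r : ℕ) (h : q + r = 2) (t : Cell T.faces r)
    (w : Cell (sdFaces T.faces) q),
    ¬ convexHull ℝ (w.1 : Set E) ⊆ supportRegion T r t.1 → R q r h t w = 0
  coeff_boundary : ∀ (q r : ℕ) (h : q + r = 2) (t : Cell T.faces r)
    (w : Cell (sdFaces T.faces) q),
    convexHull ℝ (w.1 : Set E) ⊆ boundaryIn T.space (supportRegion T r t.1) → R q r h t w = 0

/-- Equal weights: all cells `w` contained in the dual cell `v` contribute to `μ^q_v` with the same
weight, `R^q_{vw} = c_{vw} / n_v`. -/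
def EqualWeight {T : ClosedTriangulatedSurface E} {o : Numbering T.faces}
    (o' : Numbering (sdFaces T.faces)) (σ : SurfaceOrientation T o) (R : Coeffs T) : Prop :=
  ∀ (q r : ℕ) (h : q + r = 2) (t : Cell T.faces r) (w : Cell (sdFaces T.faces) q),
    chainCoeff o' σ h t w ≠ 0 →
      R q r h t w = (chainCoeff o' σ h t w : ℝ) / (dualSize o' σ h t : ℝ)

/-- Stability: for `q = r = 1`, the cells `w` contained in the primal edge `t` do not contribute to
the form of the dual edge `⋆t`. -/
def Stability {T : ClosedTriangulatedSurface E} (R : Coeffs T) : Prop :=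
  ∀ (h : 1 + 1 = 2) (t : Cell T.faces 1) (w : Cell (sdFaces T.faces) 1),
    convexHull ℝ (w.1 : Set E) ⊆ convexHull ℝ (t.1 : Set E) → R 1 1 h t w = 0

/-- The exterior derivative of the forms `μ` is given by the transposed incidence matrices, up to
the sign `(-1) ^ r`: `d μ_{⋆t} = (-1) ^ r ∑ s, D_{st} μ_{⋆s}` for primal `(r + 1)`-cells `t`. -/
def DiscreteExteriorDerivative {T : ClosedTriangulatedSurface E} (o : Numbering T.faces)
    (o' : Numbering (sdFaces T.faces)) (R : Coeffs T) : Prop :=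
  ∀ (q r : ℕ) (h : q + (r + 1) = 2) (h' : (q + 1) + r = 2) (t : Cell T.faces (r + 1)),
    (bcForm o' R h t).d =
      (-1 : ℝ) ^ r • ∑ s : Cell T.faces r, (incidence o s t : ℝ) • bcForm o' R h' s

end BuffaChristiansen

end

noncomputable section

namespace BuffaChristiansen

set_option linter.unusedSectionVars false

open scoped Classical

variable {E : Type*} [NormedAddCommGroup E] [NormedSpace ℝ E]

/-! ### Barycentric coordinates -/

/-! A combination of Whitney forms is determined by its coefficients: at the first vertex of an
oriented simplex, on the edge vectors starting there, it takes the value q! times the coefficient of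
that simplex (`evalFrame_sum_whitneyBasis`). This gives linear independence. Since d of a Whitney
form is expressed by incidence numbers (`d_whitneyBasis`), every identity between exterior
derivatives becomes an identity between cochains (`d_sum_whitneyBasis_eq_iff`).

The triangles of the refinement correspond to flags (a, e, f) of a node, an edge and a facet. A
simplex w of the refinement comes from a chain of cells; let s be the least member. The triangles
containing w are flags whose node can be any vertex of s and nothing else. Hence w lies in U_{⋆t}
iff s meets t, and in the boundary iff moreover s ⊄ t. The support condition thus amounts to two
facts: coefficients vanish unless s ⊆ t (`SupportedInside`), and no triangle of U_{⋆t} carries only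
zero coefficients.

What remains is a linear system, solved from degree 2 downwards. In degree 2 the equal weights fix
everything. In degree 1, for an edge e with node a, the values on the two halves of ⋆e are given.
The unknowns are the values on the segments from a to the barycenters of the edges and facets around
it, and their differences along the link cycle of a are prescribed. Such a potential exists iff the
signed sum of the differences vanishes (`exists_potential`). It does: each half of ⋆e contributes
1/2, while the n_a triangles at a contribute 1/n_a each, with the opposite sign. The potential is
unique up to a constant because the link is connected, and stability fixes the constant. In degree 0
all values are forced: for a facet f they are ±1 at its barycenter, half of this at its edges, 2/n_a
of this at its nodes, and 0 off f. That these values are consistent uses that the boundary of a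
boundary is zero and that the two facets at an edge are compatibly oriented (`exists_vertexSystem`).

The forms are independent because a cell of the refinement with least member t has a nonzero
coefficient in μ_{⋆t} and in no other form of that degree. -/

theorem exists_coord {s : Finset E} (hs : AffineIndependent ℝ ((↑) : s → E)) (p : E) :
    ∃ α : E →ᵃ[ℝ] ℝ, ∀ x ∈ s, α x = if x = p then 1 else 0 := by
  by_cases hp : p ∈ s
  · obtain ⟨B, hsB, hB, htop⟩ := exists_subset_affineIndependent_affineSpan_eq_top
      (s := (s : Set E)) hs
    let b : AffineBasis B ℝ E := ⟨((↑) : B → E), hB, by simpa using htop⟩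
    refine ⟨b.coord ⟨p, hsB (by simpa using hp)⟩, fun a ha => ?_⟩
    have := b.coord_apply ⟨p, hsB (by simpa using hp)⟩ ⟨a, hsB (by simpa using ha)⟩
    have hb : b ⟨a, hsB (by simpa using ha)⟩ = a := rfl
    rw [hb] at this
    rw [this]
    simp [eq_comm]
  · refine ⟨AffineMap.const ℝ E 0, fun a ha => ?_⟩
    rw [if_neg (by rintro rfl; exact hp ha)]
    simp

/-- An affine function that is `1` at `p` and `0` at all other vertices of the simplex `s`. -/
def coord (s : Finset E) (p : E) : E →ᵃ[ℝ] ℝ :=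
  if h : ∃ α : E →ᵃ[ℝ] ℝ, ∀ x ∈ s, α x = if x = p then 1 else 0 then h.choose else 0

theorem coord_apply {s : Finset E} (hs : AffineIndependent ℝ ((↑) : s → E)) (p : E) {x : E}
    (hx : x ∈ s) : coord s p x = if x = p then 1 else 0 := by
  rw [coord, dif_pos (exists_coord hs p)]
  exact (exists_coord hs p).choose_spec x hx

theorem map_barycenter (α : E →ᵃ[ℝ] ℝ) {t : Finset E} (ht : t.Nonempty) :
    α (barycenter t) = (t.card : ℝ)⁻¹ * ∑ x ∈ t, α x := by
  have hc : (t.card : ℝ) ≠ 0 := by simpa using ht.ne_empty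
  have h0 : ∀ x, α x = α.linear x + α 0 := fun x => by
    have := α.map_vadd 0 x
    simpa using this
  rw [h0, barycenter, map_smul, map_sum, Finset.sum_congr rfl fun x _ => h0 x,
    Finset.sum_add_distrib]
  simp only [smul_eq_mul, Finset.sum_const, nsmul_eq_mul]
  field_simp

theorem coord_barycenter {s t : Finset E} (hs : AffineIndependent ℝ ((↑) : s → E)) (p : E)
    (hts : t ⊆ s) (ht : t.Nonempty) :
    coord s p (barycenter t) = if p ∈ t then (t.card : ℝ)⁻¹ else 0 := by
  rw [map_barycenter _ ht, Finset.sum_congr rfl fun x hx => coord_apply hs p (hts hx)]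
  simp

theorem barycenter_mem_convexHull {t : Finset E} (ht : t.Nonempty) :
    barycenter t ∈ convexHull ℝ (t : Set E) := by
  have hc : (0 : ℝ) < t.card := by simpa using ht.card_pos
  rw [barycenter, Finset.smul_sum]
  refine (convex_convexHull ℝ _).sum_mem (fun _ _ => by positivity) ?_
    (fun x hx => subset_convexHull ℝ _ hx)
  simp only [Finset.sum_const, nsmul_eq_mul]
  field_simp

theorem barycenter_mem_affineSpan {t : Finset E} (ht : t.Nonempty) :
    barycenter t ∈ affineSpan ℝ (t : Set E) :=
  convexHull_subset_affineSpan _ (barycenter_mem_convexHull ht)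

/-- The differential is unique on the tangent space, so the linear part of any affine extension of
the coordinate restricts to it. From here on, computations take place in E instead of in the tangent
subspaces. -/
theorem hatDifferential_apply {s : Finset E} (hs : AffineIndependent ℝ ((↑) : s → E)) (p : E)
    (v : Tangent s) : hatDifferential s p v = (coord s p).linear v := by
  have : FiniteDimensional ℝ (Tangent s) :=
    finiteDimensional_vectorSpan_of_finite ℝ s.finite_toSet
  have h1 : IsHatDifferential s p (hatDifferential s p) := by
    rw [hatDifferential, dif_pos (exists_isHatDifferential hs p)]
    exact (exists_isHatDifferential hs p).choose_spec
  have h2 : IsHatDifferential s p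
      (LinearMap.toContinuousLinearMap ((coord s p).linear ∘ₗ (Tangent s).subtype)) := by
    intro a b ha hb
    have := (coord s p).linearMap_vsub a b
    rw [coord_apply hs p ha, coord_apply hs p hb] at this
    simpa using this
  rw [h1.unique h2]
  rfl

theorem hat_eq {s : Finset E} (hs : AffineIndependent ℝ ((↑) : s → E)) (hne : s.Nonempty) (p : E)
    (y : Tangent s) : hat s p y = coord s p (barycenter s + y) := by
  have := (coord s p).map_vadd (barycenter s) (y : E)
  simp only [vadd_eq_add] at this
  rw [hat, hatDifferential_apply hs, add_comm (barycenter s), this,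
    coord_barycenter hs p subset_rfl hne, add_comm]

theorem affineMap_eq_of_mem_affineSpan {S : Set E} {α : E →ᵃ[ℝ] ℝ} {c : ℝ}
    (h : ∀ x ∈ S, α x = c) {x : E} (hx : x ∈ affineSpan ℝ S) : α x = c := by
  have : affineSpan ℝ S ≤ (AffineSubspace.mk' c (⊥ : Submodule ℝ ℝ)).comap α := by
    rw [affineSpan_le]
    intro y hy
    simp [AffineSubspace.mem_mk', h y hy]
  have := this hx
  simpa [AffineSubspace.mem_mk', sub_eq_zero] using this

theorem affineMap_linear_eq_zero_of_mem_vectorSpan {S : Set E} {α : E →ᵃ[ℝ] ℝ} {c : ℝ}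
    (h : ∀ x ∈ S, α x = c) {v : E} (hv : v ∈ vectorSpan ℝ S) : α.linear v = 0 := by
  have : vectorSpan ℝ S ≤ LinearMap.ker α.linear := by
    rw [vectorSpan, Submodule.span_le]
    rintro _ ⟨a, ha, b, hb, rfl⟩
    have := α.linearMap_vsub a b
    simp [vsub_eq_sub] at this
    simp [this, h a ha, h b hb]
  exact this hv

theorem sum_affineMap_apply (t : Finset E) (α : E → E →ᵃ[ℝ] ℝ) (x : E) :
    (∑ p ∈ t, α p) x = ∑ p ∈ t, α p x := by
  induction t using Finset.induction_on with
  | empty => simp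
  | insert a t ha ih => rw [Finset.sum_insert ha, Finset.sum_insert ha, ← ih]; rfl

theorem sum_affineMap_linear (t : Finset E) (α : E → E →ᵃ[ℝ] ℝ) (x : E) :
    (∑ p ∈ t, α p).linear x = ∑ p ∈ t, (α p).linear x := by
  induction t using Finset.induction_on with
  | empty => simp
  | insert a t ha ih => rw [Finset.sum_insert ha, Finset.sum_insert ha, ← ih]; rfl

theorem sum_coord {s : Finset E} (hs : AffineIndependent ℝ ((↑) : s → E)) {x : E}
    (hx : x ∈ affineSpan ℝ (s : Set E)) : ∑ p ∈ s, coord s p x = 1 := by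
  rw [← sum_affineMap_apply]
  refine affineMap_eq_of_mem_affineSpan (fun y hy => ?_) hx
  simp only [Finset.mem_coe] at hy
  simp [sum_affineMap_apply, coord_apply hs _ hy, hy]

theorem sum_coord_linear {s : Finset E} (hs : AffineIndependent ℝ ((↑) : s → E)) {v : E}
    (hv : v ∈ vectorSpan ℝ (s : Set E)) : ∑ p ∈ s, (coord s p).linear v = 0 := by
  rw [← sum_affineMap_linear]
  refine affineMap_linear_eq_zero_of_mem_vectorSpan (c := 1) (fun y hy => ?_) hv
  simp only [Finset.mem_coe] at hy
  simp [sum_affineMap_apply, coord_apply hs _ hy, hy]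

theorem coord_eq_zero_of_mem_convexHull {s t : Finset E}
    (hs : AffineIndependent ℝ ((↑) : s → E)) (hts : t ⊆ s) {p : E} (hp : p ∉ t) {x : E}
    (hx : x ∈ convexHull ℝ (t : Set E)) : coord s p x = 0 :=
  affineMap_eq_of_mem_affineSpan (S := (t : Set E))
    (fun y hy => by
      simp only [Finset.mem_coe] at hy
      rw [coord_apply hs p (hts hy), if_neg (by rintro rfl; exact hp hy)])
    (convexHull_subset_affineSpan _ hx)

theorem coord_linear_eq_zero_of_mem_vectorSpan {s t : Finset E}
    (hs : AffineIndependent ℝ ((↑) : s → E)) (hts : t ⊆ s) {p : E} (hp : p ∉ t) {v : E}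
    (hv : v ∈ vectorSpan ℝ (t : Set E)) : (coord s p).linear v = 0 :=
  affineMap_linear_eq_zero_of_mem_vectorSpan (S := (t : Set E)) (c := 0)
    (fun y hy => by
      simp only [Finset.mem_coe] at hy
      rw [coord_apply hs p (hts hy), if_neg (by rintro rfl; exact hp hy)]) hv

/-! ### Families of simplices and Whitney forms -/

/-- A family of affinely independent simplices, closed under taking faces and purely
two-dimensional. -/
structure IsPureFamily (F : Set (Finset E)) : Prop where
  indep : ∀ s ∈ F, AffineIndependent ℝ ((↑) : s → E)
  nonempty : ∀ s ∈ F, s.Nonempty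
  down : ∀ s ∈ F, ∀ t ⊆ s, t.Nonempty → t ∈ F
  pure : ∀ s ∈ F, ∃ t ∈ F, s ⊆ t ∧ t.card = 3

theorem Numbering.vert_mem {F : Set (Finset E)} (o : Numbering F) {k : ℕ} (s : Cell F k)
    (i : Fin (k + 1)) : o.vert s i ∈ s.1 := (o k s i).2

theorem Numbering.vert_injective {F : Set (Finset E)} (o : Numbering F) {k : ℕ} (s : Cell F k) :
    Function.Injective (o.vert s) := fun _ _ h => (o k s).injective (Subtype.ext h)

theorem Numbering.exists_vert {F : Set (Finset E)} (o : Numbering F) {k : ℕ} (s : Cell F k)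
    {x : E} (hx : x ∈ s.1) : ∃ i, o.vert s i = x :=
  ⟨(o k s).symm ⟨x, hx⟩, by simp [Numbering.vert]⟩

theorem Numbering.image_vert {F : Set (Finset E)} (o : Numbering F) {k : ℕ} (s : Cell F k) :
    Finset.univ.image (o.vert s) = s.1 := by
  ext x
  simp only [Finset.mem_image, Finset.mem_univ, true_and]
  exact ⟨by rintro ⟨i, rfl⟩; exact o.vert_mem s i, fun h => o.exists_vert s h⟩

theorem wedge_apply {V : Type*} [NormedAddCommGroup V] [NormedSpace ℝ V] {q : ℕ}
    (ℓ : Fin q → V →L[ℝ] ℝ) (v : Fin q → V) :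
    wedge ℓ v = (Matrix.of fun i j => ℓ j (v i)).det := rfl

theorem whitney_apply (F : Set (Finset E)) {q : ℕ} (p : Fin (q + 1) → E) (τ : Cell F 2)
    (y : Tangent τ.1) (v : Fin q → Tangent τ.1) :
    whitney F p τ y v = (q.factorial : ℝ) * ∑ i : Fin (q + 1), (-1) ^ (i : ℕ) * hat τ.1 (p i) y *
      (Matrix.of fun a j => hatDifferential τ.1 (p (i.succAbove j)) (v a)).det := by
  simp [whitney, wedge_apply]

variable {F : Set (Finset E)}

theorem Cell.nonempty {k : ℕ} (s : Cell F k) : s.1.Nonempty :=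
  Finset.card_pos.1 (by rw [s.2.2]; omega)

/-- Each summand contains the hat function of `p i₀` or, as a column of the determinant, its
differential. Both vanish on a face that misses this vertex. -/
theorem whitney_trace (hF : IsPureFamily F) {q : ℕ} {p : Fin (q + 1) → E} {τ : Cell F 2}
    {t : Finset E} (ht : t ⊆ τ.1) {i₀ : Fin (q + 1)} (hi₀ : p i₀ ∉ t) {y : Tangent τ.1}
    (hy : barycenter τ.1 + (y : E) ∈ convexHull ℝ (t : Set E)) {v : Fin q → Tangent τ.1}
    (hv : ∀ i, (v i : E) ∈ Tangent t) : whitney F p τ y v = 0 := by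
  have hτ := hF.indep _ τ.2.1
  rw [whitney_apply]
  refine mul_eq_zero_of_right _ (Finset.sum_eq_zero fun i _ => ?_)
  by_cases hi : i = i₀
  · subst hi
    rw [hat_eq hτ τ.nonempty, coord_eq_zero_of_mem_convexHull hτ ht hi₀ hy]
    simp
  · obtain ⟨j, hj⟩ := Fin.exists_succAbove_eq (Ne.symm hi)
    refine mul_eq_zero_of_right _ (Matrix.det_eq_zero_of_column_eq_zero j fun a => ?_)
    simp only [Matrix.of_apply, hj]
    rw [hatDifferential_apply hτ, coord_linear_eq_zero_of_mem_vectorSpan hτ ht hi₀ (hv a)]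

theorem whitney_eq_zero (hF : IsPureFamily F) {q : ℕ} {p : Fin (q + 1) → E} {τ : Cell F 2}
    {i₀ : Fin (q + 1)} (hi₀ : p i₀ ∉ τ.1) : whitney F p τ = 0 := by
  have hτ := hF.indep _ τ.2.1
  funext y
  ext v
  rw [whitney_apply]
  refine mul_eq_zero_of_right _ (Finset.sum_eq_zero fun i _ => ?_)
  have h0 : ∀ w : Tangent τ.1, hatDifferential τ.1 (p i₀) w = 0 := fun w => by
    rw [hatDifferential_apply hτ, coord_linear_eq_zero_of_mem_vectorSpan hτ subset_rfl hi₀ w.2]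
  by_cases hi : i = i₀
  · subst hi
    simp [hat, h0, hi₀]
  · obtain ⟨j, hj⟩ := Fin.exists_succAbove_eq (Ne.symm hi)
    refine mul_eq_zero_of_right _ (Matrix.det_eq_zero_of_column_eq_zero j fun a => ?_)
    simp [Matrix.of_apply, hj, h0]

/-- The value of a piecewise form at the first vertex of an oriented simplex `p` in the facet `τ`,
on the edge vectors that start at this vertex. -/
def evalFrame {q : ℕ} (p : Fin (q + 1) → E) (τ : Cell F 2) (hp : ∀ i, p i ∈ τ.1) :
    PForm F q →ₗ[ℝ] ℝ where
  toFun ω := ω τ ⟨p 0 - barycenter τ.1, by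
    have := vsub_mem_vectorSpan_of_mem_affineSpan_of_mem_affineSpan
      (mem_affineSpan ℝ (s := (τ.1 : Set E)) (hp 0)) (barycenter_mem_affineSpan τ.nonempty)
    simpa using this⟩ fun j => ⟨p j.succ - p 0, sub_mem_tangent (hp _) (hp _)⟩
  map_add' _ _ := rfl
  map_smul' _ _ := rfl

/-- At the first vertex only the summand i = 0 survives, and there the differentials of the other
hat functions form the dual basis of the edge vectors, so the determinant is 1. -/
theorem evalFrame_whitney_self (hF : IsPureFamily F) {q : ℕ} {p : Fin (q + 1) → E}
    (hinj : Function.Injective p) (τ : Cell F 2) (hp : ∀ i, p i ∈ τ.1) :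
    evalFrame p τ hp (whitney F p) = q.factorial := by
  have hτ := hF.indep _ τ.2.1
  change whitney F p τ _ _ = _
  rw [whitney_apply, Fin.sum_univ_succ, Finset.sum_eq_zero, add_zero]
  · have : (Matrix.of fun (a j : Fin q) => hatDifferential τ.1 (p ((0 : Fin (q + 1)).succAbove j))
        ⟨p a.succ - p 0, sub_mem_tangent (hp _) (hp _)⟩) = 1 := by
      ext a j
      rw [Matrix.of_apply, hatDifferential_apply hτ]
      have := (coord τ.1 (p ((0 : Fin (q + 1)).succAbove j))).linearMap_vsub (p a.succ) (p 0)
      simp only [vsub_eq_sub] at this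
      rw [this, coord_apply hτ _ (hp _), coord_apply hτ _ (hp _)]
      simp [hinj.eq_iff, Matrix.one_apply, (Fin.succ_ne_zero _).symm]
    rw [this, hat_eq hτ τ.nonempty]
    simp [coord_apply hτ _ (hp _)]
  · intro i _
    rw [hat_eq hτ τ.nonempty]
    simp [coord_apply hτ _ (hp _), hinj.eq_iff, (Fin.succ_ne_zero _).symm]

theorem evalFrame_whitney_of_notMem (hF : IsPureFamily F) {q : ℕ} {p p' : Fin (q + 1) → E}
    (τ : Cell F 2) (hp : ∀ i, p i ∈ τ.1) {i₀ : Fin (q + 1)} (h : ∀ i, p i ≠ p' i₀) :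
    evalFrame p τ hp (whitney F p') = 0 := by
  change whitney F p' τ _ _ = _
  refine whitney_trace hF (t := Finset.univ.image p) (i₀ := i₀) ?_ (by simpa using h) ?_ ?_
  · intro x hx
    obtain ⟨i, -, rfl⟩ := Finset.mem_image.1 hx
    exact hp i
  · simp only [add_sub_cancel]
    exact subset_convexHull ℝ _ (by simp)
  · intro i
    exact sub_mem_tangent (by simp) (by simp)

theorem Cell.exists_facet (hF : IsPureFamily F) {q : ℕ} (s : Cell F q) :
    ∃ τ : Cell F 2, s.1 ⊆ τ.1 := by
  obtain ⟨t, ht, hst, hc⟩ := hF.pure _ s.2.1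
  exact ⟨⟨t, ht, hc⟩, hst⟩

theorem evalFrame_whitneyBasis (hF : IsPureFamily F) (o : Numbering F) {q : ℕ} (s t : Cell F q)
    (τ : Cell F 2) (hs : ∀ i, o.vert s i ∈ τ.1) :
    evalFrame (o.vert s) τ hs (whitneyBasis o t) = if s = t then (q.factorial : ℝ) else 0 := by
  split_ifs with h
  · subst h
    exact evalFrame_whitney_self hF (o.vert_injective s) τ hs
  · have : ¬ t.1 ⊆ s.1 := fun hts => h (Subtype.ext
      (Finset.eq_of_subset_of_card_le hts (by rw [s.2.2, t.2.2])).symm)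
    obtain ⟨x, hxt, hxs⟩ := Finset.not_subset.1 this
    obtain ⟨i₀, rfl⟩ := o.exists_vert t hxt
    exact evalFrame_whitney_of_notMem hF τ hs (i₀ := i₀)
      (fun i hi => hxs (hi ▸ o.vert_mem s i))

theorem evalFrame_sum_whitneyBasis (hF : IsPureFamily F) (o : Numbering F) {q : ℕ}
    [Fintype (Cell F q)] (c : Cell F q → ℝ) (s : Cell F q)
    (τ : Cell F 2) (hs : ∀ i, o.vert s i ∈ τ.1) :
    evalFrame (o.vert s) τ hs (∑ t, c t • whitneyBasis o t) = q.factorial * c s := by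
  simp [map_sum, evalFrame_whitneyBasis hF, mul_comm]

/-- Purity matters here: every cell lies in some facet, where its coefficient can be read off by
`evalFrame`. -/
theorem whitney_coeff_unique (hF : IsPureFamily F) (o : Numbering F) {q : ℕ}
    [Fintype (Cell F q)] {c c' : Cell F q → ℝ}
    (h : ∑ t, c t • whitneyBasis o t = ∑ t, c' t • whitneyBasis o t) : c = c' := by
  funext s
  obtain ⟨τ, hτ⟩ := s.exists_facet hF
  have h1 := evalFrame_sum_whitneyBasis hF o c s τ fun i => hτ (o.vert_mem s i)
  rw [h, evalFrame_sum_whitneyBasis hF o c' s τ] at h1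
  have : (q.factorial : ℝ) ≠ 0 := by exact_mod_cast q.factorial_ne_zero
  exact (mul_left_cancel₀ this h1).symm

theorem linearIndependent_whitneyBasis (hF : IsPureFamily F) (o : Numbering F) (q : ℕ)
    [Fintype (Cell F q)] : LinearIndependent ℝ (fun s : Cell F q => whitneyBasis o s) := by
  rw [Fintype.linearIndependent_iff]
  intro g hg s
  have := whitney_coeff_unique hF o (c := g) (c' := 0) (by simpa using hg)
  exact congrFun this s

section ExteriorDerivative

variable {F : Set (Finset E)}

/-! ### The exterior derivative of Whitney forms -/

theorem incidence_zero (o : Numbering F) (s : Cell F 0) (t : Cell F 1) :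
    incidence o s t = (if o.vert s 0 = o.vert t 1 then 1 else 0) -
      (if o.vert s 0 = o.vert t 0 then 1 else 0) := by
  have huniv : (Finset.univ : Finset (Equiv.Perm (Fin (0 + 1)))) = {1} := by decide
  have h : (1 : Fin 2).succAbove (0 : Fin 1) = 0 := by decide
  rw [incidence, Fin.sum_univ_two, huniv, Finset.sum_singleton, Finset.sum_singleton]
  simp only [Nat.reduceAdd, Fin.forall_fin_one, Equiv.Perm.coe_one, id_eq, h, Fin.zero_succAbove]
  simp
  split_ifs <;> rfl

theorem incidence_one (o : Numbering F) (s : Cell F 1) (t : Cell F 2) :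
    incidence o s t =
      (if o.vert s 0 = o.vert t 1 ∧ o.vert s 1 = o.vert t 2 then 1 else 0) -
      (if o.vert s 1 = o.vert t 1 ∧ o.vert s 0 = o.vert t 2 then 1 else 0) -
      (if o.vert s 0 = o.vert t 0 ∧ o.vert s 1 = o.vert t 2 then 1 else 0) +
      (if o.vert s 1 = o.vert t 0 ∧ o.vert s 0 = o.vert t 2 then 1 else 0) +
      (if o.vert s 0 = o.vert t 0 ∧ o.vert s 1 = o.vert t 1 then 1 else 0) -
      (if o.vert s 1 = o.vert t 0 ∧ o.vert s 0 = o.vert t 1 then 1 else 0) := by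
  have huniv : (Finset.univ : Finset (Equiv.Perm (Fin 2))) = {1, Equiv.swap 0 1} := by decide
  have hne : (1 : Equiv.Perm (Fin 2)) ≠ Equiv.swap 0 1 := by decide
  have h1 : (1 : Fin 3).succAbove (1 : Fin 2) = 2 := by decide
  have h2 : (2 : Fin 3).succAbove (1 : Fin 2) = 1 := by decide
  have h3 : (1 : Fin 3).succAbove (0 : Fin 2) = 0 := by decide
  have h4 : (2 : Fin 3).succAbove (0 : Fin 2) = 0 := by decide
  rw [incidence, Fin.sum_univ_three]
  simp only [Nat.reduceAdd, huniv, Finset.sum_pair hne, Fin.forall_fin_two, Equiv.Perm.coe_one,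
    id_eq, Equiv.swap_apply_left, Equiv.swap_apply_right, h1, h2, h3, h4, Fin.zero_succAbove,
    Equiv.Perm.sign_one, Equiv.Perm.sign_swap (show (0 : Fin 2) ≠ 1 by decide)]
  simp only [Fin.isValue, Fin.coe_ofNat_eq_mod, Fin.succ_zero_eq_one, Fin.succ_one_eq_two,
    Nat.zero_mod, pow_zero, Units.val_one, mul_one, Units.val_neg, Nat.one_mod, pow_one,
    Nat.reduceMod, even_two, Even.neg_pow, one_pow, Int.reduceNeg, neg_neg, mul_neg]
  split_ifs <;> rfl

theorem whitney_zero_apply (p : Fin 1 → E) (τ : Cell F 2) (y : Tangent τ.1)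
    (v : Fin 0 → Tangent τ.1) : whitney F p τ y v = hat τ.1 (p 0) y := by
  simp [whitney_apply]

theorem whitney_one_apply (p : Fin 2 → E) (τ : Cell F 2) (y : Tangent τ.1)
    (v : Fin 1 → Tangent τ.1) : whitney F p τ y v =
      hat τ.1 (p 0) y * hatDifferential τ.1 (p 1) (v 0) -
      hat τ.1 (p 1) y * hatDifferential τ.1 (p 0) (v 0) := by
  have h3 : (1 : Fin 2).succAbove (0 : Fin 1) = 0 := by decide
  simp [whitney_apply, Fin.sum_univ_two, Matrix.det_unique, h3]
  ring

theorem whitney_two_apply (p : Fin 3 → E) (τ : Cell F 2) (y : Tangent τ.1)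
    (v : Fin 2 → Tangent τ.1) : whitney F p τ y v = 2 * (
      hat τ.1 (p 0) y * (hatDifferential τ.1 (p 1) (v 0) * hatDifferential τ.1 (p 2) (v 1)
        - hatDifferential τ.1 (p 2) (v 0) * hatDifferential τ.1 (p 1) (v 1)) -
      hat τ.1 (p 1) y * (hatDifferential τ.1 (p 0) (v 0) * hatDifferential τ.1 (p 2) (v 1)
        - hatDifferential τ.1 (p 2) (v 0) * hatDifferential τ.1 (p 0) (v 1)) +
      hat τ.1 (p 2) y * (hatDifferential τ.1 (p 0) (v 0) * hatDifferential τ.1 (p 1) (v 1)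
        - hatDifferential τ.1 (p 1) (v 0) * hatDifferential τ.1 (p 0) (v 1))) := by
  have h1 : (1 : Fin 3).succAbove (1 : Fin 2) = 2 := by decide
  have h2 : (2 : Fin 3).succAbove (1 : Fin 2) = 1 := by decide
  have h3 : (1 : Fin 3).succAbove (0 : Fin 2) = 0 := by decide
  have h4 : (2 : Fin 3).succAbove (0 : Fin 2) = 0 := by decide
  rw [whitney_apply, Fin.sum_univ_three]
  simp only [Matrix.det_fin_two, Nat.reduceAdd, h1, h2, h3, h4, Matrix.of_apply,
    Fin.zero_succAbove]
  simp
  ring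

theorem hasFDerivAt_hat (s : Finset E) (p : E) (y : Tangent s) :
    HasFDerivAt (hat s p) (hatDifferential s p) y :=
  (hatDifferential s p).hasFDerivAt.const_add _

theorem differentiableAt_whitney {q : ℕ} (p : Fin (q + 1) → E) (τ : Cell F 2)
    (y : Tangent τ.1) : DifferentiableAt ℝ (whitney F p τ) y := by
  have : ∀ x, DifferentiableAt ℝ (hat τ.1 x) y := fun x => (hasFDerivAt_hat _ _ _).differentiableAt
  have h : DifferentiableAt ℝ (fun y => ∑ i : Fin (q + 1), ((-1) ^ (i : ℕ) * hat τ.1 (p i) y) •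
      wedge fun j : Fin q => hatDifferential τ.1 (p (i.succAbove j))) y :=
    DifferentiableAt.fun_sum fun i _ => ((this _).const_mul _).smul_const _
  exact h.const_smul (q.factorial : ℝ)

theorem fderiv_hat_apply (s : Finset E) (p : E) (y v : Tangent s) :
    fderiv ℝ (hat s p) y v = hatDifferential s p v := by
  rw [(hasFDerivAt_hat s p y).fderiv]

theorem d_whitney_zero_apply (p : Fin 1 → E) (τ : Cell F 2) (y : Tangent τ.1)
    (v : Fin 1 → Tangent τ.1) : (whitney F p).d τ y v = hatDifferential τ.1 (p 0) (v 0) := by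
  rw [PForm.d, extDeriv_apply (differentiableAt_whitney p τ y)]
  simp only [whitney_zero_apply]
  simp [fderiv_hat_apply]

theorem d_whitney_one_apply (p : Fin 2 → E) (τ : Cell F 2) (y : Tangent τ.1)
    (v : Fin 2 → Tangent τ.1) : (whitney F p).d τ y v =
      2 * (hatDifferential τ.1 (p 0) (v 0) * hatDifferential τ.1 (p 1) (v 1) -
        hatDifferential τ.1 (p 0) (v 1) * hatDifferential τ.1 (p 1) (v 0)) := by
  rw [PForm.d, extDeriv_apply (differentiableAt_whitney p τ y)]
  simp only [whitney_one_apply]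
  have key : ∀ (c c' : ℝ) (w : Tangent τ.1),
      fderiv ℝ (fun y => hat τ.1 (p 0) y * c - hat τ.1 (p 1) y * c') y w =
        hatDifferential τ.1 (p 0) w * c - hatDifferential τ.1 (p 1) w * c' := by
    intro c c' w
    have := ((hasFDerivAt_hat τ.1 (p 0) y).mul_const c).sub
      ((hasFDerivAt_hat τ.1 (p 1) y).mul_const c')
    rw [HasFDerivAt.fderiv (f := fun y => hat τ.1 (p 0) y * c - hat τ.1 (p 1) y * c') this]
    simp [mul_comm]
  simp [key, Fin.removeNth]
  ring

theorem exists_eq_triple (o : Numbering F) (τ : Cell F 2) (f : E → ℝ) :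
    ∑ p ∈ τ.1, f p = f (o.vert τ 0) + f (o.vert τ 1) + f (o.vert τ 2) := by
  rw [← o.image_vert τ, Finset.sum_image (o.vert_injective τ).injOn, Fin.sum_univ_three]

theorem sum_hat (hF : IsPureFamily F) (τ : Cell F 2) (y : Tangent τ.1) :
    ∑ p ∈ τ.1, hat τ.1 p y = 1 := by
  have hτ := hF.indep _ τ.2.1
  simp only [hat_eq hτ τ.nonempty]
  refine sum_coord hτ ?_
  rw [add_comm (barycenter τ.1)]
  exact AffineSubspace.vadd_mem_of_mem_direction
    (by rw [direction_affineSpan]; exact y.2) (barycenter_mem_affineSpan τ.nonempty)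

theorem sum_hatDifferential (hF : IsPureFamily F) (τ : Cell F 2) (v : Tangent τ.1) :
    ∑ p ∈ τ.1, hatDifferential τ.1 p v = 0 := by
  have hτ := hF.indep _ τ.2.1
  simp only [hatDifferential_apply hτ]
  exact sum_coord_linear hτ v.2

/-- On a facet containing p the edges at p contribute the sum over x ≠ p of λ_x dλ_p - λ_p dλ_x. As
the hat functions add up to 1 and their differentials to 0, this is (1 - λ_p) dλ_p + λ_p dλ_p =
dλ_p. -/
theorem d_whitneyBasis_zero (hF : IsPureFamily F) (o : Numbering F) [Fintype (Cell F 1)]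
    (s : Cell F 0) : (whitneyBasis o s).d =
      ∑ t : Cell F 1, (incidence o s t : ℝ) • whitneyBasis o t := by
  funext τ y
  ext v
  have hsum : (∑ t : Cell F 1, (incidence o s t : ℝ) • whitneyBasis o t) τ y v =
      ∑ t : Cell F 1, (incidence o s t : ℝ) * whitneyBasis o t τ y v := by
    simp [Finset.sum_apply]
  rw [hsum, whitneyBasis, d_whitney_zero_apply]
  set p := o.vert s 0 with hp
  have hs : s.1 = {p} := by
    rw [← o.image_vert s]; simp [p]
  have hterm : ∀ t : Cell F 1, (incidence o s t : ℝ) * whitneyBasis o t τ y v =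
      if p ∈ t.1 ∧ t.1 ⊆ τ.1 then ∑ x ∈ t.1 \ {p}, (hat τ.1 x y * hatDifferential τ.1 p (v 0) -
        hat τ.1 p y * hatDifferential τ.1 x (v 0)) else 0 := by
    intro t
    have h01 : o.vert t 0 ≠ o.vert t 1 := (o.vert_injective t).ne (by decide)
    have ht : t.1 = {o.vert t 0, o.vert t 1} := by
      rw [← o.image_vert t]; ext; simp [Fin.exists_fin_two, eq_comm]
    by_cases htτ : t.1 ⊆ τ.1
    · rw [whitneyBasis, whitney_one_apply, incidence_zero, ← hp]
      by_cases h0 : p = o.vert t 0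
      · have : t.1 \ {p} = {o.vert t 1} := by
          rw [ht, ← h0]; ext x; rw [← h0] at h01; simp; grind
        rw [if_pos (show p ∈ t.1 ∧ t.1 ⊆ τ.1 from ⟨h0 ▸ o.vert_mem t 0, htτ⟩), this, if_pos h0,
          if_neg (fun h : p = o.vert t 1 => h01 (h0.symm.trans h)), ← h0]
        simp
      · by_cases h1 : p = o.vert t 1
        · have : t.1 \ {p} = {o.vert t 0} := by
            rw [ht, ← h1]; ext x; simp; grind
          rw [if_pos (show p ∈ t.1 ∧ t.1 ⊆ τ.1 from ⟨h1 ▸ o.vert_mem t 1, htτ⟩), this, if_pos h1,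
            if_neg h0, ← h1]
          simp
        · have : ¬ p ∈ t.1 := by rw [ht]; simp [h0, h1]
          simp [h0, h1, this]
    · rw [if_neg (fun h => htτ h.2)]
      obtain ⟨x, hxt, hxs⟩ := Finset.not_subset.1 htτ
      obtain ⟨i₀, rfl⟩ := o.exists_vert t hxt
      rw [whitneyBasis, whitney_eq_zero hF hxs]
      simp
  rw [Finset.sum_congr rfl fun t _ => hterm t, ← Finset.sum_filter]
  by_cases hpτ : p ∈ τ.1
  -- Each edge at p is paired with its other end, so that edges in τ at p are reindexed by the
  -- vertices x ≠ p of τ.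
  · rw [Finset.sum_sigma']
    have hbij : (∑ x ∈ τ.1 \ {p}, (hat τ.1 x y * hatDifferential τ.1 p (v 0) -
        hat τ.1 p y * hatDifferential τ.1 x (v 0))) = hatDifferential τ.1 p (v 0) := by
      have e1 := sum_hat hF τ y
      have e2 := sum_hatDifferential hF τ (v 0)
      rw [← Finset.sum_sdiff (Finset.singleton_subset_iff.2 hpτ), Finset.sum_singleton] at e1 e2
      rw [Finset.sum_sub_distrib, ← Finset.sum_mul, ← Finset.mul_sum, eq_sub_of_add_eq e1,
        eq_neg_of_add_eq_zero_left e2]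
      ring
    refine hbij.symm.trans ?_
    have hmem : ∀ x ∈ τ.1 \ {p}, ({p, x} : Finset E) ∈ F ∧ ({p, x} : Finset E).card = 1 + 1 := by
      intro x hx
      simp only [Finset.mem_sdiff, Finset.mem_singleton] at hx
      refine ⟨hF.down _ τ.2.1 _ ?_ (by simp), Finset.card_pair (Ne.symm hx.2)⟩
      simp [Finset.insert_subset_iff, hpτ, hx.1]
    refine Finset.sum_bij (fun x hx => ⟨⟨{p, x}, hmem x hx⟩, x⟩) ?_ ?_ ?_ ?_
    · intro x hx
      simp only [Finset.mem_sdiff, Finset.mem_singleton] at hx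
      simp [Finset.insert_subset_iff, hpτ, hx]
    · intro x hx x' hx' h
      exact (Sigma.mk.inj_iff.1 h).2.eq
    · rintro ⟨t, x⟩ h
      simp only [Finset.mem_sigma, Finset.mem_filter, Finset.mem_univ, true_and,
        Finset.mem_sdiff, Finset.mem_singleton] at h
      obtain ⟨⟨h1, h2⟩, h3, h4⟩ := h
      refine ⟨x, by simp [h2 h3, h4], ?_⟩
      have : t = ⟨{p, x}, hmem x (by simp [h2 h3, h4])⟩ := by
        refine Subtype.ext (Finset.eq_of_subset_of_card_le ?_ ?_).symm
        · simp [Finset.insert_subset_iff, h1, h3]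
        · rw [t.2.2, Finset.card_pair (Ne.symm h4)]
      exact Sigma.mk.inj_iff.2 ⟨this.symm, HEq.rfl⟩
    · intro x hx
      rfl
  · rw [Finset.sum_eq_zero]
    · rw [hatDifferential_apply (hF.indep _ τ.2.1),
        coord_linear_eq_zero_of_mem_vectorSpan (hF.indep _ τ.2.1) subset_rfl hpτ (v 0).2]
    · intro t ht
      simp only [Finset.mem_filter] at ht
      exact absurd (ht.2.2 ht.2.1) hpτ

/-- On a facet only its own top form is nonzero. The relations Σ λ = 1 and Σ dλ = 0 eliminate the
third vertex, and each ordered pair of vertices leaves a polynomial identity. -/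
theorem d_whitneyBasis_one (hF : IsPureFamily F) (o : Numbering F) [Fintype (Cell F 2)]
    (s : Cell F 1) : (whitneyBasis o s).d =
      ∑ t : Cell F 2, (incidence o s t : ℝ) • whitneyBasis o t := by
  funext τ y
  ext v
  have hsum : (∑ t : Cell F 2, (incidence o s t : ℝ) • whitneyBasis o t) τ y v =
      ∑ t : Cell F 2, (incidence o s t : ℝ) * whitneyBasis o t τ y v := by
    simp [Finset.sum_apply]
  have hz : ∀ x ∉ τ.1, ∀ w, hatDifferential τ.1 x w = 0 := fun x hx w => by
    rw [hatDifferential_apply (hF.indep _ τ.2.1),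
      coord_linear_eq_zero_of_mem_vectorSpan (hF.indep _ τ.2.1) subset_rfl hx w.2]
  rw [hsum, whitneyBasis, d_whitney_one_apply, Finset.sum_eq_single τ]
  · rw [whitneyBasis, whitney_two_apply, incidence_one]
    have e1 := sum_hat hF τ y
    have e2 := sum_hatDifferential hF τ (v 0)
    have e3 := sum_hatDifferential hF τ (v 1)
    rw [exists_eq_triple o] at e1 e2 e3
    have h01 : o.vert τ 0 ≠ o.vert τ 1 := (o.vert_injective τ).ne (by decide)
    have h02 : o.vert τ 0 ≠ o.vert τ 2 := (o.vert_injective τ).ne (by decide)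
    have h12 : o.vert τ 1 ≠ o.vert τ 2 := (o.vert_injective τ).ne (by decide)
    have hs01 : o.vert s 0 ≠ o.vert s 1 := (o.vert_injective s).ne (by decide)
    have hmem : ∀ x, x ∈ τ.1 ↔ x = o.vert τ 0 ∨ x = o.vert τ 1 ∨ x = o.vert τ 2 := by
      intro x; rw [← o.image_vert τ]; simp [Fin.exists_fin_succ, eq_comm]
    have E1 := eq_sub_of_add_eq e1
    have E2 := eq_neg_of_add_eq_zero_right e2
    have E3 := eq_neg_of_add_eq_zero_right e3
    have E1' : hat τ.1 (o.vert τ 2) y = 1 - hat τ.1 (o.vert τ 0) y - hat τ.1 (o.vert τ 1) y := by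
      linarith
    by_cases hs0 : o.vert s 0 ∈ τ.1
    · by_cases hs1 : o.vert s 1 ∈ τ.1
      · rw [hmem] at hs0 hs1
        rcases hs0 with h | h | h <;> rcases hs1 with h' | h' | h' <;> rw [h, h'] at hs01 ⊢ <;>
        first
        | exact absurd rfl hs01
        | (simp only [h01, h02, h12, h01.symm, h02.symm, h12.symm, and_self, and_true, and_false,
            if_true, if_false, E2, E3, E1']
           push_cast
           ring)
      · have : ∀ i, o.vert s 1 ≠ o.vert τ i := fun i hi => hs1 (hi ▸ o.vert_mem τ i)
        simp [this, hz _ hs1]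
    · have : ∀ i, o.vert s 0 ≠ o.vert τ i := fun i hi => hs0 (hi ▸ o.vert_mem τ i)
      simp [this, hz _ hs0]
  · intro t _ ht
    have : ¬ t.1 ⊆ τ.1 := fun hts => ht (Subtype.ext
      (Finset.eq_of_subset_of_card_le hts (by rw [t.2.2, τ.2.2])))
    obtain ⟨x, hxt, hxs⟩ := Finset.not_subset.1 this
    obtain ⟨i₀, rfl⟩ := o.exists_vert t hxt
    rw [whitneyBasis, whitney_eq_zero hF hxs]
    simp
  · simp

theorem d_whitneyBasis (hF : IsPureFamily F) (o : Numbering F) {q : ℕ} (hq : q ≤ 1)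
    [Fintype (Cell F (q + 1))] (s : Cell F q) : (whitneyBasis o s).d =
      ∑ t : Cell F (q + 1), (incidence o s t : ℝ) • whitneyBasis o t := by
  interval_cases q
  · exact d_whitneyBasis_zero hF o s
  · exact d_whitneyBasis_one hF o s

theorem extDeriv_sum_smul {V : Type*} [NormedAddCommGroup V] [NormedSpace ℝ V] {ι : Type*}
    [Fintype ι] {q : ℕ} (c : ι → ℝ) (ω : ι → V → V [⋀^Fin q]→L[ℝ] ℝ) {y : V}
    (h : ∀ i, DifferentiableAt ℝ (ω i) y) :
    extDeriv (fun y => ∑ i, c i • ω i y) y = ∑ i, c i • extDeriv (ω i) y := by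
  have h2 := HasFDerivAt.fun_sum (u := Finset.univ) fun i _ =>
    (h i).hasFDerivAt.fun_const_smul (c i)
  simp only [extDeriv]
  rw [h2.fderiv]
  simp only [← ContinuousAlternatingMap.alternatizeUncurryFinCLM_apply, map_sum, map_smul]

theorem d_sum_whitneyBasis (hF : IsPureFamily F) (o : Numbering F) {q : ℕ} (hq : q ≤ 1)
    [Fintype (Cell F q)] [Fintype (Cell F (q + 1))] (c : Cell F q → ℝ) :
    PForm.d (∑ s, c s • whitneyBasis o s) =
      ∑ t : Cell F (q + 1), (∑ s, (incidence o s t : ℝ) * c s) • whitneyBasis o t := by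
  have h : PForm.d (∑ s, c s • whitneyBasis o s) = ∑ s, c s • (whitneyBasis o s).d := by
    funext τ y
    have h1 : (∑ s, c s • whitneyBasis o s : PForm F q) τ =
        fun y => ∑ s, c s • whitneyBasis o s τ y := by
      funext y; simp [Finset.sum_apply]
    have h2 : (∑ s, c s • (whitneyBasis o s).d : PForm F (q + 1)) τ y =
        ∑ s, c s • extDeriv (whitneyBasis o s τ) y := by
      simp [Finset.sum_apply, PForm.d]
    rw [h2, PForm.d, h1]
    exact extDeriv_sum_smul c _ fun s => differentiableAt_whitney (o.vert s) τ y
  rw [h, Finset.sum_congr rfl fun s _ => by rw [d_whitneyBasis hF o hq s, Finset.smul_sum],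
    Finset.sum_comm]
  refine Finset.sum_congr rfl fun t _ => ?_
  rw [Finset.sum_smul]
  refine Finset.sum_congr rfl fun s _ => ?_
  rw [smul_smul, mul_comm]

/-- The exterior derivative of a combination of Whitney forms, in terms of coefficients. -/
theorem d_sum_whitneyBasis_eq_iff (hF : IsPureFamily F) (o : Numbering F) {q : ℕ} (hq : q ≤ 1)
    [Fintype (Cell F q)] [Fintype (Cell F (q + 1))] (c : Cell F q → ℝ) (c' : Cell F (q + 1) → ℝ) :
    PForm.d (∑ s, c s • whitneyBasis o s) = ∑ t, c' t • whitneyBasis o t ↔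
      ∀ t, ∑ s, (incidence o s t : ℝ) * c s = c' t := by
  rw [d_sum_whitneyBasis hF o hq]
  constructor
  · intro h t
    exact congrFun (whitney_coeff_unique hF o h) t
  · intro h
    simp [h]

end ExteriorDerivative

/-! ### Chains of simplices -/

theorem affineMap_sum (α : E →ᵃ[ℝ] ℝ) {ι : Type*} (s : Finset ι) (c : ι → ℝ) (x : ι → E) :
    α.linear (∑ i ∈ s, c i • x i) = ∑ i ∈ s, c i * α (x i) - (∑ i ∈ s, c i) * α 0 := by
  have h0 : ∀ x, α x = α.linear x + α 0 := fun x => by simpa using α.map_vadd 0 x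
  rw [map_sum, Finset.sum_mul, ← Finset.sum_sub_distrib]
  refine Finset.sum_congr rfl fun i _ => ?_
  rw [h0 (x i), map_smul, smul_eq_mul]
  ring

theorem affineMap_convexCombination (α : E →ᵃ[ℝ] ℝ) {ι : Type*} (s : Finset ι) (c : ι → ℝ)
    (x : ι → E) (hc : ∑ i ∈ s, c i = 1) :
    α (∑ i ∈ s, c i • x i) = ∑ i ∈ s, c i * α (x i) := by
  have h0 : ∀ x, α x = α.linear x + α 0 := fun x => by simpa using α.map_vadd 0 x
  rw [h0, affineMap_sum, hc]
  ring

/-- A point with positive weights on a chain of sets determines the chain: its elements are super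
level sets of the coordinates. -/
theorem chain_subset_of_weights {C C' : Finset (Finset E)}
    (hC : IsChain (· ⊆ ·) (C : Set (Finset E))) (hC' : IsChain (· ⊆ ·) (C' : Set (Finset E)))
    (hne : ∀ s ∈ C, s.Nonempty) {u u' : Finset E → ℝ} (hu : ∀ s ∈ C, 0 < u s)
    (hu' : ∀ s ∈ C', 0 ≤ u' s)
    (h : ∀ p, ∑ s ∈ C, (if p ∈ s then u s else 0) = ∑ s ∈ C', if p ∈ s then u' s else 0) :
    C ⊆ C' := by
  intro s hs
  set W : E → ℝ := fun p => ∑ s ∈ C, if p ∈ s then u s else 0 with hW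
  -- The threshold for s: the total weight of the members above s. Points of s have at least this
  -- weight, all other points strictly less, so s is a superlevel set of W.
  set θ : ℝ := ∑ r ∈ C, if s ⊆ r then u r else 0 with hθ
  have hθ0 : 0 < θ := by
    refine Finset.sum_pos' (fun r hr => ?_) ⟨s, hs, by simpa using hu s hs⟩
    split_ifs
    exacts [(hu r hr).le, le_rfl]
  have hin : ∀ p ∈ s, θ ≤ W p := by
    intro p hp
    refine Finset.sum_le_sum fun r hr => ?_
    by_cases h1 : s ⊆ r
    · rw [if_pos h1, if_pos (h1 hp)]
    · rw [if_neg h1]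
      split_ifs
      exacts [(hu r hr).le, le_rfl]
  have hout : ∀ p ∉ s, W p < θ := by
    intro p hp
    refine Finset.sum_lt_sum (fun r hr => ?_) ⟨s, hs, ?_⟩
    · by_cases h1 : p ∈ r
      · have : s ⊆ r := by
          rcases hC.total hs hr with h | h
          exacts [h, absurd (h h1) hp]
        rw [if_pos h1, if_pos this]
      · rw [if_neg h1]
        split_ifs
        exacts [(hu r hr).le, le_rfl]
    · rw [if_neg hp, if_pos subset_rfl]
      exact hu s hs
  -- Let p be a point of s of least weight. The least member m of C' that has positive weight and
  -- contains p is also the superlevel set of W at the value W p, hence equal to s.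
  obtain ⟨p, hps, hmin⟩ := Finset.exists_min_image s W (hne s hs)
  have hW' : ∀ q, W q = ∑ r ∈ C' with 0 < u' r, if q ∈ r then u' r else 0 := by
    intro q
    rw [hW]
    simp only
    rw [h, Finset.sum_filter]
    refine Finset.sum_congr rfl fun r hr => ?_
    by_cases h1 : 0 < u' r
    · rw [if_pos h1]
    · rw [if_neg h1, le_antisymm (not_lt.1 h1) (hu' r hr)]
      simp
  set D := C'.filter (fun r => 0 < u' r ∧ p ∈ r) with hD
  have hDne : D.Nonempty := by
    rw [Finset.nonempty_iff_ne_empty]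
    intro hemp
    have : W p = 0 := by
      rw [hW']
      refine Finset.sum_eq_zero fun r hr => ?_
      rw [if_neg]
      intro hpr
      rw [Finset.mem_filter] at hr
      have : r ∈ D := by simp [hD, hr, hpr]
      simp [hemp] at this
    have := hin p hps
    linarith
  obtain ⟨m, hm⟩ := D.exists_minimal hDne
  have hmD := hm.prop
  simp only [hD, Finset.mem_filter] at hmD
  have hleast : ∀ r ∈ C', 0 < u' r → p ∈ r → m ⊆ r := by
    intro r hr h1 h2
    rcases hC'.total hmD.1 hr with h | h
    · exact h
    · exact hm.le_of_le (by simp [hD, hr, h1, h2]) h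
  have hms : m ⊆ s := by
    intro q hq
    by_contra hqs
    have h1 := hout q hqs
    have h2 := hin p hps
    have h3 : W p ≤ W q := by
      rw [hW', hW']
      refine Finset.sum_le_sum fun r hr => ?_
      rw [Finset.mem_filter] at hr
      by_cases h1 : p ∈ r
      · rw [if_pos h1, if_pos (hleast r hr.1 hr.2 h1 hq)]
      · rw [if_neg h1]
        split_ifs
        exacts [hr.2.le, le_rfl]
    linarith
  have hsm : s ⊆ m := by
    intro q hq
    by_contra hqm
    have h1 := hmin q hq
    have h3 : W q < W p := by
      rw [hW', hW']
      refine Finset.sum_lt_sum (fun r hr => ?_)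
        ⟨m, by simp [hmD], by rw [if_neg hqm, if_pos hmD.2.2]; exact hmD.2.1⟩
      rw [Finset.mem_filter] at hr
      by_cases h1 : q ∈ r
      · have : p ∈ r := by
          rcases hC'.total hmD.1 hr.1 with h | h
          exacts [h hmD.2.2, absurd (h h1) hqm]
        rw [if_pos h1, if_pos this]
      · rw [if_neg h1]
        split_ifs
        exacts [hr.2.le, le_rfl]
    linarith
  rw [hsm.antisymm hms]
  exact hmD.1

/-- A maximal member s of nonzero weight has a point outside all smaller members of the chain; at
this point only the term of s survives. -/
theorem chain_weights_eq_zero {C : Finset (Finset E)}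
    (hC : IsChain (· ⊆ ·) (C : Set (Finset E))) (hne : ∀ s ∈ C, s.Nonempty) {u : Finset E → ℝ}
    (h : ∀ p, ∑ s ∈ C, (if p ∈ s then u s else 0) = 0) : ∀ s ∈ C, u s = 0 := by
  by_contra! hcon
  obtain ⟨s₀, hs₀, hus₀⟩ := hcon
  obtain ⟨s, hs⟩ := (C.filter fun s => u s ≠ 0).exists_maximal ⟨s₀, by simp [hs₀, hus₀]⟩
  have hsC := hs.prop
  rw [Finset.mem_filter] at hsC
  obtain ⟨p, hp, hp'⟩ : ∃ p ∈ s, ∀ r ∈ C, r ⊂ s → p ∉ r := by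
    by_cases hlow : (C.filter fun r => r ⊂ s).Nonempty
    · obtain ⟨m, hm⟩ := (C.filter fun r => r ⊂ s).exists_maximal hlow
      have hmC := hm.prop
      rw [Finset.mem_filter] at hmC
      obtain ⟨p, hps, hpm⟩ := Finset.exists_of_ssubset hmC.2
      refine ⟨p, hps, fun r hr hrs hpr => hpm ?_⟩
      rcases hC.total hr hmC.1 with h | h
      · exact h hpr
      · exact hm.le_of_ge (by simp [hr, hrs]) h hpr
    · obtain ⟨p, hp⟩ := hne s hsC.1
      exact ⟨p, hp, fun r hr hrs => absurd ⟨r, by simp [hr, hrs]⟩ hlow⟩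
  have := h p
  rw [Finset.sum_eq_single_of_mem s hsC.1, if_pos hp] at this
  · exact hsC.2 this
  · intro r hr hrs
    by_cases hur : u r = 0
    · simp [hur]
    rw [if_neg]
    rcases hC.total hr hsC.1 with h | h
    · exact hp' r hr (h.ssubset_of_ne hrs)
    · exact absurd ((hs.le_of_ge (by simp [hr, hur]) h).antisymm h) hrs

/-! ### Simplices of the barycentric refinement -/

namespace ClosedTriangulatedSurface

variable (T : ClosedTriangulatedSurface E)

theorem isPureFamily : IsPureFamily T.faces where
  indep _ hs := T.indep hs
  nonempty _ hs := T.nonempty_of_mem_faces hs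
  down _ hs _ hts ht := T.down_closed hs hts ht
  pure := T.pure_two

variable {T}

/-- Two simplices of the complex intersect only in the hull of their common vertices, where both
coordinates agree. So barycentric coordinates do not depend on the simplex in which a point is
viewed. -/
theorem coord_eq_coord {s t : Finset E} (hs : s ∈ T.faces) (ht : t ∈ T.faces) {x : E}
    (hxs : x ∈ convexHull ℝ (s : Set E)) (hxt : x ∈ convexHull ℝ (t : Set E)) (p : E) :
    coord s p x = coord t p x := by
  have hx := T.inter_subset_convexHull hs ht ⟨hxs, hxt⟩
  rw [← Finset.coe_inter, Finset.convexHull_eq] at hx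
  obtain ⟨W, -, hW1, rfl⟩ := hx
  rw [Finset.centerMass_eq_of_sum_1 _ _ hW1, affineMap_convexCombination _ _ _ _ hW1,
    affineMap_convexCombination _ _ _ _ hW1]
  refine Finset.sum_congr rfl fun y hy => ?_
  rw [Finset.mem_inter] at hy
  rw [id, coord_apply (T.indep hs) _ hy.1, coord_apply (T.indep ht) _ hy.2]

/-- The barycenter of s has positive coordinates at all vertices of s, whereas points of t have
coordinate zero at vertices outside t. -/
theorem subset_of_barycenter_mem {s t : Finset E} (hs : s ∈ T.faces) (ht : t ∈ T.faces)
    (h : barycenter s ∈ convexHull ℝ (t : Set E)) : s ⊆ t := by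
  intro p hp
  by_contra hpt
  have hne := T.nonempty_of_mem_faces hs
  have h1 := coord_eq_coord hs ht (barycenter_mem_convexHull hne) h p
  rw [coord_barycenter (T.indep hs) p subset_rfl hne, if_pos hp,
    coord_eq_zero_of_mem_convexHull (T.indep ht) subset_rfl hpt h] at h1
  simp [hne.ne_empty] at h1

theorem barycenter_inj {s t : Finset E} (hs : s ∈ T.faces) (ht : t ∈ T.faces)
    (h : barycenter s = barycenter t) : s = t :=
  (subset_of_barycenter_mem hs ht
    (h ▸ barycenter_mem_convexHull (T.nonempty_of_mem_faces ht))).antisymm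
    (subset_of_barycenter_mem ht hs
      (h ▸ barycenter_mem_convexHull (T.nonempty_of_mem_faces hs)))

theorem injOn_barycenter : Set.InjOn (barycenter (E := E)) T.faces :=
  fun _ hs _ ht h => barycenter_inj hs ht h

theorem exists_top {C : Finset (Finset E)} (hC : IsChain (· ⊆ ·) (C : Set (Finset E)))
    (hne : C.Nonempty) : ∃ m ∈ C, ∀ s ∈ C, s ⊆ m := by
  obtain ⟨m, hm⟩ := C.exists_maximal hne
  refine ⟨m, hm.prop, fun s hs => ?_⟩
  rcases hC.total hs hm.prop with h | h
  exacts [h, hm.le_of_ge hs h]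

theorem exists_bot {C : Finset (Finset E)} (hC : IsChain (· ⊆ ·) (C : Set (Finset E)))
    (hne : C.Nonempty) : ∃ m ∈ C, ∀ s ∈ C, m ⊆ s := by
  obtain ⟨m, hm⟩ := C.exists_minimal hne
  refine ⟨m, hm.prop, fun s hs => ?_⟩
  rcases hC.total hs hm.prop with h | h
  exacts [hm.le_of_le hs h, h]

theorem mem_sdFaces_iff {w : Finset E} : w ∈ sdFaces T.faces ↔
    ∃ C : Finset (Finset E), C.Nonempty ∧ (∀ s ∈ C, s ∈ T.faces) ∧
      IsChain (· ⊆ ·) (C : Set (Finset E)) ∧ w = C.image barycenter := by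
  simp only [sdFaces, Set.mem_ofPred_eq]
  refine exists_congr fun C => and_congr_right fun _ => and_congr_right fun _ =>
    and_congr_right fun _ => ?_
  rw [← Finset.coe_image, Finset.coe_inj]

theorem sum_image_barycenter {C : Finset (Finset E)} (hC : ∀ s ∈ C, s ∈ T.faces) {M : Type*}
    [AddCommMonoid M] (g : E → M) :
    ∑ x ∈ C.image barycenter, g x = ∑ s ∈ C, g (barycenter s) :=
  Finset.sum_image fun s hs t ht h => barycenter_inj (hC s hs) (hC t ht) h

theorem coord_chain {C : Finset (Finset E)} (hC : ∀ s ∈ C, s ∈ T.faces) {m : Finset E}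
    (hm : m ∈ T.faces) (htop : ∀ s ∈ C, s ⊆ m) {c : Finset E → ℝ} (hc : ∑ s ∈ C, c s = 1) (p : E) :
    coord m p (∑ s ∈ C, c s • barycenter s) =
      ∑ s ∈ C, if p ∈ s then c s * (s.card : ℝ)⁻¹ else 0 := by
  rw [affineMap_convexCombination _ _ _ _ hc]
  refine Finset.sum_congr rfl fun s hs => ?_
  rw [coord_barycenter (T.indep hm) p (htop s hs) (T.nonempty_of_mem_faces (hC s hs))]
  split_ifs <;> simp

theorem sum_barycenter_mem_convexHull {C : Finset (Finset E)} (hC : ∀ s ∈ C, s ∈ T.faces)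
    {m : Finset E} (htop : ∀ s ∈ C, s ⊆ m) {c : Finset E → ℝ} (hc0 : ∀ s ∈ C, 0 ≤ c s)
    (hc : ∑ s ∈ C, c s = 1) :
    ∑ s ∈ C, c s • barycenter s ∈ convexHull ℝ (m : Set E) :=
  (convex_convexHull ℝ _).sum_mem hc0 hc fun s hs =>
    convexHull_mono (by exact_mod_cast htop s hs)
      (barycenter_mem_convexHull (T.nonempty_of_mem_faces (hC s hs)))

/-- The coordinates of the common point, taken in the top simplex of either chain, turn the equation
into the weight identity of `chain_subset_of_weights`, with weights divided by cardinalities. -/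
theorem chain_subset_of_sum_eq {C C' : Finset (Finset E)} (hCne : C.Nonempty)
    (hC'ne : C'.Nonempty) (hCF : ∀ s ∈ C, s ∈ T.faces) (hC'F : ∀ s ∈ C', s ∈ T.faces)
    (hC : IsChain (· ⊆ ·) (C : Set (Finset E))) (hC' : IsChain (· ⊆ ·) (C' : Set (Finset E)))
    {c c' : Finset E → ℝ} (hc : ∀ s ∈ C, 0 < c s) (hc' : ∀ s ∈ C', 0 ≤ c' s)
    (h1 : ∑ s ∈ C, c s = 1) (h1' : ∑ s ∈ C', c' s = 1)
    (h : ∑ s ∈ C, c s • barycenter s = ∑ s ∈ C', c' s • barycenter s) : C ⊆ C' := by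
  obtain ⟨m, hmC, hm⟩ := exists_top hC hCne
  obtain ⟨m', hmC', hm'⟩ := exists_top hC' hC'ne
  have hpos : ∀ s ∈ T.faces, (0 : ℝ) < (s.card : ℝ)⁻¹ := fun s hs => by
    have := (T.nonempty_of_mem_faces hs).card_pos
    positivity
  refine chain_subset_of_weights hC hC' (fun s hs => T.nonempty_of_mem_faces (hCF s hs))
    (u := fun s => c s * (s.card : ℝ)⁻¹) (u' := fun s => c' s * (s.card : ℝ)⁻¹)
    (fun s hs => mul_pos (hc s hs) (hpos s (hCF s hs)))
    (fun s hs => mul_nonneg (hc' s hs) (hpos s (hC'F s hs)).le) fun p => ?_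
  rw [← coord_chain hCF (hCF m hmC) hm h1, ← coord_chain hC'F (hC'F m' hmC') hm' h1',
    coord_eq_coord (hCF m hmC) (hC'F m' hmC')
    (sum_barycenter_mem_convexHull hCF hm (fun s hs => (hc s hs).le) h1)
    (h ▸ sum_barycenter_mem_convexHull hC'F hm' hc' h1'), h]

/-- An inner point of a simplex of the refinement lies only in those simplices of the refinement
that contain the whole simplex. -/
theorem subset_of_inner_mem {w w' : Finset E} (hw : w ∈ sdFaces T.faces)
    (hw' : w' ∈ sdFaces T.faces) {y : E} (hy : y ∈ convexHull ℝ (w : Set E)) {a : ℝ} (ha : 0 < a)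
    (ha1 : a ≤ 1) (h : (1 - a) • y + a • barycenter w ∈ convexHull ℝ (w' : Set E)) :
    w ⊆ w' := by
  obtain ⟨C, hCne, hCF, hC, rfl⟩ := mem_sdFaces_iff.1 hw
  obtain ⟨C', hC'ne, hC'F, hC', rfl⟩ := mem_sdFaces_iff.1 hw'
  refine Finset.image_subset_image ?_
  rw [Finset.convexHull_eq] at hy h
  obtain ⟨c, hc0, hc1, hcy⟩ := hy
  obtain ⟨c', hc0', hc1', hcy'⟩ := h
  rw [Finset.centerMass_eq_of_sum_1 _ _ hc1, sum_image_barycenter hCF] at hcy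
  rw [Finset.centerMass_eq_of_sum_1 _ _ hc1', sum_image_barycenter hC'F] at hcy'
  rw [sum_image_barycenter hCF] at hc1
  rw [sum_image_barycenter hC'F] at hc1'
  have hcard : (0 : ℝ) < C.card := by exact_mod_cast hCne.card_pos
  have hcard' : (C.image barycenter).card = C.card :=
    Finset.card_image_of_injOn fun s hs t ht h => barycenter_inj (hCF s hs) (hCF t ht) h
  -- The barycenter of w adds the positive amount a / |C| to every weight, which is the strict
  -- positivity required of the first chain.
  have hsum : ∑ s ∈ C, ((1 - a) * c (barycenter s) + a * (C.card : ℝ)⁻¹) = 1 := by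
    rw [Finset.sum_add_distrib, ← Finset.mul_sum, hc1]
    simp only [Finset.sum_const, nsmul_eq_mul]
    field_simp
    ring
  refine chain_subset_of_sum_eq hCne hC'ne hCF hC'F hC hC'
    (c := fun s => (1 - a) * c (barycenter s) + a * (C.card : ℝ)⁻¹)
    (c' := fun s => c' (barycenter s)) ?_ ?_ hsum hc1' ?_
  · intro s hs
    have := hc0 _ (Finset.mem_image_of_mem _ hs)
    have : 0 ≤ (1 - a) * c (barycenter s) := mul_nonneg (by linarith) this
    positivity
  · intro s hs
    exact hc0' _ (Finset.mem_image_of_mem _ hs)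
  · simp only [id] at hcy hcy'
    rw [hcy', ← hcy, barycenter, hcard', sum_image_barycenter hCF, Finset.smul_sum,
      Finset.smul_sum, Finset.smul_sum, ← Finset.sum_add_distrib]
    refine Finset.sum_congr rfl fun s _ => ?_
    rw [add_smul, mul_smul, mul_smul]

/-- Coordinates in the top simplex of the chain turn an affine dependence between the barycenters
into a vanishing weight function on the chain, so `chain_weights_eq_zero` applies. -/
theorem affineIndependent_of_mem_sdFaces {w : Finset E} (hw : w ∈ sdFaces T.faces) :
    AffineIndependent ℝ ((↑) : w → E) := by
  obtain ⟨C, hCne, hCF, hC, rfl⟩ := mem_sdFaces_iff.1 hw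
  obtain ⟨m, hmC, hm⟩ := exists_top hC hCne
  have key : AffineIndependent ℝ (fun s : C => barycenter s.1) := by
    rw [affineIndependent_iff_of_fintype]
    intro c hc hsum s
    rw [Finset.univ.weightedVSub_eq_weightedVSubOfPoint_of_sum_eq_zero _ _ hc 0,
      Finset.weightedVSubOfPoint_apply] at hsum
    simp only [vsub_eq_sub, sub_zero] at hsum
    set c' : Finset E → ℝ := fun s => if h : s ∈ C then c ⟨s, h⟩ else 0 with hc'
    have hcc : ∀ s : C, c s = c' s.1 := fun s => by simp [hc']
    simp only [hcc] at hc hsum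
    rw [Finset.sum_coe_sort C (fun s => c' s)] at hc
    rw [Finset.sum_coe_sort C (fun s => c' s • barycenter s)] at hsum
    have := chain_weights_eq_zero hC (fun s hs => T.nonempty_of_mem_faces (hCF s hs))
      (u := fun s => c' s * (s.card : ℝ)⁻¹) (fun p => ?_) s.1 s.2
    · rw [hcc]
      have h3 : (s.1.card : ℝ)⁻¹ ≠ 0 := by
        simpa using (T.nonempty_of_mem_faces (hCF _ s.2)).ne_empty
      exact (mul_eq_zero.1 this).resolve_right h3
    · have := affineMap_sum (coord m p) C c' barycenter
      rw [hsum, hc, map_zero, zero_mul, sub_zero] at this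
      refine Eq.trans (Finset.sum_congr rfl fun s hs => ?_) this.symm
      rw [coord_barycenter (T.indep (hCF m hmC)) p (hm s hs) (T.nonempty_of_mem_faces (hCF s hs))]
      split_ifs <;> simp
  have := key.range
  have hr : Set.range (fun s : C => barycenter s.1) = ((C.image barycenter : Finset E) : Set E) := by
    ext x; simp
  rw [hr] at this
  exact this

end ClosedTriangulatedSurface

namespace ClosedTriangulatedSurface

variable {T : ClosedTriangulatedSurface E}

/-! ### Complete flags -/

/-- A vertex, an edge and a facet that contain each other. -/
def IsFlag (a : Cell T.faces 0) (e : Cell T.faces 1) (f : Cell T.faces 2) : Prop :=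
  a.1 ⊆ e.1 ∧ e.1 ⊆ f.1

/-- The triangle of the barycentric refinement given by a flag. -/
def tri (a : Cell T.faces 0) (e : Cell T.faces 1) (f : Cell T.faces 2) : Finset E :=
  {barycenter a.1, barycenter e.1, barycenter f.1}

theorem cell_ne {k l : ℕ} (h : k ≠ l) (s : Cell T.faces k) (t : Cell T.faces l) : s.1 ≠ t.1 := by
  intro hst
  have := s.2.2
  rw [hst, t.2.2] at this
  omega

theorem barycenter_cell_ne {k l : ℕ} (h : k ≠ l) (s : Cell T.faces k) (t : Cell T.faces l) :
    barycenter s.1 ≠ barycenter t.1 :=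
  fun hst => cell_ne h s t (barycenter_inj s.2.1 t.2.1 hst)

theorem barycenter_cell_inj {k : ℕ} {s t : Cell T.faces k} (h : barycenter s.1 = barycenter t.1) :
    s = t :=
  Subtype.ext (barycenter_inj s.2.1 t.2.1 h)

theorem card_tri (a : Cell T.faces 0) (e : Cell T.faces 1) (f : Cell T.faces 2) :
    (tri a e f).card = 3 :=
  Finset.card_eq_three.2 ⟨_, _, _, barycenter_cell_ne (by decide) a e,
    barycenter_cell_ne (by decide) a f, barycenter_cell_ne (by decide) e f, rfl⟩

theorem IsFlag.tri_eq_image {a : Cell T.faces 0} {e : Cell T.faces 1} {f : Cell T.faces 2} :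
    tri a e f = ({a.1, e.1, f.1} : Finset (Finset E)).image barycenter := by
  simp [tri, Finset.image_insert]

theorem isChain_of_isFlag {a : Cell T.faces 0} {e : Cell T.faces 1} {f : Cell T.faces 2}
    (h : IsFlag a e f) :
    IsChain (· ⊆ ·) (({a.1, e.1, f.1} : Finset (Finset E)) : Set (Finset E)) := by
  have h1 := h.1
  have h2 := h.2
  have h3 := h1.trans h2
  intro s hs t ht _
  simp only [Finset.coe_insert, Finset.coe_singleton, Set.mem_insert_iff,
    Set.mem_singleton_iff] at hs ht
  rcases hs with rfl | rfl | rfl <;> rcases ht with rfl | rfl | rfl <;> simp [h1, h2, h3]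

theorem IsFlag.tri_mem {a : Cell T.faces 0} {e : Cell T.faces 1} {f : Cell T.faces 2}
    (h : IsFlag a e f) : tri a e f ∈ sdFaces T.faces :=
  mem_sdFaces_iff.2 ⟨{a.1, e.1, f.1}, by simp, by simp [a.2.1, e.2.1, f.2.1],
    isChain_of_isFlag h, tri_eq_image⟩

theorem subset_sdFaces {w w' : Finset E} (hw : w ∈ sdFaces T.faces) (h : w' ⊆ w)
    (hne : w'.Nonempty) : w' ∈ sdFaces T.faces := by
  obtain ⟨C, hCne, hCF, hC, rfl⟩ := mem_sdFaces_iff.1 hw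
  obtain ⟨D, hD, rfl⟩ := Finset.subset_image_iff.1 h
  exact mem_sdFaces_iff.2 ⟨D, by simpa using hne, fun s hs => hCF s (hD hs),
    hC.mono (by exact_mod_cast hD), rfl⟩

theorem cell_zero_eq_singleton (a : Cell T.faces 0) : ∃ x, a.1 = {x} :=
  Finset.card_eq_one.1 a.2.2

/-- Every chain extends to a complete flag, whose vertex may be prescribed. -/
theorem exists_flag_of_chain {C : Finset (Finset E)} (hne : C.Nonempty)
    (hCF : ∀ s ∈ C, s ∈ T.faces) (hC : IsChain (· ⊆ ·) (C : Set (Finset E))) {x : E}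
    (hx : ∀ s ∈ C, x ∈ s) : ∃ (a : Cell T.faces 0) (e : Cell T.faces 1) (f : Cell T.faces 2),
      IsFlag a e f ∧ a.1 = {x} ∧ C ⊆ {a.1, e.1, f.1} := by
  obtain ⟨m, hmC, hm⟩ := exists_top hC hne
  obtain ⟨f, hf, hmf, hfc⟩ := T.pure_two m (hCF m hmC)
  have hxf : x ∈ f := hmf (hx m hmC)
  have hxT : ({x} : Finset E) ∈ T.faces := T.down_closed hf (by simpa using hxf) (by simp)
  have hCf : ∀ s ∈ C, s ⊆ f := fun s hs => (hm s hs).trans hmf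
  -- The edge of the flag is the one in the chain if there is one, which is then unique, and
  -- otherwise any edge of f through x.
  obtain ⟨e, hec, hxe, hef, he⟩ : ∃ e : Finset E, e.card = 2 ∧ x ∈ e ∧ e ⊆ f ∧
      ∀ s ∈ C, s.card = 2 → s = e := by
    by_cases h : ∃ e ∈ C, e.card = 2
    · obtain ⟨e, heC, hec⟩ := h
      refine ⟨e, hec, hx e heC, hCf e heC, fun s hs hsc => ?_⟩
      rcases hC.total hs heC with h | h
      · exact Finset.eq_of_subset_of_card_le h (by omega)
      · exact (Finset.eq_of_subset_of_card_le h (by omega)).symm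
    · obtain ⟨e, hxe, hef, hec⟩ := Finset.exists_subsuperset_card_eq (n := 2)
        (Finset.singleton_subset_iff.2 hxf) (by simp) (by omega)
      exact ⟨e, hec, by simpa using hxe, hef, fun s hs hsc => absurd ⟨s, hs, hsc⟩ h⟩
  have heT : e ∈ T.faces := T.down_closed hf hef ⟨x, hxe⟩
  refine ⟨⟨{x}, hxT, by simp⟩, ⟨e, heT, hec⟩, ⟨f, hf, hfc⟩, ⟨by simpa using hxe, hef⟩, rfl, ?_⟩
  intro s hs
  have hc1 := Finset.card_le_card (hCf s hs)
  have hc2 := (T.nonempty_of_mem_faces (hCF s hs)).card_pos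
  simp only [Finset.mem_insert, Finset.mem_singleton]
  obtain h | h | h : s.card = 1 ∨ s.card = 2 ∨ s.card = 3 := by omega
  · left
    exact (Finset.eq_of_subset_of_card_le (by simpa using hx s hs) (by simp [h])).symm
  · exact Or.inr (Or.inl (he s hs h))
  · exact Or.inr (Or.inr (Finset.eq_of_subset_of_card_le (hCf s hs) (by omega)))

theorem exists_flag_of_mem_sdFaces {w : Finset E} (hw : w ∈ sdFaces T.faces) {x : E}
    (hx : ∀ s ∈ T.faces, barycenter s ∈ w → x ∈ s) :
    ∃ (a : Cell T.faces 0) (e : Cell T.faces 1) (f : Cell T.faces 2),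
      IsFlag a e f ∧ a.1 = {x} ∧ w ⊆ tri a e f := by
  obtain ⟨C, hCne, hCF, hC, rfl⟩ := mem_sdFaces_iff.1 hw
  obtain ⟨a, e, f, h, hax, hCs⟩ := exists_flag_of_chain hCne hCF hC (x := x)
    (fun s hs => hx s (hCF s hs) (Finset.mem_image_of_mem _ hs))
  exact ⟨a, e, f, h, hax, by
    rw [IsFlag.tri_eq_image (T := T)]
    exact Finset.image_subset_image hCs⟩

/-- `s` is the smallest simplex in the chain that gives the simplex `w` of the refinement. -/
def IsLowest (T : ClosedTriangulatedSurface E) (s w : Finset E) : Prop :=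
  s ∈ T.faces ∧ barycenter s ∈ w ∧ ∀ s' ∈ T.faces, barycenter s' ∈ w → s ⊆ s'

theorem exists_isLowest {w : Finset E} (hw : w ∈ sdFaces T.faces) : ∃ s, IsLowest T s w := by
  obtain ⟨C, hCne, hCF, hC, rfl⟩ := mem_sdFaces_iff.1 hw
  obtain ⟨m, hmC, hm⟩ := exists_bot hC hCne
  refine ⟨m, hCF m hmC, Finset.mem_image_of_mem _ hmC, fun s hs hsw => ?_⟩
  obtain ⟨r, hr, hrs⟩ := Finset.mem_image.1 hsw
  rw [← barycenter_inj (hCF r hr) hs hrs]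
  exact hm r hr

theorem exists_flag (w : Finset E) (hw : w ∈ sdFaces T.faces) :
    ∃ (a : Cell T.faces 0) (e : Cell T.faces 1) (f : Cell T.faces 2),
      IsFlag a e f ∧ w ⊆ tri a e f := by
  obtain ⟨s, hs⟩ := exists_isLowest hw
  obtain ⟨x, hx⟩ := T.nonempty_of_mem_faces hs.1
  obtain ⟨a, e, f, h, -, h'⟩ := exists_flag_of_mem_sdFaces hw (x := x)
    (fun s' hs' h => hs.2.2 s' hs' h hx)
  exact ⟨a, e, f, h, h'⟩

theorem isPureFamily_sdFaces : IsPureFamily (sdFaces T.faces) where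
  indep _ hs := affineIndependent_of_mem_sdFaces hs
  nonempty s hs := by
    obtain ⟨C, hCne, -, -, rfl⟩ := mem_sdFaces_iff.1 hs
    simpa using hCne
  down _ hs _ hts ht := subset_sdFaces hs hts ht
  pure s hs := by
    obtain ⟨a, e, f, h, h'⟩ := exists_flag s hs
    exact ⟨_, h.tri_mem, h', card_tri a e f⟩

/-- The triangle of a flag as a cell of the refinement. -/
def IsFlag.cell {a : Cell T.faces 0} {e : Cell T.faces 1} {f : Cell T.faces 2}
    (h : IsFlag a e f) : Cell (sdFaces T.faces) 2 := ⟨tri a e f, h.tri_mem, card_tri a e f⟩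

theorem exists_flag_cell (w : Cell (sdFaces T.faces) 2) :
    ∃ (a : Cell T.faces 0) (e : Cell T.faces 1) (f : Cell T.faces 2) (h : IsFlag a e f),
      w = h.cell := by
  obtain ⟨a, e, f, h, h'⟩ := exists_flag w.1 w.2.1
  exact ⟨a, e, f, h, Subtype.ext
    (Finset.eq_of_subset_of_card_le h' (by rw [w.2.2]; exact (card_tri a e f).le))⟩

theorem barycenter_mem_tri {s : Finset E} (hs : s ∈ T.faces) {a : Cell T.faces 0}
    {e : Cell T.faces 1} {f : Cell T.faces 2} :
    barycenter s ∈ tri a e f ↔ s = a.1 ∨ s = e.1 ∨ s = f.1 := by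
  simp only [tri, Finset.mem_insert, Finset.mem_singleton]
  exact or_congr (injOn_barycenter.eq_iff hs a.2.1)
    (or_congr (injOn_barycenter.eq_iff hs e.2.1) (injOn_barycenter.eq_iff hs f.2.1))

theorem eq_of_tri_subset {a a' : Cell T.faces 0} {e e' : Cell T.faces 1} {f f' : Cell T.faces 2}
    (h : tri a e f ⊆ tri a' e' f') : a = a' ∧ e = e' ∧ f = f' := by
  have h1 := (barycenter_mem_tri (T := T) a.2.1).1 (h (by simp [tri]))
  have h2 := (barycenter_mem_tri (T := T) e.2.1).1 (h (by simp [tri]))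
  have h3 := (barycenter_mem_tri (T := T) f.2.1).1 (h (by simp [tri]))
  have n1 := cell_ne (T := T) (k := 0) (l := 1) (by decide)
  have n2 := cell_ne (T := T) (k := 0) (l := 2) (by decide)
  have n3 := cell_ne (T := T) (k := 1) (l := 2) (by decide)
  refine ⟨Subtype.ext ?_, Subtype.ext ?_, Subtype.ext ?_⟩
  · rcases h1 with h | h | h
    exacts [h, absurd h (n1 _ _), absurd h (n2 _ _)]
  · rcases h2 with h | h | h
    exacts [absurd h.symm (n1 _ _), h, absurd h (n3 _ _)]
  · rcases h3 with h | h | h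
    exacts [absurd h.symm (n2 _ _), absurd h.symm (n3 _ _), h]

theorem IsFlag.isLowest {a : Cell T.faces 0} {e : Cell T.faces 1} {f : Cell T.faces 2}
    (h : IsFlag a e f) : IsLowest T a.1 (tri a e f) := by
  refine ⟨a.2.1, by simp [tri], fun s hs hsw => ?_⟩
  rcases (barycenter_mem_tri hs).1 hsw with rfl | rfl | rfl
  exacts [subset_rfl, h.1, h.1.trans h.2]

/-! ### The space as a union of the triangles of the refinement -/

theorem IsFlag.convexHull_subset {a : Cell T.faces 0} {e : Cell T.faces 1} {f : Cell T.faces 2}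
    (h : IsFlag a e f) : convexHull ℝ (tri a e f : Set E) ⊆ convexHull ℝ (f.1 : Set E) := by
  refine convexHull_min ?_ (convex_convexHull ℝ _)
  intro x hx
  simp only [tri, Finset.coe_insert, Finset.coe_singleton, Set.mem_insert_iff,
    Set.mem_singleton_iff] at hx
  rcases hx with rfl | rfl | rfl
  · exact convexHull_mono (by exact_mod_cast h.1.trans h.2) (barycenter_mem_convexHull a.nonempty)
  · exact convexHull_mono (by exact_mod_cast h.2) (barycenter_mem_convexHull e.nonempty)
  · exact barycenter_mem_convexHull f.nonempty

theorem sum_triple {M : Type*} [AddCommMonoid M] {x z u : E} (hxz : x ≠ z) (hxu : x ≠ u)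
    (hzu : z ≠ u) (g : E → M) : ∑ i ∈ ({x, z, u} : Finset E), g i = g x + (g z + g u) := by
  rw [Finset.sum_insert (by simp [hxz, hxu]), Finset.sum_insert (by simp [hzu]),
    Finset.sum_singleton]

/-- The triangle is found by sorting the barycentric coordinates of the point in a facet: the vertex
of the largest one is the node, and the two largest give the edge. -/
theorem exists_flag_of_mem_space {y : E} (hy : y ∈ T.space) :
    ∃ (a : Cell T.faces 0) (e : Cell T.faces 1) (f : Cell T.faces 2),
      IsFlag a e f ∧ y ∈ convexHull ℝ (tri a e f : Set E) := by
  obtain ⟨s, hs, hys⟩ := Geometry.SimplicialComplex.mem_space_iff.1 hy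
  obtain ⟨f, hf, hsf, hfc⟩ := T.pure_two s hs
  have hyf : y ∈ convexHull ℝ (f : Set E) := convexHull_mono (by exact_mod_cast hsf) hys
  rw [Finset.convexHull_eq] at hyf
  obtain ⟨W, hW0, hW1, rfl⟩ := hyf
  rw [Finset.centerMass_eq_of_sum_1 _ _ hW1]
  obtain ⟨x, hx, hxmax⟩ := Finset.exists_max_image f W (Finset.card_pos.1 (by omega))
  have hc2 : (f.erase x).card = 2 := by rw [Finset.card_erase_of_mem hx]; omega
  obtain ⟨z, hz, hzmax⟩ := Finset.exists_max_image (f.erase x) W (Finset.card_pos.1 (by omega))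
  obtain ⟨u, hu⟩ := Finset.card_eq_one.1
    (show ((f.erase x).erase z).card = 1 by rw [Finset.card_erase_of_mem hz]; omega)
  have hfe : f = insert x (insert z {u}) := by
    rw [← hu, Finset.insert_erase hz, Finset.insert_erase hx]
  have huf : u ∈ (f.erase x).erase z := by simp [hu]
  have hxz : x ≠ z := (Finset.ne_of_mem_erase hz).symm
  have hzu : z ≠ u := (Finset.ne_of_mem_erase huf).symm
  have hxu : x ≠ u := (Finset.ne_of_mem_erase (Finset.mem_of_mem_erase huf)).symm
  have hzf : z ∈ f := Finset.mem_of_mem_erase hz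
  have huf' : u ∈ f := Finset.mem_of_mem_erase (Finset.mem_of_mem_erase huf)
  have hsum3 : ∀ g : E → E, ∑ i ∈ f, g i = g x + (g z + g u) := fun g => by
    rw [hfe, sum_triple hxz hxu hzu]
  have h1 := hxmax z hzf
  have h2 := hzmax u (Finset.mem_of_mem_erase huf)
  have h3 := hW0 u huf'
  refine ⟨⟨{x}, T.down_closed hf (by simpa using hx) (by simp), by simp⟩,
    ⟨{x, z}, T.down_closed hf (by simp [Finset.insert_subset_iff, hx, hzf]) (by simp),
      Finset.card_pair hxz⟩, ⟨f, hf, hfc⟩,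
    ⟨by simp, by simp [Finset.insert_subset_iff, hx, hzf]⟩, ?_⟩
  have hb1 : barycenter ({x} : Finset E) = x := by simp [barycenter]
  have hb2 : barycenter ({x, z} : Finset E) = (2 : ℝ)⁻¹ • (x + z) := by
    simp [barycenter, Finset.card_pair hxz, Finset.sum_pair hxz]
  have hb3 : barycenter f = (3 : ℝ)⁻¹ • (x + (z + u)) := by
    rw [barycenter, hfc, hsum3 (fun i => i)]
    norm_num
  have hW1' : W x + (W z + W u) = 1 := by
    rw [← hW1, hfe, sum_triple hxz hxu hzu]
  -- Summation by parts along W x ≥ W z ≥ W u; the factors 1, 2, 3 undo the normalization of the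
  -- barycenters.
  have hy : ∑ i ∈ f, W i • id i = (W x - W z) • barycenter ({x} : Finset E) +
      ((2 * (W z - W u)) • barycenter ({x, z} : Finset E) + (3 * W u) • barycenter f) := by
    rw [hsum3 (fun i => W i • id i), hb1, hb2, hb3]
    simp only [id]
    module
  rw [hy]
  have hconv := convex_convexHull ℝ ((tri
    (⟨{x}, T.down_closed hf (by simpa using hx) (by simp), by simp⟩ : Cell T.faces 0)
    (⟨{x, z}, T.down_closed hf (by simp [Finset.insert_subset_iff, hx, hzf]) (by simp),
      Finset.card_pair hxz⟩ : Cell T.faces 1) (⟨f, hf, hfc⟩ : Cell T.faces 2) : Finset E) : Set E)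
  have := hconv.sum_mem (t := (Finset.univ : Finset (Fin 3)))
    (w := ![W x - W z, 2 * (W z - W u), 3 * W u])
    (z := ![barycenter ({x} : Finset E), barycenter ({x, z} : Finset E), barycenter f]) ?_ ?_ ?_
  · simpa [Fin.sum_univ_three, add_assoc] using this
  · intro i _
    fin_cases i <;> simp <;> linarith
  · simp [Fin.sum_univ_three]; linarith
  · intro i _
    apply subset_convexHull
    fin_cases i <;> simp [tri]

theorem IsFlag.subset_space {a : Cell T.faces 0} {e : Cell T.faces 1} {f : Cell T.faces 2}
    (h : IsFlag a e f) : convexHull ℝ (tri a e f : Set E) ⊆ T.space :=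
  h.convexHull_subset.trans (Geometry.SimplicialComplex.convexHull_subset_space f.2.1)

end ClosedTriangulatedSurface

namespace ClosedTriangulatedSurface

variable {T : ClosedTriangulatedSurface E}

/-! ### Support regions and their boundaries -/

theorem mem_dualCell_singleton {x y : E} : y ∈ dualCell T {x} ↔
    ∃ (a : Cell T.faces 0) (e : Cell T.faces 1) (f : Cell T.faces 2),
      IsFlag a e f ∧ a.1 = {x} ∧ y ∈ convexHull ℝ (tri a e f : Set E) := by
  simp only [dualCell, Set.mem_iUnion, exists_prop]
  constructor
  · rintro ⟨w, ⟨hw, hwx⟩, hy⟩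
    obtain ⟨a, e, f, h, hax, hwt⟩ := exists_flag_of_mem_sdFaces hw (x := x) fun s hs hsw => by
      obtain ⟨s', hs', hxs', hss'⟩ := hwx _ hsw
      rw [barycenter_inj hs hs' hss']
      simpa using hxs'
    exact ⟨a, e, f, h, hax, convexHull_mono (by exact_mod_cast hwt) hy⟩
  · rintro ⟨a, e, f, h, hax, hy⟩
    refine ⟨_, ⟨h.tri_mem, fun z hz => ?_⟩, hy⟩
    simp only [tri, Finset.mem_insert, Finset.mem_singleton] at hz
    rcases hz with rfl | rfl | rfl
    · exact ⟨_, a.2.1, hax.ge, rfl⟩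
    · exact ⟨_, e.2.1, hax.ge.trans h.1, rfl⟩
    · exact ⟨_, f.2.1, hax.ge.trans (h.1.trans h.2), rfl⟩

/-- The recursion over faces ends at the nodes of t, and every node of t lies in some face of
codimension one. -/
theorem supportRegion_eq {r : ℕ} {t : Finset E} (ht : t ∈ T.faces) (hc : t.card = r + 1) :
    supportRegion T r t = ⋃ x ∈ t, dualCell T {x} := by
  induction r generalizing t with
  | zero =>
    obtain ⟨x, rfl⟩ := Finset.card_eq_one.1 hc
    simp [supportRegion]
  | succ r ih =>
    ext y
    simp only [supportRegion, Set.mem_iUnion, exists_prop]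
    constructor
    · rintro ⟨s, ⟨hs, hsc, hst⟩, hy⟩
      rw [ih hs hsc] at hy
      simp only [Set.mem_iUnion, exists_prop] at hy
      obtain ⟨x, hx, hy⟩ := hy
      exact ⟨x, hst hx, hy⟩
    · rintro ⟨x, hx, hy⟩
      obtain ⟨s, hxs, hst, hsc⟩ := Finset.exists_subsuperset_card_eq (n := r + 1)
        (Finset.singleton_subset_iff.2 hx) (by simp) (by omega)
      have hxs : x ∈ s := by simpa using hxs
      have hs := T.down_closed ht hst ⟨x, hxs⟩
      refine ⟨s, ⟨hs, hsc, hst⟩, ?_⟩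
      rw [ih hs hsc]
      simp only [Set.mem_iUnion, exists_prop]
      exact ⟨x, hxs, hy⟩

theorem mem_supportRegion {r : ℕ} (t : Cell T.faces r) {y : E} : y ∈ supportRegion T r t.1 ↔
    ∃ (a : Cell T.faces 0) (e : Cell T.faces 1) (f : Cell T.faces 2),
      IsFlag a e f ∧ a.1 ⊆ t.1 ∧ y ∈ convexHull ℝ (tri a e f : Set E) := by
  rw [supportRegion_eq t.2.1 t.2.2]
  simp only [Set.mem_iUnion, exists_prop, mem_dualCell_singleton]
  constructor
  · rintro ⟨x, hx, a, e, f, h, hax, hy⟩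
    exact ⟨a, e, f, h, by simpa [hax] using hx, hy⟩
  · rintro ⟨a, e, f, h, hat, hy⟩
    obtain ⟨x, hx⟩ := cell_zero_eq_singleton a
    exact ⟨x, by simpa [hx] using hat, a, e, f, h, hx, hy⟩

theorem isClosed_iUnion_tri (P : Cell T.faces 0 → Cell T.faces 1 → Cell T.faces 2 → Prop) :
    IsClosed {y : E | ∃ (a : Cell T.faces 0) (e : Cell T.faces 1) (f : Cell T.faces 2),
      P a e f ∧ y ∈ convexHull ℝ (tri a e f : Set E)} := by
  have : {y : E | ∃ (a : Cell T.faces 0) (e : Cell T.faces 1) (f : Cell T.faces 2),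
      P a e f ∧ y ∈ convexHull ℝ (tri a e f : Set E)} =
      ⋃ (p : {p : Cell T.faces 0 × Cell T.faces 1 × Cell T.faces 2 // P p.1 p.2.1 p.2.2}),
        convexHull ℝ (tri p.1.1 p.1.2.1 p.1.2.2 : Set E) := by
    ext y
    simp
  rw [this]
  exact isClosed_iUnion_of_finite fun p => (Finset.finite_toSet _).isClosed_convexHull ℝ

theorem isClosed_supportRegion {r : ℕ} (t : Cell T.faces r) :
    IsClosed (supportRegion T r t.1) := by
  convert isClosed_iUnion_tri (T := T) (fun a e f => IsFlag a e f ∧ a.1 ⊆ t.1) using 1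
  ext y
  simp only [mem_supportRegion, Set.mem_ofPred_eq, and_assoc]

theorem subset_of_convexHull_subset {w w' : Finset E} (hw : w ∈ sdFaces T.faces)
    (hw' : w' ∈ sdFaces T.faces) (h : barycenter w ∈ convexHull ℝ (w' : Set E)) : w ⊆ w' :=
  subset_of_inner_mem hw hw'
    (barycenter_mem_convexHull (isPureFamily_sdFaces.nonempty w hw)) one_pos le_rfl
    (by simpa using h)

/-- It suffices to test the barycenter of w: a triangle containing this inner point contains the
whole simplex. -/
theorem subset_supportRegion_iff_exists {r : ℕ} (t : Cell T.faces r) {w : Finset E}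
    (hw : w ∈ sdFaces T.faces) : convexHull ℝ (w : Set E) ⊆ supportRegion T r t.1 ↔
    ∃ (a : Cell T.faces 0) (e : Cell T.faces 1) (f : Cell T.faces 2),
      IsFlag a e f ∧ a.1 ⊆ t.1 ∧ w ⊆ tri a e f := by
  constructor
  · intro h
    obtain ⟨a, e, f, hfl, hat, hy⟩ := (mem_supportRegion t).1
      (h (barycenter_mem_convexHull (isPureFamily_sdFaces.nonempty w hw)))
    exact ⟨a, e, f, hfl, hat, subset_of_convexHull_subset hw hfl.tri_mem hy⟩
  · rintro ⟨a, e, f, hfl, hat, hwt⟩ y hy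
    exact (mem_supportRegion t).2 ⟨a, e, f, hfl, hat, convexHull_mono (by exact_mod_cast hwt) hy⟩

theorem subset_closure_diff_iff_exists {r : ℕ} (t : Cell T.faces r) {w : Finset E}
    (hw : w ∈ sdFaces T.faces) :
    convexHull ℝ (w : Set E) ⊆ closure (T.space \ supportRegion T r t.1) ↔
    ∃ (a : Cell T.faces 0) (e : Cell T.faces 1) (f : Cell T.faces 2),
      IsFlag a e f ∧ ¬ a.1 ⊆ t.1 ∧ w ⊆ tri a e f := by
  constructor
  · intro h
    have hsub : closure (T.space \ supportRegion T r t.1) ⊆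
        {y : E | ∃ (a : Cell T.faces 0) (e : Cell T.faces 1) (f : Cell T.faces 2),
          (IsFlag a e f ∧ ¬ a.1 ⊆ t.1) ∧ y ∈ convexHull ℝ (tri a e f : Set E)} := by
      refine closure_minimal ?_ (isClosed_iUnion_tri fun a e f => IsFlag a e f ∧ ¬ a.1 ⊆ t.1)
      rintro y ⟨hyX, hyU⟩
      obtain ⟨a, e, f, hfl, hy⟩ := exists_flag_of_mem_space hyX
      exact ⟨a, e, f, ⟨hfl, fun hat => hyU ((mem_supportRegion t).2 ⟨a, e, f, hfl, hat, hy⟩)⟩, hy⟩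
    obtain ⟨a, e, f, ⟨hfl, hat⟩, hy⟩ := hsub
      (h (barycenter_mem_convexHull (isPureFamily_sdFaces.nonempty w hw)))
    exact ⟨a, e, f, hfl, hat, subset_of_convexHull_subset hw hfl.tri_mem hy⟩
  · rintro ⟨a, e, f, hfl, hat, hwt⟩ y hy
    have hy' : y ∈ convexHull ℝ (tri a e f : Set E) := convexHull_mono (by exact_mod_cast hwt) hy
    have hb := barycenter_mem_convexHull (isPureFamily_sdFaces.nonempty _ hfl.tri_mem)
    -- The point y is approached from the interior of a triangle outside the region. By
    -- `subset_of_inner_mem` such inner points lie in no other triangle, so they avoid the region.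
    have hlim : Filter.Tendsto (fun c : ℝ => (1 - c) • y + c • barycenter (tri a e f))
        (nhdsWithin 0 (Set.Ioc 0 1)) (nhds y) := by
      have : Continuous (fun c : ℝ => (1 - c) • y + c • barycenter (tri a e f)) := by fun_prop
      have := this.tendsto 0
      simp only [sub_zero, one_smul, zero_smul, add_zero] at this
      exact this.mono_left nhdsWithin_le_nhds
    have : (nhdsWithin (0 : ℝ) (Set.Ioc 0 1)).NeBot := by
      rw [← mem_closure_iff_nhdsWithin_neBot, closure_Ioc (by norm_num)]
      simp
    refine mem_closure_of_tendsto hlim ?_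
    filter_upwards [self_mem_nhdsWithin] with c hc
    refine ⟨hfl.subset_space ((convex_convexHull ℝ _) hy' hb (by linarith [hc.2]) hc.1.le
      (by ring)), fun hU => ?_⟩
    obtain ⟨a', e', f', hfl', hat', hmem⟩ := (mem_supportRegion t).1 hU
    have := eq_of_tri_subset (subset_of_inner_mem hfl.tri_mem hfl'.tri_mem hy' hc.1 hc.2 hmem)
    exact hat (this.1 ▸ hat')

/-- This turns the geometry of a region around w into combinatorics: the nodes of the triangles
containing w are exactly the vertices of the least simplex s. -/
theorem IsLowest.exists_flag_iff {s w : Finset E} (hw : w ∈ sdFaces T.faces)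
    (hs : IsLowest T s w) (x : E) : (∃ (a : Cell T.faces 0) (e : Cell T.faces 1)
      (f : Cell T.faces 2), IsFlag a e f ∧ a.1 = {x} ∧ w ⊆ tri a e f) ↔ x ∈ s := by
  constructor
  · rintro ⟨a, e, f, hfl, hax, hwt⟩
    have := hfl.isLowest.2.2 s hs.1 (hwt hs.2.1)
    simpa [hax] using this
  · intro hx
    exact exists_flag_of_mem_sdFaces hw fun s' hs' h => hs.2.2 s' hs' h hx

theorem subset_supportRegion_iff {r : ℕ} (t : Cell T.faces r) {s w : Finset E}
    (hw : w ∈ sdFaces T.faces) (hs : IsLowest T s w) :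
    convexHull ℝ (w : Set E) ⊆ supportRegion T r t.1 ↔ ∃ x ∈ s, x ∈ t.1 := by
  rw [subset_supportRegion_iff_exists t hw]
  simp only [← hs.exists_flag_iff hw]
  constructor
  · rintro ⟨a, e, f, hfl, hat, hwt⟩
    obtain ⟨x, hx⟩ := cell_zero_eq_singleton a
    exact ⟨x, ⟨a, e, f, hfl, hx, hwt⟩, by simpa [hx] using hat⟩
  · rintro ⟨x, ⟨a, e, f, hfl, hx, hwt⟩, hxt⟩
    exact ⟨a, e, f, hfl, by simpa [hx] using hxt, hwt⟩

/-- A simplex is in the relative boundary iff it lies both in a triangle with node in t and in a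
triangle with node outside t. -/
theorem subset_boundaryIn_iff {r : ℕ} (t : Cell T.faces r) {s w : Finset E}
    (hw : w ∈ sdFaces T.faces) (hs : IsLowest T s w) :
    convexHull ℝ (w : Set E) ⊆ boundaryIn T.space (supportRegion T r t.1) ↔
      (∃ x ∈ s, x ∈ t.1) ∧ ∃ x ∈ s, x ∉ t.1 := by
  rw [boundaryIn, (isClosed_supportRegion t).closure_eq, Set.subset_inter_iff,
    subset_supportRegion_iff t hw hs, subset_closure_diff_iff_exists t hw]
  simp only [← hs.exists_flag_iff hw]
  refine and_congr_right fun _ => ?_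
  constructor
  · rintro ⟨a, e, f, hfl, hat, hwt⟩
    obtain ⟨x, hx⟩ := cell_zero_eq_singleton a
    exact ⟨x, ⟨a, e, f, hfl, hx, hwt⟩, by simpa [hx] using hat⟩
  · rintro ⟨x, ⟨a, e, f, hfl, hx, hwt⟩, hxt⟩
    exact ⟨a, e, f, hfl, by simpa [hx] using hxt, hwt⟩

/-! ### Local support in terms of coefficients -/

/-- The coefficients of `μ_v` vanish on all cells that are not inner cells of `U_v`. -/
def SupportedInside (R : Coeffs T) : Prop :=
  ∀ (q r : ℕ) (h : q + r = 2) (t : Cell T.faces r) (w : Cell (sdFaces T.faces) q) (s : Finset E),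
    IsLowest T s w.1 → ¬ s ⊆ t.1 → R q r h t w = 0

theorem _root_.BuffaChristiansen.LocalSupport.supportedInside
    {o' : Numbering (sdFaces T.faces)} {R : Coeffs T} (hR : LocalSupport o' R) :
    SupportedInside R := by
  intro q r h t w s hs hst
  by_cases hU : convexHull ℝ (w.1 : Set E) ⊆ supportRegion T r t.1
  · refine hR.coeff_boundary q r h t w ((subset_boundaryIn_iff t w.2.1 hs).2
      ⟨(subset_supportRegion_iff t w.2.1 hs).1 hU, ?_⟩)
    exact Finset.not_subset.1 hst
  · exact hR.coeff_outside q r h t w hU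

theorem bcForm_apply (o' : Numbering (sdFaces T.faces)) (R : Coeffs T) {q r : ℕ} (h : q + r = 2)
    (t : Cell T.faces r) (τ : Cell (sdFaces T.faces) 2) (y : Tangent τ.1) :
    bcForm o' R h t τ y = ∑ w, R q r h t w • whitneyBasis o' w τ y := by
  simp [bcForm, Finset.sum_apply]

theorem whitneyBasis_eq_zero {o' : Numbering (sdFaces T.faces)} {q : ℕ}
    {w : Cell (sdFaces T.faces) q} {τ : Cell (sdFaces T.faces) 2} (h : ¬ w.1 ⊆ τ.1) :
    whitneyBasis o' w τ = 0 := by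
  obtain ⟨x, hxt, hxs⟩ := Finset.not_subset.1 h
  obtain ⟨i₀, rfl⟩ := o'.exists_vert w hxt
  exact whitney_eq_zero isPureFamily_sdFaces hxs

/-- In a triangle whose node is outside t, every cell w has that node in its least simplex, so the
least simplex is not contained in t and the coefficient vanishes. -/
theorem bcForm_eq_zero (o' : Numbering (sdFaces T.faces)) {R : Coeffs T}
    (hR : SupportedInside R) {q r : ℕ} (h : q + r = 2) (t : Cell T.faces r)
    {a : Cell T.faces 0} {e : Cell T.faces 1} {f : Cell T.faces 2} (hfl : IsFlag a e f)
    (hat : ¬ a.1 ⊆ t.1) : bcForm o' R h t hfl.cell = 0 := by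
  funext y
  rw [bcForm_apply]
  refine Finset.sum_eq_zero fun w _ => ?_
  by_cases hw : w.1 ⊆ hfl.cell.1
  · obtain ⟨s, hs⟩ := exists_isLowest w.2.1
    have := hfl.isLowest.2.2 s hs.1 (hw hs.2.1)
    rw [hR q r h t w s hs (fun h => hat (this.trans h)), zero_smul]
  · rw [whitneyBasis_eq_zero hw]
    simp

/-- Whitney forms are affine along segments. -/
theorem whitney_segment (F : Set (Finset E)) {q : ℕ} (p : Fin (q + 1) → E) (τ : Cell F 2)
    (y z : Tangent τ.1) (c : ℝ) : whitney F p τ ((1 - c) • y + c • z) =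
      (1 - c) • whitney F p τ y + c • whitney F p τ z := by
  ext v
  have : ∀ x, hat τ.1 x ((1 - c) • y + c • z) = (1 - c) * hat τ.1 x y + c * hat τ.1 x z := by
    intro x
    simp only [hat, map_add, map_smul, smul_eq_mul]
    ring
  simp only [ContinuousAlternatingMap.add_apply, ContinuousAlternatingMap.smul_apply,
    whitney_apply, this, smul_eq_mul, Finset.mul_sum, ← Finset.sum_add_distrib]
  refine Finset.sum_congr rfl fun i _ => ?_
  ring

/-- The hypothesis `hne` is needed for equality of the support with the region: one nonzero
coefficient in a triangle makes the form nonzero at a vertex of it, and affinity spreads this to a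
dense set. -/
theorem localSupport_of_supportedInside {o' : Numbering (sdFaces T.faces)} {R : Coeffs T}
    (hR : SupportedInside R)
    (hne : ∀ (q r : ℕ) (h : q + r = 2) (t : Cell T.faces r) (a : Cell T.faces 0)
      (e : Cell T.faces 1) (f : Cell T.faces 2), IsFlag a e f → a.1 ⊆ t.1 →
      ∃ w : Cell (sdFaces T.faces) q, w.1 ⊆ tri a e f ∧ R q r h t w ≠ 0) :
    LocalSupport o' R := by
  have hbd : ∀ (q r : ℕ) (h : q + r = 2) (t : Cell T.faces r) (w : Cell (sdFaces T.faces) q),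
      convexHull ℝ (w.1 : Set E) ⊆ boundaryIn T.space (supportRegion T r t.1) →
      R q r h t w = 0 := by
    intro q r h t w hw
    obtain ⟨s, hs⟩ := exists_isLowest w.2.1
    exact hR q r h t w s hs (Finset.not_subset.2 ((subset_boundaryIn_iff t w.2.1 hs).1 hw).2)
  refine ⟨?_, ?_, ?_, hbd⟩
  · intro q r h t
    apply subset_antisymm
    · refine closure_minimal ?_ (isClosed_supportRegion t)
      rintro x ⟨τ, y, rfl, hx, hne⟩
      obtain ⟨a, e, f, hfl, rfl⟩ := exists_flag_cell τ
      by_cases hat : a.1 ⊆ t.1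
      · exact (mem_supportRegion t).2 ⟨a, e, f, hfl, hat, hx⟩
      · exact absurd (congrFun (bcForm_eq_zero o' hR h t hfl hat) y) hne
    · intro x hx
      obtain ⟨a, e, f, hfl, hat, hx⟩ := (mem_supportRegion t).1 hx
      obtain ⟨w, hwt, hRw⟩ := hne q r h t a e f hfl hat
      set τ := hfl.cell
      have hxs : x ∈ affineSpan ℝ (τ.1 : Set E) := convexHull_subset_affineSpan _ hx
      have hy0 : x - barycenter τ.1 ∈ Tangent τ.1 := by
        have := vsub_mem_vectorSpan_of_mem_affineSpan_of_mem_affineSpan hxs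
          (barycenter_mem_affineSpan τ.nonempty)
        simpa using this
      set y : Tangent τ.1 := ⟨x - barycenter τ.1, hy0⟩ with hy
      have hv := evalFrame_sum_whitneyBasis isPureFamily_sdFaces o' (R q r h t) w τ
        (fun i => hwt (o'.vert_mem w i))
      have hv0 : (q.factorial : ℝ) * R q r h t w ≠ 0 :=
        mul_ne_zero (by exact_mod_cast q.factorial_ne_zero) hRw
      have hz : ∃ z : Tangent τ.1, barycenter τ.1 + (z : E) ∈ convexHull ℝ (τ.1 : Set E) ∧
          bcForm o' R h t τ z ≠ 0 := by
        have hz0 : o'.vert w 0 - barycenter τ.1 ∈ Tangent τ.1 := by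
          have := vsub_mem_vectorSpan_of_mem_affineSpan_of_mem_affineSpan
            (mem_affineSpan ℝ (s := (τ.1 : Set E)) (hwt (o'.vert_mem w 0)))
            (barycenter_mem_affineSpan τ.nonempty)
          simpa using this
        refine ⟨⟨o'.vert w 0 - barycenter τ.1, hz0⟩, ?_, fun h0 => hv0 (hv.symm.trans ?_)⟩
        · simp only [add_sub_cancel]
          exact subset_convexHull ℝ _ (hwt (o'.vert_mem w 0))
        · change bcForm o' R h t τ _ _ = 0
          rw [h0]
          rfl
      obtain ⟨z, hz, hz0⟩ := hz
      by_cases hy0 : bcForm o' R h t τ y = 0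
      -- If the form vanishes at y and not at z, then along the segment it equals c times its value
      -- at z. So points where it is nonzero converge to y.
      · have hlim : Filter.Tendsto (fun c : ℝ => barycenter τ.1 +
            (((1 - c) • y + c • z : Tangent τ.1) : E)) (nhdsWithin 0 (Set.Ioc 0 1)) (nhds x) := by
          have : Continuous (fun c : ℝ => barycenter τ.1 +
              (((1 - c) • y + c • z : Tangent τ.1) : E)) := by fun_prop
          have := this.tendsto 0
          simp only [sub_zero, one_smul, zero_smul, add_zero, hy, add_sub_cancel] at this
          exact this.mono_left nhdsWithin_le_nhds
        have : (nhdsWithin (0 : ℝ) (Set.Ioc 0 1)).NeBot := by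
          rw [← mem_closure_iff_nhdsWithin_neBot, closure_Ioc (by norm_num)]
          simp
        refine mem_closure_of_tendsto hlim ?_
        filter_upwards [self_mem_nhdsWithin] with c hc
        refine ⟨τ, _, rfl, ?_, ?_⟩
        · have := (convex_convexHull ℝ (τ.1 : Set E)) hx hz (a := 1 - c) (b := c)
            (by linarith [hc.2]) hc.1.le (by ring)
          convert this using 1
          simp only [hy, Submodule.coe_add, Submodule.coe_smul]
          module
        · have : bcForm o' R h t τ ((1 - c) • y + c • z) = c • bcForm o' R h t τ z := by
            have h1 : bcForm o' R h t τ ((1 - c) • y + c • z) =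
                (1 - c) • bcForm o' R h t τ y + c • bcForm o' R h t τ z := by
              simp only [bcForm_apply, whitneyBasis, whitney_segment, smul_add, Finset.smul_sum,
                Finset.sum_add_distrib]
              congr 1 <;> exact Finset.sum_congr rfl fun i _ => smul_comm _ _ _
            rw [h1, hy0, smul_zero, zero_add]
          rw [this]
          exact smul_ne_zero hc.1.ne' hz0
      · refine subset_closure ⟨τ, y, by simp [hy], hx, hy0⟩
  · intro q r h t τ w hw hwτ hwb y hy v hv
    rw [bcForm_apply]
    rw [ContinuousAlternatingMap.sum_apply]
    refine Finset.sum_eq_zero fun w' _ => ?_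
    rw [ContinuousAlternatingMap.smul_apply]
    -- A cell inside w lies in the boundary and has coefficient zero; the Whitney form of any other
    -- cell has zero trace on w.
    by_cases hww : w'.1 ⊆ w
    · rw [hbd q r h t w' ((convexHull_mono (by exact_mod_cast hww)).trans hwb), zero_smul]
    · obtain ⟨x, hxt, hxs⟩ := Finset.not_subset.1 hww
      obtain ⟨i₀, rfl⟩ := o'.exists_vert w' hxt
      rw [whitneyBasis, whitney_trace isPureFamily_sdFaces hwτ hxs hy hv, smul_zero]
  · intro q r h t w hw
    obtain ⟨s, hs⟩ := exists_isLowest w.2.1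
    refine hR q r h t w s hs fun hst => hw ((subset_supportRegion_iff t w.2.1 hs).2 ?_)
    obtain ⟨x, hx⟩ := T.nonempty_of_mem_faces hs.1
    exact ⟨x, hx, hst hx⟩

end ClosedTriangulatedSurface

/-! ### Incidence numbers -/

theorem incidence_zero_of_not_subset {F : Set (Finset E)} (o : Numbering F) {a : Cell F 0}
    {e : Cell F 1} (h : ¬ a.1 ⊆ e.1) : incidence o a e = 0 := by
  have : ∀ i, o.vert a 0 ≠ o.vert e i := fun i hi => h fun x hx => by
    obtain ⟨j, rfl⟩ := o.exists_vert a hx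
    rw [show j = 0 from Fin.fin_one_eq_zero j, hi]
    exact o.vert_mem e i
  simp [incidence_zero, this]

theorem incidence_zero_sq {F : Set (Finset E)} (o : Numbering F) {a : Cell F 0}
    {e : Cell F 1} (h : a.1 ⊆ e.1) : (incidence o a e : ℝ) * incidence o a e = 1 := by
  obtain ⟨i, hi⟩ := o.exists_vert e (h (o.vert_mem a 0))
  have h01 : o.vert e 0 ≠ o.vert e 1 := (o.vert_injective e).ne (by decide)
  rw [incidence_zero, ← hi]
  fin_cases i <;> simp [h01, h01.symm]

theorem incidence_one_of_not_subset {F : Set (Finset E)} (o : Numbering F) {e : Cell F 1}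
    {f : Cell F 2} (h : ¬ e.1 ⊆ f.1) : incidence o e f = 0 := by
  obtain ⟨x, hxe, hxf⟩ := Finset.not_subset.1 h
  obtain ⟨j, rfl⟩ := o.exists_vert e hxe
  have : ∀ i, o.vert e j ≠ o.vert f i := fun i hi => hxf (hi ▸ o.vert_mem f i)
  fin_cases j <;> simp at this <;> simp [incidence_one, this]

theorem incidence_one_sq {F : Set (Finset E)} (o : Numbering F) {e : Cell F 1}
    {f : Cell F 2} (h : e.1 ⊆ f.1) : (incidence o e f : ℝ) * incidence o e f = 1 := by
  obtain ⟨i, hi⟩ := o.exists_vert f (h (o.vert_mem e 0))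
  obtain ⟨j, hj⟩ := o.exists_vert f (h (o.vert_mem e 1))
  have hij : i ≠ j := by
    rintro rfl
    exact absurd (o.vert_injective e (hi.symm.trans hj)) (by decide)
  rw [incidence_one, ← hi, ← hj]
  simp only [(o.vert_injective f).eq_iff]
  clear hi hj
  fin_cases i <;> fin_cases j <;> simp at hij ⊢

/-- The boundary of a boundary is zero. This is read off from d d λ_a = 0, which holds because dλ_a
is constant on each facet, by uniqueness of Whitney coefficients. -/
theorem sum_incidence_mul_incidence {F : Set (Finset E)} (hF : IsPureFamily F) (o : Numbering F)
    [Fintype (Cell F 1)] [Fintype (Cell F 2)] (a : Cell F 0) (f : Cell F 2) :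
    ∑ e : Cell F 1, (incidence o e f : ℝ) * incidence o a e = 0 := by
  refine (d_sum_whitneyBasis_eq_iff hF o le_rfl (fun e => (incidence o a e : ℝ))
    (fun _ => 0)).1 ?_ f
  rw [← d_whitneyBasis_zero hF o a]
  simp only [zero_smul, Finset.sum_const_zero]
  funext τ y
  have : (whitneyBasis o a).d τ = fun _ => (whitneyBasis o a).d τ 0 := by
    funext z
    ext v
    exact (d_whitney_zero_apply _ τ z v).trans (d_whitney_zero_apply _ τ 0 v).symm
  rw [PForm.d, this]
  simp only [extDeriv, fderiv_fun_const, Pi.zero_apply]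
  exact map_zero (ContinuousAlternatingMap.alternatizeUncurryFinCLM ℝ (Tangent τ.1) ℝ)

/-- Used for the two facets at an edge and for the two edges of a facet at a node. -/
theorem sum_eq_of_pair {ι : Type*} [Fintype ι] {P : ι → Prop} {i j : ι} (hij : i ≠ j)
    (h : ∀ k, P k ↔ k = i ∨ k = j) {g : ι → ℝ} (hg : ∀ k, ¬ P k → g k = 0) :
    ∑ k, g k = g i + g j := by
  rw [← Finset.sum_pair hij]
  symm
  refine Finset.sum_subset (Finset.subset_univ _) fun k _ hk => hg k fun hP => hk ?_
  simpa using (h k).1 hP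

namespace ClosedTriangulatedSurface

variable {T : ClosedTriangulatedSurface E}

/-! ### Local structure of the surface -/

theorem exists_two_facets (e : Cell T.faces 1) : ∃ f g : Cell T.faces 2, f ≠ g ∧
    ∀ k : Cell T.faces 2, e.1 ⊆ k.1 ↔ k = f ∨ k = g := by
  obtain ⟨f, g, hfg, h⟩ := Set.ncard_eq_two.1 (T.two_facets e.1 e.2.1 e.2.2)
  have hf : f ∈ ({f, g} : Set (Finset E)) := by simp
  have hg : g ∈ ({f, g} : Set (Finset E)) := by simp
  rw [← h] at hf hg
  refine ⟨⟨f, hf.1, hf.2.1⟩, ⟨g, hg.1, hg.2.1⟩, fun h => hfg (congrArg Subtype.val h), fun k => ?_⟩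
  have : k.1 ∈ {t : Finset E | t ∈ T.faces ∧ t.card = 3 ∧ e.1 ⊆ t} ↔ k.1 = f ∨ k.1 = g := by
    rw [h]; simp
  rw [Subtype.ext_iff, Subtype.ext_iff, ← this]
  exact ⟨fun h => ⟨k.2.1, k.2.2, h⟩, fun h => h.2.2⟩

theorem exists_two_edges {a : Cell T.faces 0} {f : Cell T.faces 2} (haf : a.1 ⊆ f.1) :
    ∃ e e' : Cell T.faces 1, e ≠ e' ∧
      ∀ k : Cell T.faces 1, IsFlag a k f ↔ k = e ∨ k = e' := by
  obtain ⟨x, hx⟩ := cell_zero_eq_singleton a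
  have hxf : x ∈ f.1 := by simpa [hx] using haf
  obtain ⟨y, z, hyz, h⟩ := Finset.card_eq_two.1
    (show (f.1.erase x).card = 2 by rw [Finset.card_erase_of_mem hxf, f.2.2])
  have hf : f.1 = {x, y, z} := by rw [← Finset.insert_erase hxf, h]
  have hy : y ∈ f.1.erase x := by simp [h]
  have hz : z ∈ f.1.erase x := by simp [h]
  rw [Finset.mem_erase] at hy hz
  have hmem : ∀ u ∈ f.1, u ≠ x → ({x, u} : Finset E) ∈ T.faces ∧ ({x, u} : Finset E).card = 1 + 1 :=
    fun u hu hux => ⟨T.down_closed f.2.1 (by simp [Finset.insert_subset_iff, hxf, hu]) (by simp),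
      Finset.card_pair hux.symm⟩
  refine ⟨⟨{x, y}, hmem y hy.2 hy.1⟩, ⟨{x, z}, hmem z hz.2 hz.1⟩, fun h => ?_, fun k => ?_⟩
  · have : y ∈ ({x, z} : Finset E) := by
      have h' : ({x, y} : Finset E) = {x, z} := congrArg Subtype.val h
      rw [← h']; simp
    simp [hy.1, hyz] at this
  · rw [Subtype.ext_iff, Subtype.ext_iff, IsFlag, hx, Finset.singleton_subset_iff]
    simp only
    constructor
    · rintro ⟨hxk, hkf⟩
      obtain ⟨u, hu⟩ := Finset.card_eq_one.1
        (show (k.1.erase x).card = 1 by rw [Finset.card_erase_of_mem hxk, k.2.2])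
      have hk : k.1 = {x, u} := by rw [← Finset.insert_erase hxk, hu]
      have huk : u ∈ k.1.erase x := by simp [hu]
      have : u ∈ f.1 := hkf (Finset.mem_of_mem_erase huk)
      rw [hf] at this
      simp only [Finset.mem_insert, Finset.mem_singleton, Finset.ne_of_mem_erase huk,
        false_or] at this
      rcases this with rfl | rfl
      exacts [Or.inl hk, Or.inr hk]
    · rintro (h | h) <;> rw [h] <;> simp [Finset.insert_subset_iff, hxf, hy.2, hz.2]

theorem exists_facet_of_edge (e : Cell T.faces 1) : ∃ f : Cell T.faces 2, e.1 ⊆ f.1 := by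
  obtain ⟨f, _, _, h⟩ := exists_two_facets e
  exact ⟨f, (h f).2 (Or.inl rfl)⟩

/-- The facets and edges at a vertex are connected. -/
theorem eq_of_link {a : Cell T.faces 0} {α : Type*} {k : Cell T.faces 1 → Cell T.faces 2 → α}
    (h1 : ∀ e f f', IsFlag a e f → IsFlag a e f' → k e f = k e f')
    (h2 : ∀ e e' f, IsFlag a e f → IsFlag a e' f → k e f = k e' f)
    {e e' : Cell T.faces 1} {f f' : Cell T.faces 2} (h : IsFlag a e f) (h' : IsFlag a e' f') :
    k e f = k e' f' := by
  obtain ⟨x, hx⟩ := cell_zero_eq_singleton a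
  have hxf : x ∈ f.1 := (h.1.trans h.2) (by simp [hx])
  have hxf' : x ∈ f'.1 := (h'.1.trans h'.2) (by simp [hx])
  have hconn := T.link_connected x f.1 f'.1 f.2.1 f.2.2 hxf f'.2.1 f'.2.2 hxf'
  have : ∀ t' : Finset E, Relation.ReflTransGen
      (fun u v : Finset E => (u ∈ T.faces ∧ u.card = 3) ∧ (v ∈ T.faces ∧ v.card = 3) ∧
        ∃ e ∈ T.faces, e.card = 2 ∧ x ∈ e ∧ e ⊆ u ∧ e ⊆ v) f.1 t' →
      ∀ (g : Cell T.faces 2) (e' : Cell T.faces 1), g.1 = t' → IsFlag a e' g →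
        k e f = k e' g := by
    intro t' ht'
    induction ht' with
    | refl =>
      intro g e' hg hfl
      obtain rfl : g = f := Subtype.ext hg
      exact h2 _ _ _ h hfl
    | tail _ hstep ih =>
      intro g e' hg hfl
      obtain ⟨hu, hv, e₀, he₀, hc, hxe, heu, hev⟩ := hstep
      subst hg
      have ha : a.1 ⊆ e₀ := by simpa [hx] using hxe
      have hi1 := ih ⟨_, hu⟩ ⟨e₀, he₀, hc⟩ rfl ⟨ha, heu⟩
      rw [hi1, h1 ⟨e₀, he₀, hc⟩ ⟨_, hu⟩ g ⟨ha, heu⟩ ⟨ha, hev⟩]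
      exact h2 _ _ _ ⟨ha, hev⟩ hfl
  exact this f'.1 hconn f' e' rfl h'

/-! ### Signs of flags and the cycle around a vertex -/

variable {o : Numbering T.faces} (σ : SurfaceOrientation T o)

/-- The sign of a facet in the orientation of the surface. -/
def _root_.BuffaChristiansen.SurfaceOrientation.sgn (f : Cell T.faces 2) : ℝ := ((σ.sign f : ℤ) : ℝ)

theorem sgn_sq (f : Cell T.faces 2) : σ.sgn f * σ.sgn f = 1 := by
  rw [SurfaceOrientation.sgn]
  rcases Int.units_eq_one_or (σ.sign f) with h | h <;> simp [h]

theorem sum_sgn_incidence (e : Cell T.faces 1) :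
    ∑ f : Cell T.faces 2, σ.sgn f * incidence o e f = 0 := by
  have := σ.closed e
  simp only [SurfaceOrientation.sgn]
  exact_mod_cast this

/-- The orientation of the triangle of a flag, relative to the orientation of the surface. -/
def flagSign (a : Cell T.faces 0) (e : Cell T.faces 1) (f : Cell T.faces 2) : ℝ :=
  -(σ.sgn f * incidence o e f * incidence o a e)

theorem flagSign_of_not {a : Cell T.faces 0} {e : Cell T.faces 1} {f : Cell T.faces 2}
    (h : ¬ IsFlag a e f) : flagSign σ a e f = 0 := by
  rw [flagSign]
  rw [IsFlag, not_and_or] at h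
  rcases h with h | h
  · rw [incidence_zero_of_not_subset o h]; simp
  · rw [incidence_one_of_not_subset o h]; simp

theorem flagSign_sq {a : Cell T.faces 0} {e : Cell T.faces 1} {f : Cell T.faces 2}
    (h : IsFlag a e f) : flagSign σ a e f * flagSign σ a e f = 1 := by
  have h1 := sgn_sq σ f
  have h2 := incidence_zero_sq o h.1
  have h3 := incidence_one_sq o h.2
  rw [flagSign]
  linear_combination (σ.sgn f * σ.sgn f * incidence o e f * incidence o e f) * h2 +
    (σ.sgn f * σ.sgn f) * h3 + h1

/-- Together with `sum_flagSign_edges`, this makes the signs alternate along the link: neighbouring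
flags at a node, sharing an edge or a facet, have opposite signs. -/
theorem sum_flagSign_facets (a : Cell T.faces 0) (e : Cell T.faces 1) :
    ∑ f : Cell T.faces 2, flagSign σ a e f = 0 := by
  simp only [flagSign]
  rw [Finset.sum_neg_distrib, ← Finset.sum_mul, sum_sgn_incidence]
  simp

theorem sum_flagSign_edges (a : Cell T.faces 0) (f : Cell T.faces 2) :
    ∑ e : Cell T.faces 1, flagSign σ a e f = 0 := by
  simp only [flagSign, mul_assoc]
  rw [Finset.sum_neg_distrib, ← Finset.mul_sum, sum_incidence_mul_incidence T.isPureFamily]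
  simp

/-- A function on the flags at a vertex whose signed sum vanishes is a coboundary: the link of the
vertex is a cycle. -/
theorem exists_potential (a : Cell T.faces 0) (g : Cell T.faces 1 → Cell T.faces 2 → ℝ)
    (hg : ∑ e : Cell T.faces 1, ∑ f : Cell T.faces 2, flagSign σ a e f * g e f = 0) :
    ∃ φ : Finset E → ℝ, ∀ e f, IsFlag a e f → φ f.1 - φ e.1 = g e f := by
  let L : (Finset E → ℝ) →ₗ[ℝ] (Cell T.faces 1 × Cell T.faces 2 → ℝ) :=
    { toFun := fun φ p => if IsFlag a p.1 p.2 then φ p.2.1 - φ p.1.1 else 0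
      map_add' := fun φ ψ => by
        funext p
        by_cases h : IsFlag a p.1 p.2
        · simp only [if_pos h, Pi.add_apply]; ring
        · simp [if_neg h]
      map_smul' := fun c φ => by
        funext p
        by_cases h : IsFlag a p.1 p.2
        · simp only [if_pos h, Pi.smul_apply, smul_eq_mul, RingHom.id_apply]; ring
        · simp [if_neg h] }
  have hL : ∀ φ p, L φ p = if IsFlag a p.1 p.2 then φ p.2.1 - φ p.1.1 else 0 := fun _ _ => rfl
  set g' : Cell T.faces 1 × Cell T.faces 2 → ℝ := fun p => if IsFlag a p.1 p.2 then g p.1 p.2 else 0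
    with hg'
  by_cases hmem : g' ∈ LinearMap.range L
  · obtain ⟨φ, hφ⟩ := hmem
    refine ⟨φ, fun e f h => ?_⟩
    have := congrFun hφ (e, f)
    rw [hL, hg'] at this
    simpa [h] using this
  -- Duality: if g' is not a coboundary, some functional ψ kills all coboundaries but not g'. Its
  -- weights d on the flags turn out to be a multiple of the flag signs, which kills g' as well.
  exfalso
  obtain ⟨ψ, hψg, hψL⟩ := Submodule.exists_le_ker_of_notMem hmem
  have hψ : ∀ v : Cell T.faces 1 × Cell T.faces 2 → ℝ, ψ v = ∑ p, v p * ψ (Pi.single p 1) := by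
    intro v
    conv_lhs => rw [← Finset.univ_sum_single v, map_sum]
    refine Finset.sum_congr rfl fun p _ => ?_
    rw [← smul_eq_mul, ← map_smul, ← Pi.single_smul, smul_eq_mul, mul_one]
  set d : Cell T.faces 1 → Cell T.faces 2 → ℝ := fun e f =>
    if IsFlag a e f then ψ (Pi.single (e, f) 1) else 0 with hd
  have hd0 : ∀ e f, ¬ IsFlag a e f → d e f = 0 := fun e f h => by simp [hd, h]
  have hker : ∀ φ : Finset E → ℝ,
      ∑ e : Cell T.faces 1, ∑ f : Cell T.faces 2, (φ f.1 - φ e.1) * d e f = 0 := by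
    intro φ
    have : ψ (L φ) = 0 := hψL (LinearMap.mem_range_self L φ)
    rw [hψ, Fintype.sum_prod_type] at this
    rw [← this]
    refine Finset.sum_congr rfl fun e _ => Finset.sum_congr rfl fun f _ => ?_
    rw [hL]
    by_cases h : IsFlag a e f <;> simp [hd, h]
  -- Testing ψ on the potential concentrated at one edge, and then at one facet, shows that d sums
  -- to zero there. The flag signs do so too, hence d times the sign agrees on neighbouring flags.
  have hde : ∀ e, ∑ f : Cell T.faces 2, d e f = 0 := by
    intro e
    have := hker (Pi.single e.1 1)
    rw [Finset.sum_eq_single e] at this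
    · have h2 : ∀ f : Cell T.faces 2, (Pi.single e.1 1 : Finset E → ℝ) f.1 = 0 := fun f =>
        Pi.single_eq_of_ne (cell_ne (by decide) f e) _
      simpa [h2] using this
    · intro e' _ hne
      refine Finset.sum_eq_zero fun f _ => ?_
      rw [Pi.single_eq_of_ne (cell_ne (by decide) f e),
        Pi.single_eq_of_ne (fun h => hne (Subtype.ext h))]
      simp
    · simp
  have hdf : ∀ f, ∑ e : Cell T.faces 1, d e f = 0 := by
    intro f
    have := hker (Pi.single f.1 1)
    rw [Finset.sum_comm, Finset.sum_eq_single f] at this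
    · have h2 : ∀ e : Cell T.faces 1, (Pi.single f.1 1 : Finset E → ℝ) e.1 = 0 := fun e =>
        Pi.single_eq_of_ne (cell_ne (by decide) e f) _
      simpa [h2] using this
    · intro f' _ hne
      refine Finset.sum_eq_zero fun e _ => ?_
      rw [Pi.single_eq_of_ne (cell_ne (by decide) e f),
        Pi.single_eq_of_ne (fun h => hne (Subtype.ext h))]
      simp
    · simp
  have hopp : ∀ {s s' c c' : ℝ}, s * s = 1 → s + s' = 0 → c + c' = 0 → c * s = c' * s' := by
    intro s s' c c' _ h2 h3
    rw [eq_neg_of_add_eq_zero_right h2, eq_neg_of_add_eq_zero_right h3]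
    ring
  have hk1 : ∀ e f f', IsFlag a e f → IsFlag a e f' →
      d e f * flagSign σ a e f = d e f' * flagSign σ a e f' := by
    intro e f f' h h'
    obtain ⟨f₁, f₂, hne, hiff⟩ := exists_two_facets e
    have e1 := hde e
    have e2 := sum_flagSign_facets σ a e
    rw [sum_eq_of_pair hne hiff fun k hk => hd0 e k fun hfl => hk hfl.2] at e1
    rw [sum_eq_of_pair hne hiff fun k hk => flagSign_of_not σ fun hfl => hk hfl.2] at e2
    have key := hopp (flagSign_sq σ ⟨h.1, (hiff f₁).2 (Or.inl rfl)⟩) e2 e1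
    rcases (hiff f).1 h.2 with rfl | rfl <;> rcases (hiff f').1 h'.2 with rfl | rfl
    exacts [rfl, key, key.symm, rfl]
  have hk2 : ∀ e e' f, IsFlag a e f → IsFlag a e' f →
      d e f * flagSign σ a e f = d e' f * flagSign σ a e' f := by
    intro e e' f h h'
    obtain ⟨e₁, e₂, hne, hiff⟩ := exists_two_edges (h.1.trans h.2)
    have e1 := hdf f
    have e2 := sum_flagSign_edges σ a f
    rw [sum_eq_of_pair hne hiff fun k hk => hd0 k f hk] at e1
    rw [sum_eq_of_pair hne hiff fun k hk => flagSign_of_not σ hk] at e2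
    have key := hopp (flagSign_sq σ ((hiff e₁).2 (Or.inl rfl))) e2 e1
    rcases (hiff e).1 h with rfl | rfl <;> rcases (hiff e').1 h' with rfl | rfl
    exacts [rfl, key, key.symm, rfl]
  -- The link is connected, so d times the sign is constant; the signs square to 1, so d is this
  -- constant times the sign.
  have hconst : ∃ c, ∀ e f, d e f = c * flagSign σ a e f := by
    by_cases hex : ∃ e f, IsFlag a e f
    · obtain ⟨e₀, f₀, h₀⟩ := hex
      refine ⟨d e₀ f₀ * flagSign σ a e₀ f₀, fun e f => ?_⟩
      by_cases h : IsFlag a e f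
      · rw [eq_of_link (k := fun e f => d e f * flagSign σ a e f) hk1 hk2 h₀ h, mul_assoc,
          flagSign_sq σ h, mul_one]
      · rw [hd0 e f h, flagSign_of_not σ h, mul_zero]
    · push Not at hex
      exact ⟨0, fun e f => by rw [hd0 e f (hex e f), zero_mul]⟩
  obtain ⟨c, hc⟩ := hconst
  apply hψg
  rw [hψ, Fintype.sum_prod_type]
  have : ∀ e f, g' (e, f) * ψ (Pi.single (e, f) 1) = c * (flagSign σ a e f * g e f) := by
    intro e f
    rw [← mul_assoc, ← hc]
    by_cases h : IsFlag a e f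
    · simp [hg', hd, h, mul_comm]
    · simp [hg', hd, h]
  simp only [this]
  simp only [← Finset.mul_sum]
  rw [hg, mul_zero]

end ClosedTriangulatedSurface

/-! ### Cochains -/

section Cochain

variable {F : Set (Finset E)}

/-- The value of a `0`-cochain at a point. -/
def cval₀ (o : Numbering F) [Fintype (Cell F 0)] (c : Cell F 0 → ℝ) (x : E) : ℝ :=
  ∑ w, (if o.vert w 0 = x then 1 else 0) * c w

/-- The value of a `1`-cochain on the oriented segment `[x, y]`. -/
def cval₁ (o : Numbering F) [Fintype (Cell F 1)] (c : Cell F 1 → ℝ) (x y : E) : ℝ :=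
  ∑ w, ((if o.vert w 0 = x ∧ o.vert w 1 = y then 1 else 0) -
    (if o.vert w 0 = y ∧ o.vert w 1 = x then 1 else 0)) * c w

theorem sum_incidence_zero (o : Numbering F) [Fintype (Cell F 0)] (c : Cell F 0 → ℝ)
    (t : Cell F 1) : ∑ w, (incidence o w t : ℝ) * c w =
      cval₀ o c (o.vert t 1) - cval₀ o c (o.vert t 0) := by
  rw [cval₀, cval₀, ← Finset.sum_sub_distrib]
  refine Finset.sum_congr rfl fun w _ => ?_
  rw [incidence_zero]
  push_cast
  ring

theorem sum_incidence_one (o : Numbering F) [Fintype (Cell F 1)] (c : Cell F 1 → ℝ)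
    (t : Cell F 2) : ∑ w, (incidence o w t : ℝ) * c w =
      cval₁ o c (o.vert t 1) (o.vert t 2) - cval₁ o c (o.vert t 0) (o.vert t 2) +
        cval₁ o c (o.vert t 0) (o.vert t 1) := by
  rw [cval₁, cval₁, cval₁, ← Finset.sum_sub_distrib, ← Finset.sum_add_distrib]
  refine Finset.sum_congr rfl fun w _ => ?_
  rw [incidence_one]
  simp only [and_comm (a := o.vert w 1 = _)]
  push_cast
  ring

theorem cval₁_antisymm (o : Numbering F) [Fintype (Cell F 1)] (c : Cell F 1 → ℝ) (x y : E) :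
    cval₁ o c x y = -cval₁ o c y x := by
  rw [cval₁, cval₁, ← Finset.sum_neg_distrib]
  exact Finset.sum_congr rfl fun w _ => by ring

theorem Numbering.cell_zero_eq (o : Numbering F) (w : Cell F 0) : w.1 = {o.vert w 0} := by
  rw [← o.image_vert w]
  simp

theorem Numbering.cell_one_eq (o : Numbering F) (w : Cell F 1) :
    w.1 = {o.vert w 0, o.vert w 1} := by
  rw [← o.image_vert w]
  ext
  simp [Fin.exists_fin_two, eq_comm]

theorem Numbering.cell_two_eq (o : Numbering F) (w : Cell F 2) :
    w.1 = {o.vert w 0, o.vert w 1, o.vert w 2} := by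
  rw [← o.image_vert w]
  ext
  simp [Fin.exists_fin_succ, eq_comm]

theorem cval₀_vert (o : Numbering F) [Fintype (Cell F 0)] (c : Cell F 0 → ℝ) (w : Cell F 0) :
    cval₀ o c (o.vert w 0) = c w := by
  rw [cval₀, Finset.sum_eq_single w]
  · simp
  · intro w' _ h
    rw [if_neg, zero_mul]
    intro h'
    exact h (Subtype.ext (by rw [o.cell_zero_eq, h', ← o.cell_zero_eq]))
  · simp

theorem cval₁_vert (o : Numbering F) [Fintype (Cell F 1)] (c : Cell F 1 → ℝ) (w : Cell F 1) :
    cval₁ o c (o.vert w 0) (o.vert w 1) = c w := by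
  have h01 : o.vert w 0 ≠ o.vert w 1 := (o.vert_injective w).ne (by decide)
  rw [cval₁, Finset.sum_eq_single w]
  · simp [h01]
  · intro w' _ h
    rw [if_neg, if_neg]
    · simp
    · rintro ⟨h1, h2⟩
      exact h (Subtype.ext (by rw [o.cell_one_eq, h1, h2, Finset.pair_comm, ← o.cell_one_eq]))
    · rintro ⟨h1, h2⟩
      exact h (Subtype.ext (by rw [o.cell_one_eq, h1, h2, ← o.cell_one_eq]))
  · simp

theorem cval₀_singleton (o : Numbering F) [Fintype (Cell F 0)] (c : Cell F 0 → ℝ) {w : Cell F 0}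
    {x : E} (hw : w.1 = {x}) : cval₀ o c x = c w := by
  have : o.vert w 0 = x := by simpa [hw] using o.vert_mem w 0
  rw [← cval₀_vert o c w, this]

theorem vert_pair (o : Numbering F) {w : Cell F 1} {x y : E} (hw : w.1 = {x, y}) :
    (o.vert w 0 = x ∧ o.vert w 1 = y) ∨ (o.vert w 0 = y ∧ o.vert w 1 = x) := by
  have h01 : o.vert w 0 ≠ o.vert w 1 := (o.vert_injective w).ne (by decide)
  have h0 := o.vert_mem w 0
  have h1 := o.vert_mem w 1
  rw [hw] at h0 h1
  simp only [Finset.mem_insert, Finset.mem_singleton] at h0 h1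
  rcases h0 with h0 | h0 <;> rcases h1 with h1 | h1
  · exact absurd (h0.trans h1.symm) h01
  · exact Or.inl ⟨h0, h1⟩
  · exact Or.inr ⟨h0, h1⟩
  · exact absurd (h0.trans h1.symm) h01

/-- A cochain given by an antisymmetric function of the end points has the expected value on a
segment, whatever orientation the cell carries. -/
theorem cval₁_pair (o : Numbering F) [Fintype (Cell F 1)] {c : Cell F 1 → ℝ} {w : Cell F 1}
    {x y : E} (hw : w.1 = {x, y}) {A : E → E → ℝ} (hA : ∀ x y, A x y = -A y x)
    (hc : c w = A (o.vert w 0) (o.vert w 1)) : cval₁ o c x y = A x y := by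
  have := cval₁_vert o c w
  rcases vert_pair o hw with ⟨h0, h1⟩ | ⟨h0, h1⟩ <;> rw [h0, h1] at this hc
  · rw [this, hc]
  · rw [cval₁_antisymm, this, hc, hA, neg_neg]

/-- A function of three points that changes sign when two of them are interchanged. -/
def IsAlternating₃ (G : E → E → E → ℝ) : Prop :=
  (∀ x y z, G x y z = -G y x z) ∧ ∀ x y z, G x y z = -G x z y

/-- ε is the sign of the permutation relating the two orders. One and the same ε serves all
alternating functions, so that coboundaries and areas are reordered consistently. -/
theorem exists_sign_of_triple (o : Numbering F) {w : Cell F 2} {x y z : E} (hw : w.1 = {x, y, z}) :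
    ∃ ε : ℝ, ε * ε = 1 ∧ ∀ G : E → E → E → ℝ, IsAlternating₃ G →
      G (o.vert w 0) (o.vert w 1) (o.vert w 2) = ε * G x y z := by
  have h01 : o.vert w 0 ≠ o.vert w 1 := (o.vert_injective w).ne (by decide)
  have h02 : o.vert w 0 ≠ o.vert w 2 := (o.vert_injective w).ne (by decide)
  have h12 : o.vert w 1 ≠ o.vert w 2 := (o.vert_injective w).ne (by decide)
  have h0 := o.vert_mem w 0
  have h1 := o.vert_mem w 1
  have h2 := o.vert_mem w 2
  rw [hw] at h0 h1 h2
  simp only [Finset.mem_insert, Finset.mem_singleton] at h0 h1 h2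
  have key : ∀ G : E → E → E → ℝ, IsAlternating₃ G → G y x z = -G x y z ∧ G x z y = -G x y z ∧
      G z y x = -G x y z ∧ G y z x = G x y z ∧ G z x y = G x y z := by
    intro G hG
    have := hG.1 x y z
    have := hG.1 x z y
    have := hG.1 y z x
    have := hG.2 x y z
    have := hG.2 y x z
    have := hG.2 z x y
    refine ⟨?_, ?_, ?_, ?_, ?_⟩ <;> linarith
  rcases h0 with h0 | h0 | h0 <;> rcases h1 with h1 | h1 | h1 <;>
    rcases h2 with h2 | h2 | h2 <;> rw [h0, h1] at h01 <;> rw [h0, h2] at h02 <;>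
    rw [h1, h2] at h12 <;> first
    | exact absurd rfl h01
    | exact absurd rfl h02
    | exact absurd rfl h12
    | exact ⟨1, by norm_num, fun G hG => by
        obtain ⟨k1, k2, k3, k4, k5⟩ := key G hG
        rw [h0, h1, h2]; linarith⟩
    | exact ⟨-1, by norm_num, fun G hG => by
        obtain ⟨k1, k2, k3, k4, k5⟩ := key G hG
        rw [h0, h1, h2]; linarith⟩

theorem isAlternating₃_coboundary (o : Numbering F) [Fintype (Cell F 1)] (c : Cell F 1 → ℝ) :
    IsAlternating₃ fun x y z => cval₁ o c y z - cval₁ o c x z + cval₁ o c x y := by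
  refine ⟨fun x y z => ?_, fun x y z => ?_⟩
  · simp only; rw [cval₁_antisymm o c x y]; ring
  · simp only; rw [cval₁_antisymm o c y z]; ring

end Cochain

namespace ClosedTriangulatedSurface

variable {T : ClosedTriangulatedSurface E} {o : Numbering T.faces} (σ : SurfaceOrientation T o)

/-! ### Positive frames -/

/-- The area form of a facet, with the orientation given by the numbering of its vertices. -/
def areaForm (o : Numbering T.faces) (f : Cell T.faces 2) (u v : E) : ℝ :=
  (coord f.1 (o.vert f 1)).linear u * (coord f.1 (o.vert f 2)).linear v -
    (coord f.1 (o.vert f 2)).linear u * (coord f.1 (o.vert f 1)).linear v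

theorem coord_linear_sub (s : Finset E) (p x y : E) :
    (coord s p).linear (x - y) = coord s p x - coord s p y := by
  simpa using (coord s p).linearMap_vsub x y

theorem eq_sum_frame (o : Numbering T.faces) (f : Cell T.faces 2) {v : E} (hv : v ∈ Tangent f.1) :
    v = (coord f.1 (o.vert f 1)).linear v • (o.vert f 1 - o.vert f 0) +
      (coord f.1 (o.vert f 2)).linear v • (o.vert f 2 - o.vert f 0) := by
  have hf := T.indep f.2.1
  have h01 : o.vert f 0 ≠ o.vert f 1 := (o.vert_injective f).ne (by decide)
  have h02 : o.vert f 0 ≠ o.vert f 2 := (o.vert_injective f).ne (by decide)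
  have h12 : o.vert f 1 ≠ o.vert f 2 := (o.vert_injective f).ne (by decide)
  have hpt : ∀ x ∈ f.1, x - o.vert f 0 = coord f.1 (o.vert f 1) x • (o.vert f 1 - o.vert f 0) +
      coord f.1 (o.vert f 2) x • (o.vert f 2 - o.vert f 0) := by
    intro x hx
    rw [coord_apply hf _ hx, coord_apply hf _ hx]
    rw [o.cell_two_eq f] at hx
    simp only [Finset.mem_insert, Finset.mem_singleton] at hx
    rcases hx with rfl | rfl | rfl <;> simp [h01, h02, h12, h12.symm]
  induction hv using Submodule.span_induction with
  | mem x hx =>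
    obtain ⟨a, ha, b, hb, rfl⟩ := hx
    simp only [Finset.mem_coe] at ha hb
    have h1 := hpt a ha
    have h2 := hpt b hb
    simp only [vsub_eq_sub]
    rw [coord_linear_sub, coord_linear_sub, ← sub_sub_sub_cancel_right a b (o.vert f 0), h1, h2]
    module
  | zero => simp
  | add x y _ _ hx hy =>
    conv_lhs => rw [hx, hy]
    simp only [map_add]
    module
  | smul c x _ hx =>
    conv_lhs => rw [hx]
    simp only [map_smul, smul_eq_mul]
    module

/-- The matrix of a tangent frame in the edge vectors of the facet consists of the coordinate
differentials, so its determinant is the area form. -/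
theorem isPositiveFrame_iff (f : Cell T.faces 2) {v : Fin 2 → E} (hv : ∀ i, v i ∈ Tangent f.1) :
    IsPositiveFrame σ f v ↔ 0 < σ.sgn f * areaForm o f (v 0) (v 1) := by
  have hf := T.indep f.2.1
  have h01 : o.vert f 0 ≠ o.vert f 1 := (o.vert_injective f).ne (by decide)
  have h02 : o.vert f 0 ≠ o.vert f 2 := (o.vert_injective f).ne (by decide)
  have h12 : o.vert f 1 ≠ o.vert f 2 := (o.vert_injective f).ne (by decide)
  have hfr0 : frame (o.vert f) 0 = o.vert f 1 - o.vert f 0 := rfl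
  have hfr1 : frame (o.vert f) 1 = o.vert f 2 - o.vert f 0 := rfl
  constructor
  · rintro ⟨A, hA, hpos⟩
    have key : ∀ i, (coord f.1 (o.vert f 1)).linear (v i) = A i 0 ∧
        (coord f.1 (o.vert f 2)).linear (v i) = A i 1 := by
      intro i
      rw [hA i, Fin.sum_univ_two, hfr0, hfr1]
      simp only [map_add, map_smul, coord_linear_sub]
      simp [coord_apply hf _ (o.vert_mem f _), h01, h02, h12, h12.symm]
    rw [Matrix.det_fin_two] at hpos
    rw [areaForm, (key 0).1, (key 0).2, (key 1).1, (key 1).2]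
    exact hpos
  · intro h
    refine ⟨Matrix.of fun i => ![(coord f.1 (o.vert f 1)).linear (v i),
      (coord f.1 (o.vert f 2)).linear (v i)], fun i => ?_, ?_⟩
    · rw [Fin.sum_univ_two, hfr0, hfr1]
      exact eq_sum_frame o f (hv i)
    · rw [Matrix.det_fin_two]
      exact h

/-- On the tangent plane the three coordinate differentials add up to zero, so any two of them give
the same area form up to the sign by which the edge sits in the facet. -/
theorem areaForm_eq (f : Cell T.faces 2) {e : Cell T.faces 1} (hef : e.1 ⊆ f.1) {u v : E}
    (hu : u ∈ Tangent f.1) (hv : v ∈ Tangent f.1) : areaForm o f u v = incidence o e f *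
      ((coord f.1 (o.vert e 0)).linear u * (coord f.1 (o.vert e 1)).linear v -
        (coord f.1 (o.vert e 1)).linear u * (coord f.1 (o.vert e 0)).linear v) := by
  have hf := T.indep f.2.1
  have e1 := sum_coord_linear hf hu
  have e2 := sum_coord_linear hf hv
  rw [exists_eq_triple o f (fun p => (coord f.1 p).linear u)] at e1
  rw [exists_eq_triple o f (fun p => (coord f.1 p).linear v)] at e2
  have E1 : (coord f.1 (o.vert f 0)).linear u =
      -(coord f.1 (o.vert f 1)).linear u - (coord f.1 (o.vert f 2)).linear u := by linarith
  have E2 : (coord f.1 (o.vert f 0)).linear v =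
      -(coord f.1 (o.vert f 1)).linear v - (coord f.1 (o.vert f 2)).linear v := by linarith
  obtain ⟨i, hi⟩ := o.exists_vert f (hef (o.vert_mem e 0))
  obtain ⟨j, hj⟩ := o.exists_vert f (hef (o.vert_mem e 1))
  have hij : i ≠ j := by
    rintro rfl
    exact absurd (o.vert_injective e (hi.symm.trans hj)) (by decide)
  rw [incidence_one, ← hi, ← hj, areaForm]
  simp only [(o.vert_injective f).eq_iff]
  clear hi hj
  fin_cases i <;> fin_cases j <;> simp [E1, E2] at hij ⊢ <;> ring

theorem sub_mem_tangent_of_mem_affineSpan {s : Finset E} {x y : E}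
    (hx : x ∈ affineSpan ℝ (s : Set E)) (hy : y ∈ affineSpan ℝ (s : Set E)) :
    x - y ∈ Tangent s := by
  simpa using vsub_mem_vectorSpan_of_mem_affineSpan_of_mem_affineSpan hx hy

theorem barycenter_mem_affineSpan_of_subset {s t : Finset E} (hs : s.Nonempty) (hst : s ⊆ t) :
    barycenter s ∈ affineSpan ℝ (t : Set E) :=
  affineSpan_mono ℝ (by exact_mod_cast hst) (barycenter_mem_affineSpan hs)

/-- The six triangles of a facet have equal area, hence the factor 1/6. The sign, multiplied by that
of the facet, is the flag sign. -/
theorem areaForm_flag {a : Cell T.faces 0} {e : Cell T.faces 1} {f : Cell T.faces 2}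
    (h : IsFlag a e f) : areaForm o f (barycenter e.1 - barycenter a.1)
      (barycenter f.1 - barycenter a.1) = -(incidence o e f * incidence o a e) / 6 := by
  have hf := T.indep f.2.1
  have haf := h.1.trans h.2
  have hb1 := barycenter_mem_affineSpan_of_subset a.nonempty haf
  have hb2 := barycenter_mem_affineSpan_of_subset e.nonempty h.2
  have hb3 := barycenter_mem_affineSpan f.nonempty
  have h01 : o.vert e 0 ≠ o.vert e 1 := (o.vert_injective e).ne (by decide)
  rw [areaForm_eq f h.2 (sub_mem_tangent_of_mem_affineSpan hb2 hb1)
    (sub_mem_tangent_of_mem_affineSpan hb3 hb1)]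
  simp only [coord_linear_sub]
  simp only [coord_barycenter hf _ haf a.nonempty, coord_barycenter hf _ h.2 e.nonempty,
    coord_barycenter hf _ subset_rfl f.nonempty, if_pos (o.vert_mem e _),
    if_pos (h.2 (o.vert_mem e _)), a.2.2, e.2.2, f.2.2]
  obtain ⟨i, hi⟩ := o.exists_vert e (h.1 (o.vert_mem a 0))
  have ha := o.cell_zero_eq a
  rw [incidence_zero, ha, ← hi]
  fin_cases i <;> simp [h01, h01.symm] <;> ring

theorem areaForm_dual_edge {e : Cell T.faces 1} {f : Cell T.faces 2}
    (h : e.1 ⊆ f.1) : areaForm o f (barycenter f.1 - barycenter e.1)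
      (o.vert e 1 - o.vert e 0) = -(incidence o e f : ℝ) / 3 := by
  have hf := T.indep f.2.1
  have h01 : o.vert e 0 ≠ o.vert e 1 := (o.vert_injective e).ne (by decide)
  rw [areaForm_eq f h (sub_mem_tangent_of_mem_affineSpan
    (barycenter_mem_affineSpan f.nonempty) (barycenter_mem_affineSpan_of_subset e.nonempty h))
    (sub_mem_tangent (h (o.vert_mem e _)) (h (o.vert_mem e _)))]
  simp only [coord_linear_sub]
  simp only [coord_barycenter hf _ h e.nonempty,
    coord_barycenter hf _ subset_rfl f.nonempty, if_pos (o.vert_mem e _),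
    if_pos (h (o.vert_mem e _)), e.2.2, f.2.2, coord_apply hf _ (h (o.vert_mem e _))]
  simp [h01, h01.symm]
  ring

theorem areaForm_frame (f : Cell T.faces 2) : areaForm o f (o.vert f 1 - o.vert f 0)
      (o.vert f 2 - o.vert f 0) = 1 := by
  have hf := T.indep f.2.1
  have h01 : o.vert f 0 ≠ o.vert f 1 := (o.vert_injective f).ne (by decide)
  have h02 : o.vert f 0 ≠ o.vert f 2 := (o.vert_injective f).ne (by decide)
  have h12 : o.vert f 1 ≠ o.vert f 2 := (o.vert_injective f).ne (by decide)
  simp only [areaForm, coord_linear_sub, coord_apply hf _ (o.vert_mem f _)]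
  simp [h01, h02, h12, h12.symm]

theorem isAlternating₃_areaForm (f : Cell T.faces 2) :
    IsAlternating₃ fun x y z => areaForm o f (y - x) (z - x) := by
  constructor <;>
  · intro x y z
    simp only [areaForm, map_sub]
    ring

/-! ### The coefficients of the dual chains -/

theorem IsLowest.inDual_iff {s w t : Finset E} (hw : w ∈ sdFaces T.faces) (hs : IsLowest T s w) :
    InDual T t w ↔ t ⊆ s := by
  constructor
  · rintro ⟨-, h⟩
    obtain ⟨s', hs', hts', hss'⟩ := h _ hs.2.1
    rwa [barycenter_inj hs.1 hs' hss']
  · intro hts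
    refine ⟨hw, fun x hx => ?_⟩
    obtain ⟨C, -, hCF, -, rfl⟩ := mem_sdFaces_iff.1 hw
    obtain ⟨s', hs', rfl⟩ := Finset.mem_image.1 hx
    exact ⟨s', hCF s' hs', hts.trans (hs.2.2 s' (hCF s' hs') hx), rfl⟩

variable (o' : Numbering (sdFaces T.faces))

theorem chainCoeff_eq_zero {q r : ℕ} (h : q + r = 2) {t : Cell T.faces r}
    {w : Cell (sdFaces T.faces) q} (hw : ¬ InDual T t.1 w.1) : chainCoeff o' σ h t w = 0 := by
  rw [chainCoeff, if_neg hw]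

theorem chainCoeff_ne_zero {q r : ℕ} (h : q + r = 2) {t : Cell T.faces r}
    {w : Cell (sdFaces T.faces) q} (hw : InDual T t.1 w.1) :
    chainCoeff o' σ h t w = 1 ∨ chainCoeff o' σ h t w = -1 := by
  rw [chainCoeff, if_pos hw]
  split_ifs <;> simp

theorem dualSize_eq {q r : ℕ} (h : q + r = 2) (t : Cell T.faces r) :
    (dualSize o' σ h t : ℝ) =
      ∑ w : Cell (sdFaces T.faces) q, if InDual T t.1 w.1 then 1 else 0 := by
  rw [dualSize]
  push_cast
  refine Finset.sum_congr rfl fun w _ => ?_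
  split_ifs with hw
  · rcases chainCoeff_ne_zero σ o' h hw with h | h <;> rw [h] <;> simp
  · rw [chainCoeff_eq_zero σ o' h hw]; simp

/-- The facet g in the definition of the coefficient is forced to be f, since w contains the
barycenter of f. Only the sign of the area form remains, so any positive factor c may be split off.
-/
theorem chainCoeff_eq_of_sign {q r : ℕ} (h : q + r = 2) {t : Cell T.faces r}
    {w : Cell (sdFaces T.faces) q} (hw : InDual T t.1 w.1) {f : Cell T.faces 2}
    (hfw : barycenter f.1 ∈ w.1) (hwf : convexHull ℝ (w.1 : Set E) ⊆ convexHull ℝ (f.1 : Set E))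
    {v : Fin 2 → E} (hv : Fin.append (frame (o'.vert w)) (frame (o.vert t)) ∘ Fin.cast h.symm = v)
    (hvf : ∀ i, v i ∈ Tangent f.1) {η c : ℝ} (hη : η * η = 1) (hc : 0 < c)
    (hsign : σ.sgn f * areaForm o f (v 0) (v 1) = c * η) :
    (chainCoeff o' σ h t w : ℝ) = η := by
  have hiff : (∃ g : Cell T.faces 2, convexHull ℝ (w.1 : Set E) ⊆ convexHull ℝ (g.1 : Set E) ∧
        IsPositiveFrame σ g
          (Fin.append (frame (o'.vert w)) (frame (o.vert t)) ∘ Fin.cast h.symm)) ↔ 0 < η := by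
    rw [hv]
    constructor
    · rintro ⟨g, hg, hpos⟩
      have hfg := subset_of_barycenter_mem f.2.1 g.2.1 (hg (subset_convexHull ℝ _ hfw))
      obtain rfl : f = g :=
        Subtype.ext (Finset.eq_of_subset_of_card_le hfg (by rw [f.2.2, g.2.2]))
      rw [isPositiveFrame_iff σ f hvf, hsign] at hpos
      exact pos_of_mul_pos_right hpos hc.le
    · intro hpos
      refine ⟨f, hwf, (isPositiveFrame_iff σ f hvf).2 ?_⟩
      rw [hsign]
      positivity
  rw [chainCoeff, if_pos hw]
  rcases mul_self_eq_one_iff.1 hη with rfl | rfl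
  · rw [if_pos (hiff.2 one_pos)]
    simp
  · rw [if_neg (fun h => by have := hiff.1 h; norm_num at this)]
    simp

/-- The chain coefficient and every alternating function pick up the same ε from the arbitrary
numbering of w, so ε cancels when they are compared. -/
theorem IsFlag.exists_sign {a : Cell T.faces 0} {e : Cell T.faces 1} {f : Cell T.faces 2}
    (h : IsFlag a e f) {w : Cell (sdFaces T.faces) 2} (hw : w.1 = tri a e f) (h2 : 2 + 0 = 2) :
    ∃ ε : ℝ, ε * ε = 1 ∧
      (∀ G : E → E → E → ℝ, IsAlternating₃ G → G (o'.vert w 0) (o'.vert w 1) (o'.vert w 2) =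
          ε * G (barycenter a.1) (barycenter e.1) (barycenter f.1)) ∧
      (chainCoeff o' σ h2 a w : ℝ) = ε * flagSign σ a e f := by
  obtain ⟨ε, hε, hG⟩ := exists_sign_of_triple o' hw
  refine ⟨ε, hε, hG, ?_⟩
  have hwf : convexHull ℝ (w.1 : Set E) ⊆ convexHull ℝ (f.1 : Set E) := by
    rw [hw]; exact h.convexHull_subset
  have hlow : IsLowest T a.1 w.1 := by rw [hw]; exact h.isLowest
  have hspan : ∀ i, o'.vert w i ∈ affineSpan ℝ (f.1 : Set E) := fun i =>
    convexHull_subset_affineSpan _ (hwf (subset_convexHull ℝ _ (o'.vert_mem w i)))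
  have hfs := flagSign_sq σ h
  refine chainCoeff_eq_of_sign σ o' h2 (f := f)
    (v := ![o'.vert w 1 - o'.vert w 0, o'.vert w 2 - o'.vert w 0])
    ((hlow.inDual_iff w.2.1).2 subset_rfl) (by simp [hw, tri])
    hwf ?_ ?_ (c := 1 / 6) (η := ε * flagSign σ a e f) ?_ (by norm_num) ?_
  · funext i
    fin_cases i <;> rfl
  · intro i
    fin_cases i <;> exact sub_mem_tangent_of_mem_affineSpan (hspan _) (hspan _)
  · linear_combination hfs * ε * ε + hε
  · have := hG _ (isAlternating₃_areaForm (o := o) f)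
    simp only [Matrix.cons_val_zero, Matrix.cons_val_one]
    rw [this, areaForm_flag h, flagSign]
    ring

/-! ### Edges and vertices of the refinement and their chain coefficients -/

theorem card_pair_barycenter {s s' : Finset E} (hs : s ∈ T.faces) (hs' : s' ∈ T.faces)
    (h : s ⊂ s') : ({barycenter s, barycenter s'} : Finset E).card = 1 + 1 :=
  Finset.card_pair fun hb => h.ne (barycenter_inj hs hs' hb)

theorem pair_mem_sdFaces {s s' : Finset E} (hs : s ∈ T.faces) (hs' : s' ∈ T.faces)
    (h : s ⊂ s') : ({barycenter s, barycenter s'} : Finset E) ∈ sdFaces T.faces := by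
  refine mem_sdFaces_iff.2 ⟨{s, s'}, by simp, by simp [hs, hs'], ?_, by simp⟩
  rw [Finset.coe_pair]
  exact IsChain.pair h.subset

/-- The edge of the refinement that joins the barycenters of two simplices. -/
def edgeCell {s s' : Finset E} (hs : s ∈ T.faces) (hs' : s' ∈ T.faces) (h : s ⊂ s') :
    Cell (sdFaces T.faces) 1 :=
  ⟨{barycenter s, barycenter s'}, pair_mem_sdFaces hs hs' h, card_pair_barycenter hs hs' h⟩

theorem isLowest_edgeCell {s s' : Finset E} (hs : s ∈ T.faces) (hs' : s' ∈ T.faces) (h : s ⊂ s') :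
    IsLowest T s (edgeCell hs hs' h).1 := by
  refine ⟨hs, by simp [edgeCell], fun r hr hrw => ?_⟩
  simp only [edgeCell, Finset.mem_insert, Finset.mem_singleton] at hrw
  rcases hrw with hb | hb
  · rw [barycenter_inj hr hs hb]
  · rw [barycenter_inj hr hs' hb]
    exact h.subset

theorem exists_edgeCell (w : Cell (sdFaces T.faces) 1) : ∃ (s s' : Finset E) (hs : s ∈ T.faces)
    (hs' : s' ∈ T.faces) (h : s ⊂ s'), w = edgeCell hs hs' h := by
  obtain ⟨C, -, hCF, hC, hw⟩ := mem_sdFaces_iff.1 w.2.1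
  have hcard : C.card = 2 := by
    rw [← show w.1.card = 2 from w.2.2, hw]
    exact (Finset.card_image_of_injOn fun s hs t ht h =>
      barycenter_inj (hCF s hs) (hCF t ht) h).symm
  obtain ⟨s, s', hss', rfl⟩ := Finset.card_eq_two.1 hcard
  have hs := hCF s (by simp)
  have hs' := hCF s' (by simp)
  rw [Finset.image_insert, Finset.image_singleton] at hw
  rcases hC.total (x := s) (y := s') (by simp) (by simp) with h | h
  · exact ⟨s, s', hs, hs', h.ssubset_of_ne hss', Subtype.ext hw⟩
  · exact ⟨s', s, hs', hs, h.ssubset_of_ne hss'.symm, Subtype.ext (by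
      rw [hw, Finset.pair_comm]; rfl)⟩

theorem cell_ssubset {k l : ℕ} (hkl : k ≠ l) {s : Cell T.faces k} {t : Cell T.faces l}
    (h : s.1 ⊆ t.1) : s.1 ⊂ t.1 := h.ssubset_of_ne (cell_ne hkl s t)

/-- The sign of the orientation of an edge with respect to the one that starts at `x`. -/
def startSign (w : Cell (sdFaces T.faces) 1) (x : E) : ℝ := if o'.vert w 0 = x then 1 else -1

theorem startSign_sq (w : Cell (sdFaces T.faces) 1) (x : E) :
    startSign o' w x * startSign o' w x = 1 := by
  unfold startSign
  split_ifs <;> norm_num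

theorem chainCoeff_edge {e : Cell T.faces 1} {f : Cell T.faces 2} (h : e.1 ⊆ f.1)
    (h2 : 1 + 1 = 2) : (chainCoeff o' σ h2 e
      (edgeCell e.2.1 f.2.1 (cell_ssubset (by decide) h)) : ℝ) =
    startSign o' (edgeCell e.2.1 f.2.1 (cell_ssubset (by decide) h)) (barycenter e.1) *
      -(σ.sgn f * incidence o e f) := by
  unfold startSign
  set w := edgeCell e.2.1 f.2.1 (cell_ssubset (by decide) h) with hw
  have hne : barycenter f.1 ≠ barycenter e.1 := barycenter_cell_ne (by decide) f e
  have hlow : IsLowest T e.1 w.1 := isLowest_edgeCell _ _ _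
  have hs1 := sgn_sq σ f
  have hs2 := incidence_one_sq o h
  have hwf : convexHull ℝ (w.1 : Set E) ⊆ convexHull ℝ (f.1 : Set E) := by
    refine convexHull_min ?_ (convex_convexHull ℝ _)
    intro x hx
    simp only [hw, edgeCell, Finset.coe_insert, Finset.coe_singleton, Set.mem_insert_iff,
      Set.mem_singleton_iff] at hx
    rcases hx with rfl | rfl
    · exact convexHull_mono (by exact_mod_cast h) (barycenter_mem_convexHull e.nonempty)
    · exact barycenter_mem_convexHull f.nonempty
  have hspan : ∀ i, o'.vert w i ∈ affineSpan ℝ (f.1 : Set E) := fun i =>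
    convexHull_subset_affineSpan _ (hwf (subset_convexHull ℝ _ (o'.vert_mem w i)))
  refine chainCoeff_eq_of_sign σ o' h2 (f := f)
    (v := ![o'.vert w 1 - o'.vert w 0, o.vert e 1 - o.vert e 0])
    ((hlow.inDual_iff w.2.1).2 subset_rfl) (by simp [hw, edgeCell]) hwf ?_ ?_
    (c := 1 / 3) ?_ (by norm_num) ?_
  · funext i
    fin_cases i <;> rfl
  · intro i
    fin_cases i
    · exact sub_mem_tangent_of_mem_affineSpan (hspan _) (hspan _)
    · exact sub_mem_tangent (h (o.vert_mem e _)) (h (o.vert_mem e _))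
  · split_ifs <;> linear_combination hs2 * (σ.sgn f * σ.sgn f) + hs1
  · simp only [Matrix.cons_val_zero, Matrix.cons_val_one]
    have key := areaForm_dual_edge (o := o) h
    rcases vert_pair o' (w := w) (x := barycenter e.1) (y := barycenter f.1) rfl with
      ⟨h0, h1⟩ | ⟨h0, h1⟩
    · rw [h0, h1, if_pos rfl, key]
      ring
    · rw [h0, h1, if_neg hne]
      have : areaForm o f (barycenter e.1 - barycenter f.1) (o.vert e 1 - o.vert e 0) =
          -areaForm o f (barycenter f.1 - barycenter e.1) (o.vert e 1 - o.vert e 0) := by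
        simp only [areaForm, map_sub]
        ring
      rw [this, key]
      ring

/-- The vertex of the refinement at the barycenter of a simplex. -/
def vertexCell {s : Finset E} (hs : s ∈ T.faces) : Cell (sdFaces T.faces) 0 :=
  ⟨{barycenter s}, mem_sdFaces_iff.2 ⟨{s}, by simp, by simp [hs], by simp, by simp⟩, by simp⟩

theorem isLowest_vertexCell {s : Finset E} (hs : s ∈ T.faces) :
    IsLowest T s (vertexCell hs).1 := by
  refine ⟨hs, by simp [vertexCell], fun r hr hrw => ?_⟩
  simp only [vertexCell, Finset.mem_singleton] at hrw
  rw [barycenter_inj hr hs hrw]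

theorem exists_vertexCell (w : Cell (sdFaces T.faces) 0) : ∃ (s : Finset E) (hs : s ∈ T.faces),
    w = vertexCell hs := by
  obtain ⟨s, hs⟩ := exists_isLowest w.2.1
  obtain ⟨x, hx⟩ := Finset.card_eq_one.1 w.2.2
  refine ⟨s, hs.1, Subtype.ext ?_⟩
  have := hs.2.1
  rw [hx, Finset.mem_singleton] at this
  exact hx.trans (congrArg (fun y => ({y} : Finset E)) this.symm)

theorem chainCoeff_vertex (f : Cell T.faces 2) (h2 : 0 + 2 = 2) :
    (chainCoeff o' σ h2 f (vertexCell f.2.1) : ℝ) = σ.sgn f := by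
  refine chainCoeff_eq_of_sign σ o' h2 (f := f)
    (v := ![o.vert f 1 - o.vert f 0, o.vert f 2 - o.vert f 0])
    (((isLowest_vertexCell f.2.1).inDual_iff (vertexCell f.2.1).2.1).2 subset_rfl)
    (by simp [vertexCell]) ?_ ?_ ?_ (c := 1) (sgn_sq σ f) one_pos ?_
  · refine convexHull_min ?_ (convex_convexHull ℝ _)
    simpa [vertexCell] using barycenter_mem_convexHull f.nonempty
  · funext i
    fin_cases i <;> rfl
  · intro i
    fin_cases i <;> exact sub_mem_tangent (o.vert_mem f _) (o.vert_mem f _)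
  · simp only [Matrix.cons_val_zero, Matrix.cons_val_one]
    rw [areaForm_frame]
    ring

end ClosedTriangulatedSurface

namespace ClosedTriangulatedSurface

variable {T : ClosedTriangulatedSurface E} {o : Numbering T.faces} (σ : SurfaceOrientation T o)
  (o' : Numbering (sdFaces T.faces))

/-! ### The number of cells in a dual cell -/

theorem eq_vertexCell_of_inDual {f : Cell T.faces 2} {w : Cell (sdFaces T.faces) 0}
    (hd : InDual T f.1 w.1) : w = vertexCell f.2.1 := by
  obtain ⟨s, hs, rfl⟩ := exists_vertexCell w
  rw [(isLowest_vertexCell hs).inDual_iff (vertexCell hs).2.1] at hd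
  obtain ⟨g, hg, hsg, hgc⟩ := T.pure_two s hs
  have hfg : f.1 = g := Finset.eq_of_subset_of_card_le (hd.trans hsg) (by rw [hgc, f.2.2])
  have : s = f.1 := (hsg.trans hfg.ge).antisymm hd
  subst this
  rfl

theorem eq_edgeCell_of_inDual {e : Cell T.faces 1} {w : Cell (sdFaces T.faces) 1}
    (hd : InDual T e.1 w.1) : ∃ (f : Cell T.faces 2) (h : e.1 ⊆ f.1),
      w = edgeCell e.2.1 f.2.1 (cell_ssubset (by decide) h) := by
  obtain ⟨s, s', hs, hs', hss', rfl⟩ := exists_edgeCell w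
  rw [(isLowest_edgeCell hs hs' hss').inDual_iff (edgeCell hs hs' hss').2.1] at hd
  obtain ⟨g, hg, hsg, hgc⟩ := T.pure_two s' hs'
  have c1 := Finset.card_le_card hsg
  have c2 := Finset.card_lt_card hss'
  have c3 := Finset.card_le_card hd
  rw [e.2.2] at c3
  obtain rfl : e.1 = s := Finset.eq_of_subset_of_card_le hd (by rw [e.2.2]; omega)
  exact ⟨⟨s', hs', by omega⟩, hss'.subset, rfl⟩

theorem inDual_vertexCell (f : Cell T.faces 2) : InDual T f.1 (vertexCell f.2.1).1 :=
  ((isLowest_vertexCell f.2.1).inDual_iff (vertexCell f.2.1).2.1).2 subset_rfl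

theorem inDual_edgeCell (e : Cell T.faces 1) {s : Finset E} (hs : s ∈ T.faces) (h : e.1 ⊂ s) :
    InDual T e.1 (edgeCell e.2.1 hs h).1 :=
  ((isLowest_edgeCell e.2.1 hs h).inDual_iff (edgeCell e.2.1 hs h).2.1).2 subset_rfl

theorem dualSize_facet (f : Cell T.faces 2) (h : 0 + 2 = 2) : (dualSize o' σ h f : ℝ) = 1 := by
  rw [dualSize_eq, Finset.sum_eq_single (vertexCell f.2.1)]
  · rw [if_pos (inDual_vertexCell f)]
  · intro w _ hw
    exact if_neg fun hd => hw (eq_vertexCell_of_inDual hd)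
  · simp

theorem dualSize_edge (e : Cell T.faces 1) (h : 1 + 1 = 2) : (dualSize o' σ h e : ℝ) = 2 := by
  obtain ⟨f₁, f₂, hne, hiff⟩ := exists_two_facets e
  have h1 := (hiff f₁).2 (Or.inl rfl)
  have h2 := (hiff f₂).2 (Or.inr rfl)
  have key : ∀ w : Cell (sdFaces T.faces) 1, InDual T e.1 w.1 ↔
      w = edgeCell e.2.1 f₁.2.1 (cell_ssubset (by decide) h1) ∨
      w = edgeCell e.2.1 f₂.2.1 (cell_ssubset (by decide) h2) := by
    intro w
    constructor
    · intro hd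
      obtain ⟨f, hf, rfl⟩ := eq_edgeCell_of_inDual hd
      rcases (hiff f).1 hf with rfl | rfl
      · exact Or.inl rfl
      · exact Or.inr rfl
    · rintro (rfl | rfl)
      · exact inDual_edgeCell e f₁.2.1 _
      · exact inDual_edgeCell e f₂.2.1 _
  rw [dualSize_eq, sum_eq_of_pair ?_ key (fun k hk => if_neg hk), if_pos ((key _).2 (Or.inl rfl)),
    if_pos ((key _).2 (Or.inr rfl))]
  · norm_num
  · intro h
    have h' : ({barycenter e.1, barycenter f₁.1} : Finset E) = {barycenter e.1, barycenter f₂.1} :=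
      congrArg Subtype.val h
    have : barycenter f₁.1 ∈ ({barycenter e.1, barycenter f₂.1} : Finset E) := by
      rw [← h']; simp
    simp only [Finset.mem_insert, Finset.mem_singleton] at this
    rcases this with h | h
    · exact barycenter_cell_ne (by decide) f₁ e h
    · exact hne (barycenter_cell_inj h)

theorem inDual_tri_iff {a a' : Cell T.faces 0} {e : Cell T.faces 1} {f : Cell T.faces 2}
    (h : IsFlag a e f) : InDual T a'.1 (tri a e f) ↔ a' = a := by
  rw [h.isLowest.inDual_iff h.tri_mem]
  constructor
  · intro hs
    exact Subtype.ext (Finset.eq_of_subset_of_card_le hs (by rw [a.2.2, a'.2.2]))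
  · rintro rfl
    exact subset_rfl

/-- The number of flags at the node is written as a sum of squared signs, the form in which it
appears in the solvability condition of `exists_edgeSystem`. -/
theorem dualSize_node (a : Cell T.faces 0) (h : 2 + 0 = 2) : (dualSize o' σ h a : ℝ) =
    ∑ e : Cell T.faces 1, ∑ f : Cell T.faces 2, flagSign σ a e f * flagSign σ a e f := by
  have h1 : ∀ e f, flagSign σ a e f * flagSign σ a e f = if IsFlag a e f then (1 : ℝ) else 0 := by
    intro e f
    split_ifs with hfl
    · exact flagSign_sq σ hfl
    · rw [flagSign_of_not σ hfl, zero_mul]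
  rw [dualSize_eq]
  simp only [h1]
  rw [← Fintype.sum_prod_type (f := fun p : Cell T.faces 1 × Cell T.faces 2 =>
    if IsFlag a p.1 p.2 then (1 : ℝ) else 0), Finset.sum_boole, Finset.sum_boole]
  congr 1
  symm
  refine Finset.card_bij (fun p hp => IsFlag.cell (Finset.mem_filter.1 hp).2) ?_ ?_ ?_
  · intro p hp
    have hfl := (Finset.mem_filter.1 hp).2
    rw [Finset.mem_filter]
    exact ⟨Finset.mem_univ _, (inDual_tri_iff hfl).2 rfl⟩
  · intro p hp p' hp' hpp
    have : tri a p.1 p.2 = tri a p'.1 p'.2 := congrArg Subtype.val hpp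
    have := eq_of_tri_subset this.le
    exact Prod.ext this.2.1 this.2.2
  · intro w hw
    have hd := (Finset.mem_filter.1 hw).2
    obtain ⟨a', e, f, hfl, rfl⟩ := exists_flag_cell w
    obtain rfl : a = a' := (inDual_tri_iff hfl).1 hd
    exact ⟨(e, f), by simp [hfl], rfl⟩

theorem exists_flag_at (a : Cell T.faces 0) : ∃ e f, IsFlag a e f := by
  obtain ⟨f, hf, haf, hfc⟩ := T.pure_two a.1 a.2.1
  obtain ⟨e, _, _, h⟩ := exists_two_edges (a := a) (f := ⟨f, hf, hfc⟩) haf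
  exact ⟨e, _, (h e).2 (Or.inl rfl)⟩

theorem dualSize_node_pos (a : Cell T.faces 0) (h : 2 + 0 = 2) :
    (0 : ℝ) < dualSize o' σ h a := by
  obtain ⟨e, f, hfl⟩ := exists_flag_at a
  rw [dualSize_node]
  refine Finset.sum_pos' (fun e _ => Finset.sum_nonneg fun f _ => mul_self_nonneg _)
    ⟨e, Finset.mem_univ _, Finset.sum_pos' (fun f _ => mul_self_nonneg _)
      ⟨f, Finset.mem_univ _, ?_⟩⟩
  rw [flagSign_sq σ hfl]
  exact one_pos

/-! ### The combinatorial system for the coefficients -/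

/-- The conditions on the values `X e s s'` of the coefficients of `μ_{⋆e}` on the oriented edges of
the refinement from the barycenter of `s` to that of `s'`. -/
structure EdgeSystem (n : Cell T.faces 0 → ℝ) (X : Cell T.faces 1 → Finset E → Finset E → ℝ) :
    Prop where
  dual : ∀ (e e' : Cell T.faces 1) (f : Cell T.faces 2), e'.1 ⊆ f.1 →
    X e e'.1 f.1 = if e' = e then -(σ.sgn f * incidence o e f) / 2 else 0
  outside : ∀ (e : Cell T.faces 1) (a : Cell T.faces 0) (s : Finset E), s ∈ T.faces → a.1 ⊂ s →
    ¬ a.1 ⊆ e.1 → X e a.1 s = 0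
  stable : ∀ (e : Cell T.faces 1) (a : Cell T.faces 0), a.1 ⊆ e.1 → X e a.1 e.1 = 0
  closed : ∀ (e : Cell T.faces 1) (a : Cell T.faces 0) (e' : Cell T.faces 1) (f : Cell T.faces 2),
    IsFlag a e' f → X e e'.1 f.1 - X e a.1 f.1 + X e a.1 e'.1 =
      incidence o a e * flagSign σ a e' f / n a

/-- The conditions on the values `V f s` of the coefficients of `μ_{⋆f}` at the barycenters of the
simplices `s`. -/
structure VertexSystem (X : Cell T.faces 1 → Finset E → Finset E → ℝ)
    (V : Cell T.faces 2 → Finset E → ℝ) : Prop where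
  dual : ∀ f : Cell T.faces 2, V f f.1 = σ.sgn f
  outside : ∀ (f : Cell T.faces 2) (s : Finset E), s ∈ T.faces → ¬ s ⊆ f.1 → V f s = 0
  exact : ∀ (f : Cell T.faces 2) (s s' : Finset E), s ∈ T.faces → s' ∈ T.faces → s ⊂ s' →
    V f s' - V f s = -∑ e : Cell T.faces 1, (incidence o e f : ℝ) * X e s s'

variable {σ} {n : Cell T.faces 0 → ℝ} {X : Cell T.faces 1 → Finset E → Finset E → ℝ}
  {V : Cell T.faces 2 → Finset E → ℝ}

theorem ssubset_cases {s s' : Finset E} (hs : s ∈ T.faces) (hs' : s' ∈ T.faces) (h : s ⊂ s') :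
    (∃ (a : Cell T.faces 0) (e : Cell T.faces 1), s = a.1 ∧ s' = e.1) ∨
    (∃ (a : Cell T.faces 0) (f : Cell T.faces 2), s = a.1 ∧ s' = f.1) ∨
    (∃ (e : Cell T.faces 1) (f : Cell T.faces 2), s = e.1 ∧ s' = f.1) := by
  obtain ⟨g, hg, hsg, hgc⟩ := T.pure_two s' hs'
  have c1 := Finset.card_le_card hsg
  have c2 := Finset.card_lt_card h
  have c3 := (T.nonempty_of_mem_faces hs).card_pos
  obtain ⟨h1, h2⟩ | ⟨h1, h2⟩ | ⟨h1, h2⟩ : (s.card = 1 ∧ s'.card = 2) ∨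
    (s.card = 1 ∧ s'.card = 3) ∨ (s.card = 2 ∧ s'.card = 3) := by omega
  · exact Or.inl ⟨⟨s, hs, h1⟩, ⟨s', hs', h2⟩, rfl, rfl⟩
  · exact Or.inr (Or.inl ⟨⟨s, hs, h1⟩, ⟨s', hs', h2⟩, rfl, rfl⟩)
  · exact Or.inr (Or.inr ⟨⟨s, hs, h1⟩, ⟨s', hs', h2⟩, rfl, rfl⟩)

/-- The closedness equations on the two triangles of f at a share the unknown `X e₂ a.1 f.1`. Their
difference eliminates it; stability and the dual values leave only `X e₂ a.1 e₁.1`. -/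
theorem EdgeSystem.local_value (hX : EdgeSystem σ n X) {a : Cell T.faces 0}
    {e₁ e₂ : Cell T.faces 1} {f : Cell T.faces 2} (hne : e₁ ≠ e₂)
    (hiff : ∀ k, IsFlag a k f ↔ k = e₁ ∨ k = e₂) :
    incidence o e₂ f * X e₂ a.1 e₁.1 = -σ.sgn f * (1 / 2 - 2 / n a) := by
  have h1 := (hiff e₁).2 (Or.inl rfl)
  have h2 := (hiff e₂).2 (Or.inr rfl)
  have c1 := hX.closed e₂ a e₁ f h1
  have c2 := hX.closed e₂ a e₂ f h2
  rw [hX.stable e₂ a h2.1, hX.dual e₂ e₂ f h2.2, if_pos rfl] at c2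
  rw [hX.dual e₂ e₁ f h1.2, if_neg hne] at c1
  have hsum := sum_flagSign_edges σ a f
  rw [sum_eq_of_pair hne hiff fun k hk => flagSign_of_not σ hk] at hsum
  have hD := incidence_one_sq o h2.2
  have hd := incidence_zero_sq o h2.1
  have hs : flagSign σ a e₁ f = -flagSign σ a e₂ f := by linarith
  have key : X e₂ a.1 e₁.1 = -(σ.sgn f * incidence o e₂ f) / 2 -
      2 * (incidence o a e₂ * flagSign σ a e₂ f) / n a := by
    rw [hs] at c1
    linear_combination c1 - c2
  have hor : incidence o a e₂ * flagSign σ a e₂ f = -(σ.sgn f * incidence o e₂ f) := by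
    rw [flagSign]
    linear_combination -(σ.sgn f * incidence o e₂ f) * hd
  rw [key, hor]
  linear_combination (-σ.sgn f / 2 + 2 * σ.sgn f / n a) * hD

/-- Of the three edges of f only the two at a can contribute, and e₁ itself is ruled out by
stability. -/
theorem EdgeSystem.sum_node (hX : EdgeSystem σ n X) {a : Cell T.faces 0}
    {e₁ e₂ : Cell T.faces 1} {f : Cell T.faces 2} (hne : e₁ ≠ e₂)
    (hiff : ∀ k, IsFlag a k f ↔ k = e₁ ∨ k = e₂) :
    ∑ e : Cell T.faces 1, (incidence o e f : ℝ) * X e a.1 e₁.1 =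
      -σ.sgn f * (1 / 2 - 2 / n a) := by
  have h1 := (hiff e₁).2 (Or.inl rfl)
  rw [sum_eq_of_pair hne hiff, hX.stable e₁ a h1.1, mul_zero, zero_add, hX.local_value hne hiff]
  intro k hk
  rw [IsFlag, not_and_or] at hk
  rcases hk with hk | hk
  · rw [hX.outside k a e₁.1 e₁.2.1 (cell_ssubset (by decide) h1.1) hk, mul_zero]
  · rw [incidence_one_of_not_subset o hk]; simp

theorem EdgeSystem.sum_dual (hX : EdgeSystem σ n X) (f : Cell T.faces 2) {e' : Cell T.faces 1}
    {f' : Cell T.faces 2} (h : e'.1 ⊆ f'.1) :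
    ∑ e : Cell T.faces 1, (incidence o e f : ℝ) * X e e'.1 f'.1 =
      incidence o e' f * (-(σ.sgn f' * incidence o e' f') / 2) := by
  rw [Finset.sum_eq_single e', hX.dual e' e' f' h, if_pos rfl]
  · intro k _ hk
    rw [hX.dual k e' f' h, if_neg hk.symm, mul_zero]
  · simp

theorem VertexSystem.edge_value (hX : EdgeSystem σ n X) (hV : VertexSystem σ X V)
    {e : Cell T.faces 1} {f : Cell T.faces 2} (h : e.1 ⊆ f.1) : V f e.1 = σ.sgn f / 2 := by
  have h1 := hV.exact f e.1 f.1 e.2.1 f.2.1 (cell_ssubset (by decide) h)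
  rw [hX.sum_dual f h, hV.dual] at h1
  have := incidence_one_sq o h
  linear_combination -h1 - σ.sgn f / 2 * this

/-- The value is transported from the barycenter of f through that of an edge e₁ to a: 1/2 + (1/2 -
2/n) subtracted from 1 leaves 2/n, up to the sign of f. -/
theorem VertexSystem.node_value (hX : EdgeSystem σ n X) (hV : VertexSystem σ X V)
    {a : Cell T.faces 0} {f : Cell T.faces 2} (h : a.1 ⊆ f.1) : V f a.1 = 2 * σ.sgn f / n a := by
  obtain ⟨e₁, e₂, hne, hiff⟩ := exists_two_edges h
  have h1 := (hiff e₁).2 (Or.inl rfl)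
  have h2 := hV.exact f a.1 e₁.1 a.2.1 e₁.2.1 (cell_ssubset (by decide) h1.1)
  rw [hX.sum_node hne hiff, hV.edge_value hX h1.2] at h2
  linear_combination -h2

/-! #### Existence -/

theorem exists_edgeSystem (hn : ∀ a : Cell T.faces 0, n a ≠ 0)
    (hsize : ∀ a : Cell T.faces 0, n a =
      ∑ e : Cell T.faces 1, ∑ f : Cell T.faces 2, flagSign σ a e f * flagSign σ a e f) :
    ∃ X, EdgeSystem σ n X := by
  have hpot : ∀ (e : Cell T.faces 1) (a : Cell T.faces 0), ∃ φ : Finset E → ℝ,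
      a.1 ⊆ e.1 → φ e.1 = 0 ∧ ∀ e' f, IsFlag a e' f →
        (if e' = e then -(σ.sgn f * incidence o e f) / 2 else 0) - φ f.1 + φ e'.1 =
          incidence o a e * flagSign σ a e' f / n a := by
    intro e a
    by_cases hae : a.1 ⊆ e.1
    swap
    · exact ⟨0, fun h => absurd h hae⟩
    -- The prescribed difference between facet and edge: the given dual value minus the right-hand
    -- side of the closedness equation.
    obtain ⟨φ, hφ⟩ := exists_potential σ a (fun e' f =>
      (if e' = e then -(σ.sgn f * incidence o e f) / 2 else 0) -
        incidence o a e * flagSign σ a e' f / n a) (by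
      have hd := incidence_zero_sq o hae
      -- Only the two halves of ⋆e contribute, each with half the incidence number, because the
      -- orientation signs square away.
      have h1 : ∑ e' : Cell T.faces 1, ∑ f : Cell T.faces 2, flagSign σ a e' f *
          (if e' = e then -(σ.sgn f * incidence o e f) / 2 else 0) = incidence o a e := by
        rw [Finset.sum_eq_single e]
        · obtain ⟨f₁, f₂, hne, hiff⟩ := exists_two_facets e
          have key : ∀ f : Cell T.faces 2, e.1 ⊆ f.1 → flagSign σ a e f *
              (-(σ.sgn f * incidence o e f) / 2) = incidence o a e / 2 := by
            intro f hf
            have h1 := sgn_sq σ f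
            have h2 := incidence_one_sq o hf
            rw [flagSign]
            linear_combination (incidence o a e / 2 * σ.sgn f * σ.sgn f : ℝ) * h2 +
              (incidence o a e / 2 : ℝ) * h1
          simp only [if_true]
          rw [sum_eq_of_pair hne hiff, key f₁ ((hiff f₁).2 (Or.inl rfl)),
            key f₂ ((hiff f₂).2 (Or.inr rfl))]
          · ring
          · intro k hk
            rw [incidence_one_of_not_subset o hk]; simp
        · intro e' _ he'
          simp [he']
        · simp
      -- The signs square to 1, so all n a triangles contribute equally and cancel the denominator.
      -- Both sums agree, which is the solvability condition.
      have h2 : ∑ e' : Cell T.faces 1, ∑ f : Cell T.faces 2, flagSign σ a e' f *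
          (incidence o a e * flagSign σ a e' f / n a) = incidence o a e := by
        have : ∀ e' f, flagSign σ a e' f * (incidence o a e * flagSign σ a e' f / n a) =
            (incidence o a e / n a) * (flagSign σ a e' f * flagSign σ a e' f) := by
          intro e' f; ring
        simp only [this, ← Finset.mul_sum]
        rw [← hsize, div_mul_cancel₀ _ (hn a)]
      simp only [mul_sub, Finset.sum_sub_distrib]
      rw [h1, h2, sub_self])
    -- The free constant of the potential is chosen so that it vanishes at e, as stability demands.
    refine ⟨fun s => φ s - φ e.1, fun _ => ⟨sub_self _, fun e' f hfl => ?_⟩⟩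
    have := hφ e' f hfl
    linear_combination -this
  choose φ hφ using hpot
  -- The first sum acts only when s is a node, the second only when s = e; dimensions keep them
  -- apart.
  let X : Cell T.faces 1 → Finset E → Finset E → ℝ := fun e s s' =>
    (∑ a : Cell T.faces 0, if a.1 = s then (if a.1 ⊆ e.1 then φ e a s' else 0) else 0) +
    ∑ f : Cell T.faces 2, if s = e.1 ∧ f.1 = s' then -(σ.sgn f * incidence o e f) / 2 else 0
  have hX0 : ∀ e (a : Cell T.faces 0) s', X e a.1 s' = if a.1 ⊆ e.1 then φ e a s' else 0 := by
    intro e a s'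
    have h1 : ∑ f : Cell T.faces 2, (if a.1 = e.1 ∧ f.1 = s' then
        -(σ.sgn f * incidence o e f) / 2 else 0) = 0 :=
      Finset.sum_eq_zero fun f _ => if_neg fun h => cell_ne (by decide) a e h.1
    simp only [X]
    rw [h1, add_zero, Finset.sum_eq_single a]
    · simp
    · intro b _ hb
      rw [if_neg fun h => hb (Subtype.ext h)]
    · simp
  have hX1 : ∀ e (e' : Cell T.faces 1) (f : Cell T.faces 2), X e e'.1 f.1 =
      if e' = e then -(σ.sgn f * incidence o e f) / 2 else 0 := by
    intro e e' f
    have h1 : (∑ a : Cell T.faces 0, if a.1 = e'.1 then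
        (if a.1 ⊆ e.1 then φ e a f.1 else 0) else 0) = 0 :=
      Finset.sum_eq_zero fun a _ => if_neg (cell_ne (by decide) a e')
    simp only [X]
    rw [h1, zero_add, Finset.sum_eq_single f]
    · simp [Subtype.ext_iff]
    · intro b _ hb
      rw [if_neg fun h => hb (Subtype.ext h.2)]
    · simp
  refine ⟨X, ⟨fun e e' f _ => hX1 e e' f, fun e a s _ _ h => by rw [hX0, if_neg h],
    fun e a h => by rw [hX0, if_pos h, (hφ e a h).1], fun e a e' f hfl => ?_⟩⟩
  rw [hX0, hX0, hX1]
  by_cases hae : a.1 ⊆ e.1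
  · rw [if_pos hae, if_pos hae]
    exact (hφ e a hae).2 e' f hfl
  · rw [if_neg hae, if_neg hae, incidence_zero_of_not_subset o hae, if_neg]
    · simp
    · rintro rfl
      exact hae hfl.1

theorem exists_vertexSystem (hX : EdgeSystem σ n X) : ∃ V, VertexSystem σ X V := by
  -- These are the values forced by `VertexSystem.edge_value` and `VertexSystem.node_value`,
  -- extended by zero off f.
  let V : Cell T.faces 2 → Finset E → ℝ := fun f s =>
    if s ⊆ f.1 then (if s.card = 3 then σ.sgn f else if s.card = 2 then σ.sgn f / 2 else
      ∑ a : Cell T.faces 0, if a.1 = s then 2 * σ.sgn f / n a else 0) else 0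
  have hV0 : ∀ f (a : Cell T.faces 0), a.1 ⊆ f.1 → V f a.1 = 2 * σ.sgn f / n a := by
    intro f a h
    simp only [V]
    rw [if_pos h, if_neg (by rw [a.2.2]; decide), if_neg (by rw [a.2.2]; decide),
      Finset.sum_eq_single a]
    · simp
    · intro b _ hb
      rw [if_neg fun h => hb (Subtype.ext h)]
    · simp
  have hV1 : ∀ f (e : Cell T.faces 1), e.1 ⊆ f.1 → V f e.1 = σ.sgn f / 2 := by
    intro f e h
    simp only [V]
    rw [if_pos h, if_neg (by rw [e.2.2]; decide), if_pos e.2.2]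
  have hV2 : ∀ f, V f f.1 = σ.sgn f := by
    intro f
    simp only [V]
    rw [if_pos subset_rfl, if_pos f.2.2]
  have hout : ∀ f s, ¬ s ⊆ f.1 → V f s = 0 := fun f s h => if_neg h
  have hedge : ∀ (f : Cell T.faces 2) (e' : Cell T.faces 1) (f' : Cell T.faces 2),
      e'.1 ⊆ f'.1 → V f f'.1 - V f e'.1 =
        -∑ e : Cell T.faces 1, (incidence o e f : ℝ) * X e e'.1 f'.1 := by
    intro f e' f' h
    rw [hX.sum_dual f h]
    by_cases hf : f' = f
    · subst hf
      rw [hV2, hV1 _ _ h]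
      have := incidence_one_sq o h
      linear_combination -σ.sgn f' / 2 * this
    · have hff : ¬ f'.1 ⊆ f.1 := fun hs =>
        hf (Subtype.ext (Finset.eq_of_subset_of_card_le hs (by rw [f.2.2, f'.2.2])))
      rw [hout _ _ hff]
      by_cases he : e'.1 ⊆ f.1
      · rw [hV1 _ _ he]
        obtain ⟨f₁, f₂, hne, hiff⟩ := exists_two_facets e'
        have hsum := sum_sgn_incidence σ e'
        rw [sum_eq_of_pair hne hiff fun k hk => by rw [incidence_one_of_not_subset o hk]; simp]
          at hsum
        -- When f and f' are the two facets at e', compatibility of their orientations makes the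
        -- jump across the edge match.
        have hsum' : σ.sgn f * incidence o e' f + σ.sgn f' * incidence o e' f' = 0 := by
          rcases (hiff f).1 he with rfl | rfl <;> rcases (hiff f').1 h with rfl | rfl
          · exact absurd rfl hf
          · exact hsum
          · rw [add_comm]; exact hsum
          · exact absurd rfl hf
        have := incidence_one_sq o he
        linear_combination σ.sgn f / 2 * this - incidence o e' f / 2 * hsum'
      · rw [hout _ _ he, incidence_one_of_not_subset o he]; simp
  -- The value predicted at a is the same via e' and via f': summing the closedness equations with
  -- the incidence numbers of f, the right-hand sides cancel because the boundary of a boundary is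
  -- zero.
  have hflag : ∀ (f : Cell T.faces 2) (a : Cell T.faces 0) (e' : Cell T.faces 1)
      (f' : Cell T.faces 2), IsFlag a e' f' →
      V f e'.1 + ∑ e : Cell T.faces 1, (incidence o e f : ℝ) * X e a.1 e'.1 =
      V f f'.1 + ∑ e : Cell T.faces 1, (incidence o e f : ℝ) * X e a.1 f'.1 := by
    intro f a e' f' hfl
    have h1 := hedge f e' f' hfl.2
    have h2 : ∑ e : Cell T.faces 1, (incidence o e f : ℝ) * X e e'.1 f'.1 -
        ∑ e : Cell T.faces 1, (incidence o e f : ℝ) * X e a.1 f'.1 +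
        ∑ e : Cell T.faces 1, (incidence o e f : ℝ) * X e a.1 e'.1 = 0 := by
      rw [← Finset.sum_sub_distrib, ← Finset.sum_add_distrib]
      have : ∀ e : Cell T.faces 1, (incidence o e f : ℝ) * X e e'.1 f'.1 -
          incidence o e f * X e a.1 f'.1 + incidence o e f * X e a.1 e'.1 =
          (incidence o e f * incidence o a e) * (flagSign σ a e' f' / n a) := by
        intro e
        have := hX.closed e a e' f' hfl
        linear_combination (incidence o e f : ℝ) * this
      rw [Finset.sum_congr rfl fun e _ => this e, ← Finset.sum_mul,
        sum_incidence_mul_incidence T.isPureFamily, zero_mul]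
    linear_combination -h1 + h2
  -- By connectedness of the link the predicted value at a does not depend on the edge; it is
  -- computed at an edge of f.
  have hnode : ∀ (f : Cell T.faces 2) (a : Cell T.faces 0) (e' : Cell T.faces 1)
      (f' : Cell T.faces 2), IsFlag a e' f' →
      V f e'.1 + ∑ e : Cell T.faces 1, (incidence o e f : ℝ) * X e a.1 e'.1 = V f a.1 := by
    intro f a e' f' hfl
    by_cases haf : a.1 ⊆ f.1
    · obtain ⟨e₁, e₂, hne, hiff⟩ := exists_two_edges haf
      have h1 := (hiff e₁).2 (Or.inl rfl)
      have := eq_of_link (a := a) (k := fun e' _ =>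
        V f e'.1 + ∑ e : Cell T.faces 1, (incidence o e f : ℝ) * X e a.1 e'.1)
        (fun _ _ _ _ _ => rfl)
        (fun e e' f' h h' => (hflag f a e f' h).trans (hflag f a e' f' h').symm) hfl h1
      rw [this, hX.sum_node hne hiff, hV1 f e₁ h1.2, hV0 f a haf]
      ring
    · rw [hout f a.1 haf, hout f e'.1 fun h => haf (hfl.1.trans h), zero_add]
      refine Finset.sum_eq_zero fun e _ => ?_
      by_cases hae : a.1 ⊆ e.1
      · rw [incidence_one_of_not_subset o fun h => haf (hae.trans h)]; simp
      · rw [hX.outside e a e'.1 e'.2.1 (cell_ssubset (by decide) hfl.1) hae, mul_zero]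
  refine ⟨V, ⟨hV2, fun f s _ h => hout f s h, fun f s s' hs hs' hss' => ?_⟩⟩
  rcases ssubset_cases hs hs' hss' with ⟨a, e', rfl, rfl⟩ | ⟨a, f', rfl, rfl⟩ | ⟨e', f', rfl, rfl⟩
  · obtain ⟨f', hf'⟩ := exists_facet_of_edge e'
    have := hnode f a e' f' ⟨hss'.subset, hf'⟩
    linear_combination this
  · obtain ⟨e', _, _, hiff⟩ := exists_two_edges hss'.subset
    have hfl := (hiff e').2 (Or.inl rfl)
    have h1 := hnode f a e' f' hfl
    have h2 := hflag f a e' f' hfl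
    linear_combination h1 - h2
  · exact hedge f e' f' hss'.subset

/-! #### Uniqueness -/

/-- Two solutions have the same dual values, so around a node of e they differ by a constant, which
stability at e makes zero. Around the other nodes both vanish. -/
theorem EdgeSystem.unique {X' : Cell T.faces 1 → Finset E → Finset E → ℝ}
    (hX : EdgeSystem σ n X) (hX' : EdgeSystem σ n X') (e : Cell T.faces 1) {s s' : Finset E}
    (hs : s ∈ T.faces) (hs' : s' ∈ T.faces) (h : s ⊂ s') : X e s s' = X' e s s' := by
  have hdual : ∀ (e' : Cell T.faces 1) (f : Cell T.faces 2), e'.1 ⊆ f.1 →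
      X e e'.1 f.1 = X' e e'.1 f.1 := fun e' f hf => by rw [hX.dual e e' f hf, hX'.dual e e' f hf]
  have hflag : ∀ (a : Cell T.faces 0) (e' : Cell T.faces 1) (f : Cell T.faces 2), IsFlag a e' f →
      X e a.1 f.1 - X' e a.1 f.1 = X e a.1 e'.1 - X' e a.1 e'.1 := by
    intro a e' f hfl
    have h1 := hX.closed e a e' f hfl
    have h2 := hX'.closed e a e' f hfl
    have h3 := hdual e' f hfl.2
    linear_combination h2 - h1 + h3
  have hnode : ∀ (a : Cell T.faces 0) (e' : Cell T.faces 1), a.1 ⊆ e'.1 →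
      X e a.1 e'.1 = X' e a.1 e'.1 := by
    intro a e' ha
    by_cases hae : a.1 ⊆ e.1
    · obtain ⟨f, hf⟩ := exists_facet_of_edge e
      obtain ⟨f', hf'⟩ := exists_facet_of_edge e'
      have := eq_of_link (a := a) (k := fun e' _ => X e a.1 e'.1 - X' e a.1 e'.1)
        (fun _ _ _ _ _ => rfl)
        (fun e e' f' h h' => (hflag a e f' h).symm.trans (hflag a e' f' h'))
        (show IsFlag a e' f' from ⟨ha, hf'⟩) (show IsFlag a e f from ⟨hae, hf⟩)
      rw [hX.stable e a hae, hX'.stable e a hae] at this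
      linear_combination this
    · rw [hX.outside e a e'.1 e'.2.1 (cell_ssubset (by decide) ha) hae,
        hX'.outside e a e'.1 e'.2.1 (cell_ssubset (by decide) ha) hae]
  rcases ssubset_cases hs hs' h with ⟨a, e', rfl, rfl⟩ | ⟨a, f', rfl, rfl⟩ | ⟨e', f', rfl, rfl⟩
  · exact hnode a e' h.subset
  · obtain ⟨e', _, _, hiff⟩ := exists_two_edges h.subset
    have hfl := (hiff e').2 (Or.inl rfl)
    have h1 := hflag a e' f' hfl
    have h2 := hnode a e' hfl.1
    linear_combination h1 + h2
  · exact hdual e' f' h.subset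

/-- Inside f the value is tied to the prescribed one at the barycenter of f by a single segment;
outside f it is zero. -/
theorem VertexSystem.unique {X' : Cell T.faces 1 → Finset E → Finset E → ℝ}
    {V' : Cell T.faces 2 → Finset E → ℝ}
    (hX : EdgeSystem σ n X) (hX' : EdgeSystem σ n X') (hV : VertexSystem σ X V)
    (hV' : VertexSystem σ X' V') (f : Cell T.faces 2) {s : Finset E}
    (hs : s ∈ T.faces) : V f s = V' f s := by
  by_cases hsf : s ⊆ f.1
  · by_cases heq : s = f.1
    · rw [heq, hV.dual, hV'.dual]
    · have hss := hsf.ssubset_of_ne heq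
      have h1 := hV.exact f s f.1 hs f.2.1 hss
      have h2 := hV'.exact f s f.1 hs f.2.1 hss
      rw [hV.dual] at h1
      rw [hV'.dual] at h2
      simp only [hX.unique hX' _ hs f.2.1 hss] at h1
      linear_combination h2 - h1
  · rw [hV.outside f s hs hsf, hV'.outside f s hs hsf]

end ClosedTriangulatedSurface

namespace ClosedTriangulatedSurface

variable {T : ClosedTriangulatedSurface E} {o : Numbering T.faces} (σ : SurfaceOrientation T o)
  (o' : Numbering (sdFaces T.faces))

/-! ### Values of the coefficients on oriented cells -/

/-- The coefficient of `μ_{⋆e}` on the oriented edge of the refinement from the barycenter of `s`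
to that of `s'`. -/
def edgeValue (R : Coeffs T) (e : Cell T.faces 1) (s s' : Finset E) : ℝ :=
  cval₁ o' (R 1 1 rfl e) (barycenter s) (barycenter s')

/-- The coefficient of `μ_{⋆f}` at the barycenter of `s`. -/
def vertexValue (R : Coeffs T) (f : Cell T.faces 2) (s : Finset E) : ℝ :=
  cval₀ o' (R 0 2 rfl f) (barycenter s)

theorem edgeValue_eq (R : Coeffs T) (e : Cell T.faces 1) {s s' : Finset E} (hs : s ∈ T.faces)
    (hs' : s' ∈ T.faces) (h : s ⊂ s') : edgeValue o' R e s s' =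
      startSign o' (edgeCell hs hs' h) (barycenter s) * R 1 1 rfl e (edgeCell hs hs' h) := by
  have hne : barycenter s' ≠ barycenter s := fun hb => h.ne (barycenter_inj hs' hs hb).symm
  have := cval₁_vert o' (R 1 1 rfl e) (edgeCell hs hs' h)
  unfold edgeValue startSign
  rcases vert_pair o' (w := edgeCell hs hs' h) rfl with ⟨h0, h1⟩ | ⟨h0, h1⟩ <;>
    rw [h0, h1] at this
  · rw [if_pos h0, one_mul, this]
  · rw [h0, if_neg hne, cval₁_antisymm, this]
    ring

theorem edgeValue_eq_zero_iff (R : Coeffs T) (e : Cell T.faces 1) {s s' : Finset E}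
    (hs : s ∈ T.faces) (hs' : s' ∈ T.faces) (h : s ⊂ s') :
    edgeValue o' R e s s' = 0 ↔ R 1 1 rfl e (edgeCell hs hs' h) = 0 := by
  rw [edgeValue_eq o' R e hs hs' h, mul_eq_zero, or_iff_right]
  intro h0
  have := startSign_sq o' (edgeCell hs hs' h) (barycenter s)
  rw [h0] at this
  norm_num at this

theorem vertexValue_eq (R : Coeffs T) (f : Cell T.faces 2) {s : Finset E} (hs : s ∈ T.faces) :
    vertexValue o' R f s = R 0 2 rfl f (vertexCell hs) :=
  cval₀_singleton o' _ rfl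

/-! ### The exterior derivative in terms of coefficients -/

theorem d_bcForm_eq_iff (R : Coeffs T) {q r : ℕ} (h : q + (r + 1) = 2) (h' : (q + 1) + r = 2)
    (t : Cell T.faces (r + 1)) : (bcForm o' R h t).d =
        (-1 : ℝ) ^ r • ∑ s : Cell T.faces r, (incidence o s t : ℝ) • bcForm o' R h' s ↔
      ∀ w', ∑ w, (incidence o' w w' : ℝ) * R q (r + 1) h t w =
        (-1 : ℝ) ^ r * ∑ s : Cell T.faces r, (incidence o s t : ℝ) * R (q + 1) r h' s w' := by
  rw [← d_sum_whitneyBasis_eq_iff isPureFamily_sdFaces o' (by omega)]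
  have : (-1 : ℝ) ^ r • ∑ s : Cell T.faces r, (incidence o s t : ℝ) • bcForm o' R h' s =
      ∑ w', ((-1 : ℝ) ^ r * ∑ s : Cell T.faces r, (incidence o s t : ℝ) * R (q + 1) r h' s w') •
        whitneyBasis o' w' := by
    simp only [bcForm, Finset.smul_sum, smul_smul, Finset.mul_sum, Finset.sum_smul]
    rw [Finset.sum_comm]
  rw [this]
  rfl

/-- Among all nodes only a has the triangle in its dual cell. Both sides then carry the same sign ε
of the numbering of the triangle, which drops out. -/
theorem coboundary_edge_iff {R : Coeffs T} (hR : ∀ (a : Cell T.faces 0) w, R 2 0 rfl a w =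
      (chainCoeff o' σ rfl a w : ℝ) / dualSize o' σ (rfl : 2 + 0 = 2) a) (e : Cell T.faces 1)
    {a : Cell T.faces 0} {e' : Cell T.faces 1} {f : Cell T.faces 2} (hfl : IsFlag a e' f) :
    ∑ w, (incidence o' w hfl.cell : ℝ) * R 1 1 rfl e w =
        ∑ b : Cell T.faces 0, (incidence o b e : ℝ) * R 2 0 rfl b hfl.cell ↔
      edgeValue o' R e e'.1 f.1 - edgeValue o' R e a.1 f.1 + edgeValue o' R e a.1 e'.1 =
        incidence o a e * flagSign σ a e' f / dualSize o' σ (rfl : 2 + 0 = 2) a := by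
  obtain ⟨ε, hε, hG, hc⟩ := hfl.exists_sign σ o' (w := hfl.cell) rfl rfl
  have hε0 : ε ≠ 0 := by rintro rfl; norm_num at hε
  have h1 := hG _ (isAlternating₃_coboundary o' (R 1 1 rfl e))
  have h2 : ∑ b : Cell T.faces 0, (incidence o b e : ℝ) * R 2 0 rfl b hfl.cell =
      ε * (incidence o a e * flagSign σ a e' f / dualSize o' σ (rfl : 2 + 0 = 2) a) := by
    rw [Finset.sum_eq_single a]
    · rw [hR, hc]
      ring
    · intro b _ hb
      rw [hR, chainCoeff_eq_zero σ o' rfl fun hd => hb ((inDual_tri_iff hfl).1 hd)]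
      simp
    · simp
  rw [sum_incidence_one, h1, h2]
  exact mul_right_inj' hε0

theorem coboundary_vertex_iff (R : Coeffs T) (f : Cell T.faces 2) {s s' : Finset E}
    (hs : s ∈ T.faces) (hs' : s' ∈ T.faces) (h : s ⊂ s') :
    ∑ w, (incidence o' w (edgeCell hs hs' h) : ℝ) * R 0 2 rfl f w =
        -∑ e : Cell T.faces 1, (incidence o e f : ℝ) * R 1 1 rfl e (edgeCell hs hs' h) ↔
      vertexValue o' R f s' - vertexValue o' R f s =
        -∑ e : Cell T.faces 1, (incidence o e f : ℝ) * edgeValue o' R e s s' := by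
  have hη := startSign_sq o' (edgeCell hs hs' h) (barycenter s)
  have hη0 : startSign o' (edgeCell hs hs' h) (barycenter s) ≠ 0 := by
    intro h0
    rw [h0] at hη
    norm_num at hη
  have hne : barycenter s' ≠ barycenter s := fun hb => h.ne (barycenter_inj hs' hs hb).symm
  have h1 : ∑ w, (incidence o' w (edgeCell hs hs' h) : ℝ) * R 0 2 rfl f w =
      startSign o' (edgeCell hs hs' h) (barycenter s) *
        (vertexValue o' R f s' - vertexValue o' R f s) := by
    rw [sum_incidence_zero]
    unfold vertexValue startSign
    rcases vert_pair o' (w := edgeCell hs hs' h) rfl with ⟨h0, h1⟩ | ⟨h0, h1⟩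
    · rw [if_pos h0, h0, h1, one_mul]
    · rw [h0, h1, if_neg hne]
      ring
  have h2 : ∀ e : Cell T.faces 1, R 1 1 rfl e (edgeCell hs hs' h) =
      startSign o' (edgeCell hs hs' h) (barycenter s) * edgeValue o' R e s s' := by
    intro e
    rw [edgeValue_eq o' R e hs hs' h, ← mul_assoc, hη, one_mul]
  have h3 : -∑ e : Cell T.faces 1, (incidence o e f : ℝ) * R 1 1 rfl e (edgeCell hs hs' h) =
      startSign o' (edgeCell hs hs' h) (barycenter s) *
        -∑ e : Cell T.faces 1, (incidence o e f : ℝ) * edgeValue o' R e s s' := by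
    rw [mul_neg, Finset.mul_sum]
    congr 1
    refine Finset.sum_congr rfl fun e _ => ?_
    rw [h2]
    ring
  rw [h1, h3]
  exact mul_right_inj' hη0

/-! ### The conditions as a combinatorial system -/

/-- The coefficients satisfy the combinatorial systems. -/
structure IsSolution (R : Coeffs T) : Prop where
  node : ∀ (a : Cell T.faces 0) (w : Cell (sdFaces T.faces) 2), R 2 0 rfl a w =
    (chainCoeff o' σ rfl a w : ℝ) / dualSize o' σ (rfl : 2 + 0 = 2) a
  edge : EdgeSystem σ (fun a => (dualSize o' σ (rfl : 2 + 0 = 2) a : ℝ)) (edgeValue o' R)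
  facet : VertexSystem σ (edgeValue o' R) (vertexValue o' R)

variable {σ o'}

theorem subset_of_edgeCell_subset {s s' t : Finset E} (hs : s ∈ T.faces) (hs' : s' ∈ T.faces)
    (h : s ⊂ s') (ht : t ∈ T.faces)
    (hst : convexHull ℝ ((edgeCell hs hs' h).1 : Set E) ⊆ convexHull ℝ (t : Set E)) : s' ⊆ t :=
  subset_of_barycenter_mem hs' ht (hst (subset_convexHull ℝ _ (by simp [edgeCell])))

theorem edgeCell_subset {s s' : Finset E} (hs : s ∈ T.faces) (hs' : s' ∈ T.faces) (h : s ⊂ s') :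
    convexHull ℝ ((edgeCell hs hs' h).1 : Set E) ⊆ convexHull ℝ (s' : Set E) := by
  refine convexHull_min ?_ (convex_convexHull ℝ _)
  intro x hx
  simp only [edgeCell, Finset.coe_insert, Finset.coe_singleton, Set.mem_insert_iff,
    Set.mem_singleton_iff] at hx
  rcases hx with rfl | rfl
  · exact convexHull_mono (by exact_mod_cast h.subset)
      (barycenter_mem_convexHull (T.nonempty_of_mem_faces hs))
  · exact barycenter_mem_convexHull (T.nonempty_of_mem_faces hs')

theorem not_subset_of_ne {k : ℕ} {s t : Cell T.faces k} (h : s ≠ t) : ¬ s.1 ⊆ t.1 := fun hst =>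
  h (Subtype.ext (Finset.eq_of_subset_of_card_le hst (by rw [s.2.2, t.2.2])))

theorem chainCoeff_cast_ne_zero {q r : ℕ} (h : q + r = 2) {t : Cell T.faces r}
    {w : Cell (sdFaces T.faces) q} (hw : InDual T t.1 w.1) : chainCoeff o' σ h t w ≠ 0 := by
  rcases chainCoeff_ne_zero σ o' h hw with h | h <;> rw [h] <;> decide

/-- This is the half that yields uniqueness: only the vanishing of coefficients is used from local
support, neither the support itself nor the trace. -/
theorem isSolution_of_conditions {R : Coeffs T} (hL : LocalSupport o' R) (hW : EqualWeight o' σ R)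
    (hS : Stability R) (hD : DiscreteExteriorDerivative o o' R) : IsSolution σ o' R := by
  have hR := hL.supportedInside
  have hnode : ∀ (a : Cell T.faces 0) (w : Cell (sdFaces T.faces) 2), R 2 0 rfl a w =
      (chainCoeff o' σ rfl a w : ℝ) / dualSize o' σ (rfl : 2 + 0 = 2) a := by
    intro a w
    by_cases hd : InDual T a.1 w.1
    · exact hW 2 0 rfl a w (chainCoeff_cast_ne_zero rfl hd)
    · obtain ⟨a', e, f, hfl, rfl⟩ := exists_flag_cell w
      rw [chainCoeff_eq_zero σ o' rfl hd,
        hR 2 0 rfl a hfl.cell a'.1 hfl.isLowest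
          (not_subset_of_ne fun h => hd ((inDual_tri_iff hfl).2 h.symm))]
      simp
  refine ⟨hnode, ⟨?_, ?_, ?_, ?_⟩, ⟨?_, ?_, ?_⟩⟩
  · intro e e' f hf
    split_ifs with he
    · subst he
      rw [edgeValue_eq o' R _ e'.2.1 f.2.1 (cell_ssubset (by decide) hf),
        hW 1 1 rfl e' _ (chainCoeff_cast_ne_zero rfl (inDual_edgeCell e' f.2.1 _)),
        chainCoeff_edge σ o' hf, dualSize_edge]
      have := startSign_sq o' (edgeCell e'.2.1 f.2.1 (cell_ssubset (by decide) hf))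
        (barycenter e'.1)
      linear_combination -(σ.sgn f * incidence o e' f) / 2 * this
    · rw [edgeValue_eq_zero_iff o' R e e'.2.1 f.2.1 (cell_ssubset (by decide) hf)]
      exact hR 1 1 rfl e _ e'.1 (isLowest_edgeCell _ _ _) (not_subset_of_ne he)
  · intro e a s hs has ha
    rw [edgeValue_eq_zero_iff o' R e a.2.1 hs has]
    exact hR 1 1 rfl e _ a.1 (isLowest_edgeCell _ _ _) ha
  · intro e a ha
    rw [edgeValue_eq_zero_iff o' R e a.2.1 e.2.1 (cell_ssubset (by decide) ha)]
    exact hS rfl e _ (edgeCell_subset _ _ _)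
  · intro e a e' f hfl
    refine (coboundary_edge_iff σ o' hnode e hfl).1 ?_
    have := (d_bcForm_eq_iff o' R (q := 1) (r := 0) rfl rfl e).1 (hD 1 0 rfl rfl e) hfl.cell
    rw [pow_zero, one_mul] at this
    exact this
  · intro f
    rw [vertexValue_eq o' R f f.2.1,
      hW 0 2 rfl f _ (chainCoeff_cast_ne_zero rfl (inDual_vertexCell f)), chainCoeff_vertex,
      dualSize_facet, div_one]
  · intro f s hs hsf
    rw [vertexValue_eq o' R f hs]
    exact hR 0 2 rfl f _ s (isLowest_vertexCell hs) hsf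
  · intro f s s' hs hs' h
    refine (coboundary_vertex_iff o' R f hs hs' h).1 ?_
    have := (d_bcForm_eq_iff o' R (q := 0) (r := 1) rfl rfl f).1 (hD 0 1 rfl rfl f)
      (edgeCell hs hs' h)
    rw [pow_one, neg_one_mul] at this
    exact this

theorem IsLowest.eq {s s' w : Finset E} (h : IsLowest T s w) (h' : IsLowest T s' w) : s = s' :=
  (h.2.2 s' h'.1 h'.2.1).antisymm (h'.2.2 s h.1 h.2.1)

/-! ### Solutions of the systems satisfy all conditions and are unique -/

namespace IsSolution

variable {R : Coeffs T} (hR : IsSolution σ o' R)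
include hR

theorem supportedInside : SupportedInside R := by
  intro q r h t w s hs hst
  obtain ⟨rfl, rfl⟩ | ⟨rfl, rfl⟩ | ⟨rfl, rfl⟩ :
    (q = 2 ∧ r = 0) ∨ (q = 1 ∧ r = 1) ∨ (q = 0 ∧ r = 2) := by omega
  · rw [hR.node, chainCoeff_eq_zero σ o' rfl]
    · simp
    · intro hd
      obtain ⟨a, e, f, hfl, rfl⟩ := exists_flag_cell w
      obtain rfl := (inDual_tri_iff hfl).1 hd
      exact hst (hs.eq hfl.isLowest).le
  · obtain ⟨s₀, s₁, h0, h1, h01, rfl⟩ := exists_edgeCell w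
    obtain rfl := hs.eq (isLowest_edgeCell h0 h1 h01)
    rw [← edgeValue_eq_zero_iff o' R t h0 h1 h01]
    rcases ssubset_cases h0 h1 h01 with ⟨a, e, rfl, rfl⟩ | ⟨a, f, rfl, rfl⟩ | ⟨e, f, rfl, rfl⟩
    · exact hR.edge.outside t a e.1 h1 h01 hst
    · exact hR.edge.outside t a f.1 h1 h01 hst
    · rw [hR.edge.dual t e f h01.subset, if_neg]
      rintro rfl
      exact hst subset_rfl
  · obtain ⟨s₀, h0, rfl⟩ := exists_vertexCell w
    obtain rfl := hs.eq (isLowest_vertexCell h0)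
    rw [← vertexValue_eq o' R t h0]
    exact hR.facet.outside t s h0 hst

/-- This supplies the nonvanishing needed for the support. In degree 1, zero coefficients on all
three sides of the triangle would contradict closedness, whose right-hand side is ±1/n; in degree 0
the value at the node is ±2/n. -/
theorem exists_ne_zero (q r : ℕ) (h : q + r = 2) (t : Cell T.faces r) (a : Cell T.faces 0)
    (e : Cell T.faces 1) (f : Cell T.faces 2) (hfl : IsFlag a e f) (hat : a.1 ⊆ t.1) :
    ∃ w : Cell (sdFaces T.faces) q, w.1 ⊆ tri a e f ∧ R q r h t w ≠ 0 := by
  have hn : (dualSize o' σ (rfl : 2 + 0 = 2) a : ℝ) ≠ 0 := (dualSize_node_pos σ o' a rfl).ne'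
  obtain ⟨rfl, rfl⟩ | ⟨rfl, rfl⟩ | ⟨rfl, rfl⟩ :
    (q = 2 ∧ r = 0) ∨ (q = 1 ∧ r = 1) ∨ (q = 0 ∧ r = 2) := by omega
  · obtain rfl : a = t := by_contra fun h => not_subset_of_ne h hat
    refine ⟨hfl.cell, subset_rfl, ?_⟩
    rw [hR.node]
    refine div_ne_zero (Int.cast_ne_zero.2 (chainCoeff_cast_ne_zero rfl ?_)) hn
    exact (inDual_tri_iff hfl).2 rfl
  · have hsub : ∀ {s s' : Finset E} (hs : s ∈ T.faces) (hs' : s' ∈ T.faces) (hss' : s ⊂ s'),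
        barycenter s ∈ tri a e f → barycenter s' ∈ tri a e f →
          (edgeCell hs hs' hss').1 ⊆ tri a e f := by
      intro s s' hs hs' hss' h1 h2 x hx
      simp only [edgeCell, Finset.mem_insert, Finset.mem_singleton] at hx
      rcases hx with rfl | rfl
      exacts [h1, h2]
    have hc := hR.edge.closed t a e f hfl
    have hne : (incidence o a t : ℝ) * flagSign σ a e f / dualSize o' σ (rfl : 2 + 0 = 2) a ≠ 0 := by
      refine div_ne_zero (mul_ne_zero ?_ ?_) hn
      · intro h0
        have := incidence_zero_sq o hat
        rw [h0] at this
        norm_num at this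
      · intro h0
        have := flagSign_sq σ hfl
        rw [h0] at this
        norm_num at this
    by_contra! hall
    refine hne (hc.symm.trans ?_)
    have haf := hfl.1.trans hfl.2
    rw [(edgeValue_eq_zero_iff o' R t e.2.1 f.2.1 (cell_ssubset (by decide) hfl.2)).2
        (hall _ (hsub _ _ _ (by simp [tri]) (by simp [tri]))),
      (edgeValue_eq_zero_iff o' R t a.2.1 f.2.1 (cell_ssubset (by decide) haf)).2
        (hall _ (hsub _ _ _ (by simp [tri]) (by simp [tri]))),
      (edgeValue_eq_zero_iff o' R t a.2.1 e.2.1 (cell_ssubset (by decide) hfl.1)).2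
        (hall _ (hsub _ _ _ (by simp [tri]) (by simp [tri])))]
    ring
  · refine ⟨vertexCell a.2.1, by simp [vertexCell, tri], ?_⟩
    rw [← vertexValue_eq o' R t a.2.1, hR.facet.node_value hR.edge hat]
    refine div_ne_zero (mul_ne_zero two_ne_zero fun h0 => ?_) hn
    have := sgn_sq σ t
    rw [h0] at this
    norm_num at this

theorem localSupport : LocalSupport o' R :=
  localSupport_of_supportedInside hR.supportedInside hR.exists_ne_zero

theorem equalWeight : EqualWeight o' σ R := by
  intro q r h t w hc
  have hd : InDual T t.1 w.1 := by_contra fun hd => hc (chainCoeff_eq_zero σ o' h hd)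
  obtain ⟨rfl, rfl⟩ | ⟨rfl, rfl⟩ | ⟨rfl, rfl⟩ :
    (q = 2 ∧ r = 0) ∨ (q = 1 ∧ r = 1) ∨ (q = 0 ∧ r = 2) := by omega
  · exact hR.node t w
  · obtain ⟨f, hf, rfl⟩ := eq_edgeCell_of_inDual hd
    have h1 := hR.edge.dual t t f hf
    rw [if_pos rfl, edgeValue_eq o' R t t.2.1 f.2.1 (cell_ssubset (by decide) hf)] at h1
    rw [chainCoeff_edge σ o' hf, dualSize_edge]
    have := startSign_sq o' (edgeCell t.2.1 f.2.1 (cell_ssubset (by decide) hf)) (barycenter t.1)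
    set η := startSign o' (edgeCell t.2.1 f.2.1 (cell_ssubset (by decide) hf)) (barycenter t.1)
    linear_combination η * h1 -
      R 1 1 rfl t (edgeCell t.2.1 f.2.1 (cell_ssubset (by decide) hf)) * this
  · obtain rfl := eq_vertexCell_of_inDual hd
    rw [chainCoeff_vertex, dualSize_facet, div_one, ← hR.facet.dual t,
      vertexValue_eq o' R t t.2.1]

theorem stability : Stability R := by
  intro h t w hw
  obtain ⟨s, s', hs, hs', hss', rfl⟩ := exists_edgeCell w
  have hst := subset_of_edgeCell_subset hs hs' hss' t.2.1 hw
  rw [← edgeValue_eq_zero_iff o' R t hs hs' hss']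
  have hc := Finset.card_le_card hst
  rw [t.2.2] at hc
  rcases ssubset_cases hs hs' hss' with ⟨a, e, rfl, rfl⟩ | ⟨a, f, rfl, rfl⟩ | ⟨e, f, rfl, rfl⟩
  · obtain rfl : e = t := by_contra fun h => not_subset_of_ne h hst
    exact hR.edge.stable e a hss'.subset
  · rw [f.2.2] at hc
    omega
  · rw [f.2.2] at hc
    omega

theorem discreteExteriorDerivative : DiscreteExteriorDerivative o o' R := by
  intro q r h h' t
  refine (d_bcForm_eq_iff o' R h h' t).2 fun w' => ?_
  obtain ⟨rfl, rfl⟩ | ⟨rfl, rfl⟩ : (q = 1 ∧ r = 0) ∨ (q = 0 ∧ r = 1) := by omega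
  · obtain ⟨a, e, f, hfl, rfl⟩ := exists_flag_cell w'
    rw [pow_zero, one_mul]
    exact (coboundary_edge_iff σ o' hR.node t hfl).2 (hR.edge.closed t a e f hfl)
  · obtain ⟨s, s', hs, hs', hss', rfl⟩ := exists_edgeCell w'
    rw [pow_one, neg_one_mul]
    exact (coboundary_vertex_iff o' R t hs hs' hss').2 (hR.facet.exact t s s' hs hs' hss')

theorem unique {R' : Coeffs T} (hR' : IsSolution σ o' R') : R' = R := by
  funext q r h t w
  obtain ⟨rfl, rfl⟩ | ⟨rfl, rfl⟩ | ⟨rfl, rfl⟩ :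
    (q = 2 ∧ r = 0) ∨ (q = 1 ∧ r = 1) ∨ (q = 0 ∧ r = 2) := by omega
  · exact (hR'.node t w).trans (hR.node t w).symm
  · obtain ⟨s, s', hs, hs', hss', rfl⟩ := exists_edgeCell w
    have h1 := hR'.edge.unique hR.edge t hs hs' hss'
    rw [edgeValue_eq o' R t hs hs' hss', edgeValue_eq o' R' t hs hs' hss'] at h1
    refine mul_left_cancel₀ (fun h0 => ?_) h1
    have := startSign_sq o' (edgeCell hs hs' hss') (barycenter s)
    rw [h0] at this
    norm_num at this
  · obtain ⟨s, hs, rfl⟩ := exists_vertexCell w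
    have h1 := hR'.facet.unique hR'.edge hR.edge hR.facet t hs
    rwa [vertexValue_eq o' R t hs, vertexValue_eq o' R' t hs] at h1

/-- A cell w of ⋆t whose least simplex is t has a nonzero equal-weight coefficient for t. For
another t' of the same dimension t is not contained in t', so its coefficient is zero. -/
theorem exists_diagonal (q r : ℕ) (h : q + r = 2) (t : Cell T.faces r) :
    ∃ w : Cell (sdFaces T.faces) q, R q r h t w ≠ 0 ∧ ∀ t', t' ≠ t → R q r h t' w = 0 := by
  suffices ∃ w : Cell (sdFaces T.faces) q, IsLowest T t.1 w.1 ∧ R q r h t w ≠ 0 by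
    obtain ⟨w, hw, hne⟩ := this
    exact ⟨w, hne, fun t' ht' => hR.supportedInside q r h t' w t.1 hw (not_subset_of_ne ht'.symm)⟩
  have key : ∀ w : Cell (sdFaces T.faces) q, IsLowest T t.1 w.1 → R q r h t w ≠ 0 := by
    intro w hw
    have hd := chainCoeff_cast_ne_zero (σ := σ) (o' := o') h ((hw.inDual_iff w.2.1).2 subset_rfl)
    rw [hR.equalWeight q r h t w hd]
    refine div_ne_zero (Int.cast_ne_zero.2 hd) (Int.cast_ne_zero.2 fun h0 => ?_)
    rw [dualSize, Finset.sum_eq_zero_iff_of_nonneg fun w _ => abs_nonneg _] at h0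
    exact hd (abs_eq_zero.1 (h0 w (Finset.mem_univ w)))
  suffices ∃ w : Cell (sdFaces T.faces) q, IsLowest T t.1 w.1 by
    obtain ⟨w, hw⟩ := this
    exact ⟨w, hw, key w hw⟩
  obtain ⟨rfl, rfl⟩ | ⟨rfl, rfl⟩ | ⟨rfl, rfl⟩ :
    (q = 2 ∧ r = 0) ∨ (q = 1 ∧ r = 1) ∨ (q = 0 ∧ r = 2) := by omega
  · obtain ⟨e, f, hfl⟩ := exists_flag_at t
    exact ⟨hfl.cell, hfl.isLowest⟩
  · obtain ⟨f, hf⟩ := exists_facet_of_edge t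
    exact ⟨_, isLowest_edgeCell t.2.1 f.2.1 (cell_ssubset (by decide) hf)⟩
  · exact ⟨_, isLowest_vertexCell t.2.1⟩

theorem linearIndependent (q r : ℕ) (h : q + r = 2) :
    LinearIndependent ℝ (fun t : Cell T.faces r => bcForm o' R h t) := by
  rw [Fintype.linearIndependent_iff]
  intro g hg t
  obtain ⟨w, hw, hw'⟩ := hR.exists_diagonal q r h t
  have h1 : ∑ w, (∑ t, g t * R q r h t w) • whitneyBasis o' w =
      ∑ w : Cell (sdFaces T.faces) q, (0 : ℝ) • whitneyBasis o' w := by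
    simp only [zero_smul, Finset.sum_const_zero, Finset.sum_smul]
    rw [Finset.sum_comm, ← hg]
    simp only [bcForm, Finset.smul_sum, smul_smul]
  have h2 := congrFun (whitney_coeff_unique isPureFamily_sdFaces o' h1) w
  rw [Finset.sum_eq_single t] at h2
  · exact (mul_eq_zero.1 h2).resolve_right hw
  · intro t' _ ht'
    rw [hw' t' ht', mul_zero]
  · simp

end IsSolution

/-! ### Existence of the coefficients -/

/-- The simplex with a given barycenter. -/
def simplexAt (T : ClosedTriangulatedSurface E) (x : E) : Finset E :=
  if h : ∃ s ∈ T.faces, barycenter s = x then h.choose else ∅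

theorem simplexAt_barycenter {s : Finset E} (hs : s ∈ T.faces) :
    simplexAt T (barycenter s) = s := by
  have h : ∃ s' ∈ T.faces, barycenter s' = barycenter s := ⟨s, hs, rfl⟩
  rw [simplexAt, dif_pos h]
  exact barycenter_inj h.choose_spec.1 hs h.choose_spec.2

variable (σ o') in
theorem exists_isSolution : ∃ R : Coeffs T, IsSolution σ o' R := by
  obtain ⟨X, hX⟩ := exists_edgeSystem (σ := σ)
    (n := fun a => (dualSize o' σ (rfl : 2 + 0 = 2) a : ℝ))
    (fun a => (dualSize_node_pos σ o' a rfl).ne') (fun a => dualSize_node σ o' a rfl)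
  obtain ⟨V, hV⟩ := exists_vertexSystem hX
  -- `X` is meaningful only on increasing pairs. It is cut off there and antisymmetrized, so that
  -- the coefficient follows the orientation of each edge of the refinement.
  let B : Cell T.faces 1 → Finset E → Finset E → ℝ := fun e s s' => if s ⊂ s' then X e s s' else 0
  let A : Cell T.faces 1 → E → E → ℝ := fun e x y =>
    B e (simplexAt T x) (simplexAt T y) - B e (simplexAt T y) (simplexAt T x)
  -- The last branch is never relevant: q + r = 2 leaves only the three pairs above it.
  let R : Coeffs T := fun q r h => match q, r, h with
    | 2, 0, h => fun a w => (chainCoeff o' σ h a w : ℝ) / dualSize o' σ h a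
    | 1, 1, _ => fun e w => A e (o'.vert w 0) (o'.vert w 1)
    | 0, 2, _ => fun f w => V f (simplexAt T (o'.vert w 0))
    | _, _, _ => fun _ _ => 0
  have hE : ∀ (e : Cell T.faces 1) (s s' : Finset E), s ∈ T.faces → s' ∈ T.faces → s ⊂ s' →
      edgeValue o' R e s s' = X e s s' := by
    intro e s s' hs hs' h
    have : edgeValue o' R e s s' = A e (barycenter s) (barycenter s') :=
      cval₁_pair o' (w := edgeCell hs hs' h) (A := A e) rfl (fun x y => by simp only [A]; ring) rfl
    rw [this]
    simp only [A, B, simplexAt_barycenter hs, simplexAt_barycenter hs', if_pos h,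
      if_neg (h.asymm), sub_zero]
  have hv : ∀ (f : Cell T.faces 2) (s : Finset E), s ∈ T.faces →
      vertexValue o' R f s = V f s := by
    intro f s hs
    rw [vertexValue_eq o' R f hs]
    have : o'.vert (vertexCell hs) 0 = barycenter s := by
      simpa [vertexCell] using o'.vert_mem (vertexCell hs) 0
    change V f (simplexAt T (o'.vert (vertexCell hs) 0)) = V f s
    rw [this, simplexAt_barycenter hs]
  refine ⟨R, ⟨fun a w => rfl, ⟨?_, ?_, ?_, ?_⟩, ⟨?_, ?_, ?_⟩⟩⟩
  · intro e e' f hf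
    rw [hE e e'.1 f.1 e'.2.1 f.2.1 (cell_ssubset (by decide) hf)]
    exact hX.dual e e' f hf
  · intro e a s hs has ha
    rw [hE e a.1 s a.2.1 hs has]
    exact hX.outside e a s hs has ha
  · intro e a ha
    rw [hE e a.1 e.1 a.2.1 e.2.1 (cell_ssubset (by decide) ha)]
    exact hX.stable e a ha
  · intro e a e' f hfl
    rw [hE e e'.1 f.1 e'.2.1 f.2.1 (cell_ssubset (by decide) hfl.2),
      hE e a.1 f.1 a.2.1 f.2.1 (cell_ssubset (by decide) (hfl.1.trans hfl.2)),
      hE e a.1 e'.1 a.2.1 e'.2.1 (cell_ssubset (by decide) hfl.1)]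
    exact hX.closed e a e' f hfl
  · intro f
    rw [hv f f.1 f.2.1]
    exact hV.dual f
  · intro f s hs hsf
    rw [hv f s hs]
    exact hV.outside f s hs hsf
  · intro f s s' hs hs' h
    rw [hv f s hs, hv f s' hs']
    simp only [hE _ s s' hs hs' h]
    exact hV.exact f s s' hs hs' h

end ClosedTriangulatedSurface

end BuffaChristiansen

end

/-! ### The theorem: independence, exterior derivative, existence and uniqueness -/

theorem mainTheorem3 {E : Type*} [NormedAddCommGroup E] [NormedSpace ℝ E]
    (T : BuffaChristiansen.ClosedTriangulatedSurface E)
    (o : BuffaChristiansen.Numbering T.faces)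
    (o' : BuffaChristiansen.Numbering (BuffaChristiansen.sdFaces T.faces))
    (σ : BuffaChristiansen.SurfaceOrientation T o) :
    (∀ r : ℕ, LinearIndependent ℝ
      (fun s : BuffaChristiansen.Cell T.faces r => BuffaChristiansen.whitneyBasis o s)) ∧
    (∀ r : ℕ, r ≤ 1 → ∀ s : BuffaChristiansen.Cell T.faces r,
      (BuffaChristiansen.whitneyBasis o s).d =
        ∑ t : BuffaChristiansen.Cell T.faces (r + 1),
          (BuffaChristiansen.incidence o s t : ℝ) • BuffaChristiansen.whitneyBasis o t) ∧
    ∃ R : BuffaChristiansen.Coeffs T,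
      (BuffaChristiansen.LocalSupport o' R ∧ BuffaChristiansen.EqualWeight o' σ R ∧
        BuffaChristiansen.Stability R ∧
        BuffaChristiansen.DiscreteExteriorDerivative o o' R) ∧
      (∀ (q r : ℕ) (h : q + r = 2), LinearIndependent ℝ
        (fun t : BuffaChristiansen.Cell T.faces r => BuffaChristiansen.bcForm o' R h t)) ∧
      ∀ R' : BuffaChristiansen.Coeffs T,
        (BuffaChristiansen.LocalSupport o' R' ∧ BuffaChristiansen.EqualWeight o' σ R' ∧
          BuffaChristiansen.Stability R' ∧
          BuffaChristiansen.DiscreteExteriorDerivative o o' R') → R' = R := by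
  obtain ⟨R, hR⟩ :=
    BuffaChristiansen.ClosedTriangulatedSurface.exists_isSolution σ o'
  refine ⟨fun r => BuffaChristiansen.linearIndependent_whitneyBasis T.isPureFamily o r,
    fun r hr s => BuffaChristiansen.d_whitneyBasis T.isPureFamily o hr s,
    R, ⟨hR.localSupport, hR.equalWeight, hR.stability, hR.discreteExteriorDerivative⟩,
    hR.linearIndependent, ?_⟩
  rintro R' ⟨hL, hW, hS, hD⟩
  exact hR.unique
    (BuffaChristiansen.ClosedTriangulatedSurface.isSolution_of_conditions hL hW hS hD)
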